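/- Let $0<r_i<r_e$. For $0<\epsilon<r_e-r_i$ put $\Omega=\{x\in\mathbb R^2:|x-(r_e,0)|<r_e\}$ and $D=\{x\in\mathbb R^2:|x-(r_i+\epsilon,0)|<r_i\}$, so that $\overline D\subset\Omega$ and $\epsilon=\operatorname{dist}(D,\partial\Omega)$. For $k>0$ and a mean-zero function $g_d$ on $\partial\Omega$ let $v$ be the solution of $$\Delta v=0\ \text{ in } D\cup(\Omega\setminus\overline D),\qquad v|_+=v|_-,\quad \frac{\partial v}{\partial\nu}\Big|_+=k\,\frac{\partial v}{\partial\nu}\Big|_-\ \text{ on }\partial D,\qquad v=g_d\ \text{ on }\partial\Omega,$$ that is, $v$ is continuous on $\overline\Omega$, harmonic in $D$ and in $\Omega\setminus\overline D$, takes the boundary values $g_d$, and its one-sided derivatives along the outward unit normal $\nu$ of $\partial D$, from outside ($+$) and from inside ($-$), exist and satisfy the stated relation. Let $$H_d(x)=\frac1\pi\int_{\partial\Omega}\frac{\partial}{\partial\nu_\zeta}\bigl(\ln|x-\zeta|\bigr)\,g_d(\zeta)\,d\sigma(\zeta),\qquad x\in\Omega,$$ be twice the double layer potential of $g_d$ (the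 harmonic function in $\Omega$ with boundary values $g_d$). Write $\|g_d\|_{C^{2,\delta}}$ for the maximum of $\sup|G|$, $\sup|G'|$, $\sup|G''|$ and of the $\delta$-Hölder seminorm of $G''$, where $G(t)=g_d(r_e+r_e\cos t,\,r_e\sin t)$. There is a constant $C>0$ depending only on $r_i,r_e$, and for every $\delta>1/2$ a constant $K\ge0$ depending only on $r_i,r_e,\delta$, such that the following holds for every mean-zero $g_d\in C^{2,\delta}(\partial\Omega)$. The limit $(C_1,C_2)=\lim_{\Omega\ni x\to(0,0)}\nabla H_d(x)$ exists, and: 1. (Upper bound.) For all $0<\epsilon<r_e-r_i$ and all $k>0$, $$\|\nabla v\|_{L^\infty(\Omega\setminus\overline D)}\le C\,\frac{|C_1|+|C_2|}{\frac1k+\sqrt\epsilon}+K\,\|g_d\|_{C^{2,\delta}}.$$ If $(C_1,C_2)\ne(0,0)$, there are moreover $\epsilon_0,k_0>0$ (depending on $g_d$, $r_i$, $r_e$, $\delta$) such that for all $\epsilon<\epsilon_0$, $\epsilon<r_e-r_i$, and all $k>k_0$, $$\|\nabla v\|_{L^\infty(\Omega\setminus\overline D)}\le C\,\frac{|C_1|+|C_2|}{\frac1k+\sqrt\epsilon}.$$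 2. (Optimality.) If $C_1C_2=0$, then for every $M>0$ there is $\epsilon_0>0$ (depending on $M$, $g_d$, $r_i$, $r_e$, $\delta$) such that for all $\epsilon<\epsilon_0$, $\epsilon<r_e-r_i$, and all $k>0$ with $\epsilon^{-1}\le Mk^2$, $$\|\nabla v\|_{L^\infty(\Omega\setminus\overline D)}\ge\frac{|C_1|+|C_2|}{C\left(\frac1k+\sqrt\epsilon\right)}.$$ -/

import Mathlib

open Set Filter Topology MeasureTheory

noncomputable section

namespace NearlyTouchingDisks

/-! The plane `ℝ²` is identified with `ℂ` (as a real inner product space): the point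
`(x₁, x₂)` is `x₁ + i x₂`. In particular the gradient of a real function is a complex number. -/

/-- The exterior disk of radius `re`, whose boundary passes through the origin. -/
def Omega (re : ℝ) : Set ℂ := Metric.ball (re : ℂ) re

/-- The centre of the inclusion. -/
def centreD (ri ε : ℝ) : ℂ := ((ri + ε : ℝ) : ℂ)

/-- The inclusion: the disk of radius `ri` at distance `ε` from the origin. -/
def Incl (ri ε : ℝ) : Set ℂ := Metric.ball (centreD ri ε) ri

/-- The region between the inclusion and the exterior circle. -/
def Gap (re ri ε : ℝ) : Set ℂ := Omega re \ closure (Incl ri ε)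

/-- The boundary datum as a `2π`-periodic function of the angle on `∂Ω`. -/
def angular (re : ℝ) (g : ℂ → ℝ) : ℝ → ℝ := fun t => g (circleMap (re : ℂ) re t)

/-- `g` belongs to `C^{2,δ}(∂Ω)` with norm at most `A`, the norm being the maximum of the suprema
of `|G|`, `|G'|`, `|G''|` and of the `δ`-Hölder seminorm of `G''`, where `G` is `g` as a function
of the angle. -/
structure C2HolderBound (re δ A : ℝ) (g : ℂ → ℝ) : Prop where
  contDiff : ContDiff ℝ 2 (angular re g)
  bound : ∀ j ≤ 2, ∀ t, |iteratedDeriv j (angular re g) t| ≤ A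
  holder : ∀ s t, |iteratedDeriv 2 (angular re g) s - iteratedDeriv 2 (angular re g) t|
    ≤ A * |s - t| ^ δ

/-- The double layer potential on `∂Ω` with density `φ`:
`(2π)⁻¹ ∫_{∂Ω} ∂/∂ν_ζ (ln |x - ζ|) φ(ζ) dσ(ζ)`, where `ζ = re + re e^{it}`, `ν_ζ = e^{it}` and
`dσ = re dt`. -/
def doubleLayer (re : ℝ) (φ : ℂ → ℝ) (x : ℂ) : ℝ :=
  (2 * Real.pi)⁻¹ * ∫ t in (0 : ℝ)..(2 * Real.pi),
    fderiv ℝ (fun ζ : ℂ => Real.log ‖x - ζ‖) (circleMap (re : ℂ) re t) (circleMap 0 1 t)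
      * φ (circleMap (re : ℂ) re t) * re

/-- The harmonic function `H_d = 2 𝒟_{∂Ω}[g]` in `Ω`. -/
def Hd (re : ℝ) (g : ℂ → ℝ) (x : ℂ) : ℝ := 2 * doubleLayer re g x

/-- `v` solves the Dirichlet transmission problem: it is harmonic in the inclusion and in the gap,
continuous on the closed disk (so its traces from both sides of `∂D` agree), equal to `g` on `∂Ω`,
and its one-sided derivatives along the unit normal `ν` of `∂D` exist and satisfy
`∂v/∂ν|₊ = k ∂v/∂ν|₋`. -/
structure IsSolution (re ri ε k : ℝ) (g v : ℂ → ℝ) : Prop where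
  harmonic_incl : InnerProductSpace.HarmonicOnNhd v (Incl ri ε)
  harmonic_gap : InnerProductSpace.HarmonicOnNhd v (Gap re ri ε)
  continuousOn : ContinuousOn v (closure (Omega re))
  transmission : ∀ x ∈ frontier (Incl ri ε), ∃ dplus dminus : ℝ,
    HasDerivWithinAt (fun t : ℝ => v (x + t • (ri⁻¹ • (x - centreD ri ε)))) dplus (Ici 0) 0 ∧
    HasDerivWithinAt (fun t : ℝ => v (x + t • (ri⁻¹ • (x - centreD ri ε)))) dminus (Iic 0) 0 ∧
    dplus = k * dminus
  boundary : ∀ x ∈ frontier (Omega re), v x = g x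

/-- `‖∇v‖_{L^∞(Ω \ D̄)}`, as an extended nonnegative number. -/
def gapGradNorm (re ri ε : ℝ) (v : ℂ → ℝ) : ENNReal :=
  eLpNorm (gradient v) ⊤ (volume.restrict (Gap re ri ε))

end NearlyTouchingDisks

end

/-! The function $H_d$ is the real part of a holomorphic $h$ on $\Omega$. Integrating by parts in
its Cauchy integral shows that $f=h'$ is bounded and Lipschitz on $\Omega$, with constants
controlled by the $C^{2,\delta}$ norm (`exists_dirichletData`). Hence $f$ has a limit $f_0$ at the
origin and $\nabla H_d=\bar f$ tends to $\bar f_0$.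

The transmission problem is solved by the method of images. The circles $\partial\Omega$ and
$\partial D$ have a common pair of inverse points $b<0<a$, and $\varphi=(z-a)/(z-b)$ makes them
concentric. There the composition of the two reflections is multiplication by some $\mu<1$ with
$1-\mu\asymp\sqrt\epsilon$. Let $T$ be this map in the plane, $R$ the reflection across $\partial D$
and $q=(k-1)/(k+1)$. Then $U=\sum q^n\,h\circ T^n$ satisfies $U=h+q\,U\circ T$, and the solution is
$(1-q)\,\mathrm{Re}\,U$ in $D$ and $\mathrm{Re}(U-q\,U\circ R)$ outside: $R=T$ on $\partial\Omega$
gives the Dirichlet datum, and $R=\mathrm{id}$ on $\partial D$ gives the jump relation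
(`isSolution_explicitSolution`). A maximum principle (`IsSolution.eqOn`) identifies every solution
with this one.

The gradient is therefore governed by $U'=\sum q^n w_n\, f\circ T^n$, where
$w_n=\mu^n(1-\varphi)^2/(1-\mu^n\varphi)^2$. When the gap is not wide, replacing $f$ by $f_0$ costs
a bounded multiple of the Lipschitz constant, uniformly in $\epsilon$ and $k$
(`norm_fieldSeries_sub_le`, `remainder_le`). What remains is $f_0S$ with $S=\sum q^nw_n$. For
$k\ge1$, $|w_n|\le4\mu^n$ gives $|S|\le4/(1-q\mu)$ and $1-q\mu\asymp 1/k+\sqrt\epsilon$. For $k\le1$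
the signs alternate and Abel summation bounds $S$ (`norm_weightSum_le_of_nonpos`).

For optimality the normal derivative is evaluated at one point of $\partial D$. If $f_0$ is real,
the point nearest the origin makes all weights positive (`exists_real_point`). If $f_0$ is
imaginary, a point slightly off the axis makes the relevant imaginary parts all nonnegative, and
about $1/(1-q\mu)$ of them are bounded below (`exists_imaginary_point`). -/

noncomputable section

namespace NearlyTouchingDisks

open scoped Real ComplexConjugate ENNReal

/-! ### Cauchy transforms of Hölder densities on the unit circle -/

section

/-- The Cauchy-type transform of a density on the unit circle. -/
def cauchyTransform (P : ℝ → ℂ) (y : ℂ) : ℂ :=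
  ∫ t in (0 : ℝ)..(2 * π), P t / (circleMap 0 1 t - y)

lemma norm_circleMap_zero_one (t : ℝ) : ‖circleMap 0 1 t‖ = 1 := by simp

lemma one_sub_norm_le_norm_circleMap_sub (t : ℝ) (y : ℂ) :
    1 - ‖y‖ ≤ ‖circleMap 0 1 t - y‖ := by
  have := norm_sub_norm_le (circleMap 0 1 t) y
  rwa [norm_circleMap_zero_one] at this

lemma circleMap_sub_ne_zero {y : ℂ} (hy : ‖y‖ < 1) (t : ℝ) : circleMap 0 1 t - y ≠ 0 := by
  have := one_sub_norm_le_norm_circleMap_sub t y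
  exact norm_pos_iff.1 (by linarith)

lemma continuous_div_circleMap_sub_pow {P : ℝ → ℂ} (hP : Continuous P) {y : ℂ} (hy : ‖y‖ < 1)
    (n : ℕ) : Continuous fun t => P t / (circleMap 0 1 t - y) ^ n :=
  hP.div (((continuous_circleMap 0 1).sub continuous_const).pow n)
    fun t => pow_ne_zero _ (circleMap_sub_ne_zero hy t)

lemma continuous_div_circleMap_sub {P : ℝ → ℂ} (hP : Continuous P) {y : ℂ} (hy : ‖y‖ < 1) :
    Continuous fun t => P t / (circleMap 0 1 t - y) := by
  simpa using continuous_div_circleMap_sub_pow hP hy 1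

lemma hasDerivAt_cauchyTransform {P : ℝ → ℂ} (hP : Continuous P) {y : ℂ} (hy : ‖y‖ < 1) :
    HasDerivAt (cauchyTransform P)
      (∫ t in (0 : ℝ)..(2 * π), P t / (circleMap 0 1 t - y) ^ 2) y := by
  obtain ⟨r, hyr, hr⟩ := exists_between hy
  have hs : Metric.ball (0 : ℂ) r ∈ 𝓝 y := Metric.isOpen_ball.mem_nhds (by simpa using hyr)
  have hlt : ∀ x ∈ Metric.ball (0 : ℂ) r, ‖x‖ < r := fun x hx => by simpa using hx
  refine (intervalIntegral.hasDerivAt_integral_of_dominated_loc_of_deriv_le (μ := volume)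
    (bound := fun t => ‖P t‖ / (1 - r) ^ 2)
    (F' := fun y t => P t / (circleMap 0 1 t - y) ^ 2) hs ?_ ?_ ?_ ?_ ?_ ?_).2
  · filter_upwards [hs] with x hx
    exact (continuous_div_circleMap_sub hP ((hlt x hx).trans hr)).aestronglyMeasurable
  · exact (continuous_div_circleMap_sub hP hy).intervalIntegrable _ _
  · exact (continuous_div_circleMap_sub_pow hP hy 2).aestronglyMeasurable
  · refine .of_forall fun t _ x hx => ?_
    rw [norm_div, norm_pow]
    have h1 := one_sub_norm_le_norm_circleMap_sub t x
    have h2 := hlt x hx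
    have : 0 < 1 - r := by linarith
    gcongr
    linarith
  · exact (hP.norm.div_const _).intervalIntegrable _ _
  · refine .of_forall fun t _ x hx => ?_
    have hne := circleMap_sub_ne_zero ((hlt x hx).trans hr) t
    convert! ((hasDerivAt_const x (P t)).div
      ((hasDerivAt_id x).const_sub (circleMap 0 1 t)) hne) using 1
    simp

/-- Since $\zeta=e^{it}$ has $\zeta'=i\zeta$, this is the vanishing of the integral of
$(Q/(\zeta-y))'$ over a period. It trades a derivative of the kernel for one of the density, so the
kernel never gets more singular. -/
lemma integral_circleMap_mul_div_sq {Q Q' : ℝ → ℂ} (hQ : ∀ t, HasDerivAt Q (Q' t) t)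
    (hQ' : Continuous Q') (hper : Function.Periodic Q (2 * π)) {y : ℂ} (hy : ‖y‖ < 1) :
    ∫ t in (0 : ℝ)..(2 * π), circleMap 0 1 t * Q t / (circleMap 0 1 t - y) ^ 2
      = -Complex.I * cauchyTransform Q' y := by
  have hQc : Continuous Q := continuous_iff_continuousAt.2 fun t => (hQ t).continuousAt
  have hd : ∀ t ∈ uIcc 0 (2 * π), HasDerivAt (fun t => Q t / (circleMap 0 1 t - y))
      (Q' t / (circleMap 0 1 t - y)
        - Complex.I * (circleMap 0 1 t * Q t / (circleMap 0 1 t - y) ^ 2)) t := by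
    intro t _
    have hne := circleMap_sub_ne_zero hy t
    convert! ((hQ t).div ((hasDerivAt_circleMap 0 1 t).sub_const y) hne) using 1
    field_simp
  have c1 := (continuous_div_circleMap_sub hQ' hy).intervalIntegrable (μ := volume) 0 (2 * π)
  have c2 : IntervalIntegrable
      (fun t => Complex.I * (circleMap 0 1 t * Q t / (circleMap 0 1 t - y) ^ 2))
      volume 0 (2 * π) :=
    (continuous_const.mul (continuous_div_circleMap_sub_pow
      ((continuous_circleMap 0 1).mul hQc) hy 2)).intervalIntegrable _ _
  have h := intervalIntegral.integral_eq_sub_of_hasDerivAt hd (c1.sub c2)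
  have h0 : Q (2 * π) = Q 0 := by simpa using hper 0
  have h1 : circleMap 0 1 (2 * π) = circleMap 0 1 0 := by simpa using periodic_circleMap 0 1 0
  rw [h0, h1, sub_self, intervalIntegral.integral_sub c1 c2,
    intervalIntegral.integral_const_mul] at h
  rw [cauchyTransform, sub_eq_zero.1 h, ← mul_assoc]
  simp

/-- On the unit circle the conjugate of $1/(\zeta-y)$ is $\zeta/(1-\bar y\zeta)$, which is
holomorphic on the closed disk and vanishes at $0$, so its mean is $0$. This permits subtracting
constants from a density. -/
lemma cauchyTransform_one {y : ℂ} (hy : ‖y‖ < 1) : cauchyTransform (fun _ => 1) y = 0 := by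
  have hden : ∀ ζ ∈ Metric.closedBall (0 : ℂ) 1, 1 - conj y * ζ ≠ 0 := by
    intro ζ hζ h
    have h1 : ‖conj y * ζ‖ = 1 := by rw [← sub_eq_zero.1 h, norm_one]
    rw [norm_mul, RCLike.norm_conj] at h1
    have h2 : ‖ζ‖ ≤ 1 := by simpa using hζ
    nlinarith [norm_nonneg y, norm_nonneg ζ]
  have hd : DiffContOnCl ℂ (fun ζ : ℂ => ζ / (1 - conj y * ζ)) (Metric.ball 0 |(1 : ℝ)|) := by
    apply DifferentiableOn.diffContOnCl
    rw [abs_one, closure_ball _ one_ne_zero]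
    exact differentiableOn_id.div (by fun_prop) hden
  have h := hd.circleAverage
  simp only [Real.circleAverage, zero_div] at h
  have h2 : ∫ t in (0 : ℝ)..(2 * π), conj (1 / (circleMap 0 1 t - y)) = 0 := by
    rw [smul_eq_zero] at h
    refine Eq.trans (intervalIntegral.integral_congr fun t _ => ?_)
      (h.resolve_left (inv_ne_zero Real.two_pi_pos.ne'))
    have h3 : circleMap 0 1 t * conj (circleMap 0 1 t) = 1 := by
      rw [Complex.mul_conj, Complex.normSq_eq_norm_sq, norm_circleMap_zero_one]; simp
    have h4 : conj (circleMap 0 1 t) - conj y ≠ 0 := by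
      rw [← map_sub]
      exact (map_ne_zero _).2 (circleMap_sub_ne_zero hy t)
    have h5 := hden (circleMap 0 1 t) (by simp)
    simp only [map_div₀, map_one, map_sub]
    rw [div_eq_div_iff h4 h5]
    linear_combination -h3
  rw [cauchyTransform]
  have h6 : ∫ t in (0 : ℝ)..(2 * π), conj (1 / (circleMap 0 1 t - y))
      = conj (∫ t in (0 : ℝ)..(2 * π), 1 / (circleMap 0 1 t - y)) := by
    simp only [intervalIntegral.integral_of_le Real.two_pi_pos.le]
    exact integral_conj
  rw [h6] at h2
  simpa using h2

/-- The chord $2|\sin(\tau/2)|$ is at least $2|\tau|/\pi$. Going through $e^{is}$, it is at most the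
distance in question plus $1-r$, hence at most twice that distance. The bound is uniform in $r$. -/
lemma abs_div_pi_le_norm_circleMap_sub (s τ r : ℝ) (hr0 : 0 ≤ r) (hr : r ≤ 1) (hτ : |τ| ≤ π) :
    |τ| / π ≤ ‖circleMap 0 1 (s + τ) - r * circleMap 0 1 s‖ := by
  have h1 : ‖circleMap 0 1 (s + τ) - circleMap 0 1 s‖ = 2 * |Real.sin (τ / 2)| := by
    have : circleMap 0 1 (s + τ) - circleMap 0 1 s
        = circleMap 0 1 s * (Complex.exp (Complex.I * τ) - 1) := by
      simp only [circleMap, zero_add, Complex.ofReal_one, one_mul, Complex.ofReal_add, mul_sub,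
        ← Complex.exp_add, mul_one]
      ring_nf
    rw [this, norm_mul, norm_circleMap_zero_one, one_mul,
      Complex.norm_exp_I_mul_ofReal_sub_one]
    simp
  have h2 := Real.mul_abs_le_abs_sin (x := τ / 2) (by rw [abs_div, abs_two]; linarith)
  rw [abs_div, abs_two] at h2
  have h3 : ‖circleMap 0 1 s - r * circleMap 0 1 s‖ = 1 - r := by
    rw [← one_sub_mul, norm_mul, norm_circleMap_zero_one, mul_one, ← Complex.ofReal_one,
      ← Complex.ofReal_sub, Complex.norm_real, Real.norm_of_nonneg (by linarith)]
  have h4 : 1 - r ≤ ‖circleMap 0 1 (s + τ) - r * circleMap 0 1 s‖ := by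
    have := one_sub_norm_le_norm_circleMap_sub (s + τ) (r * circleMap 0 1 s)
    rwa [norm_mul, norm_circleMap_zero_one, mul_one, Complex.norm_real,
      Real.norm_of_nonneg hr0] at this
  have h5 := norm_sub_le_norm_sub_add_norm_sub (circleMap 0 1 (s + τ)) (r * circleMap 0 1 s)
    (circleMap 0 1 s)
  rw [norm_sub_rev (r * circleMap 0 1 s), h1, h3] at h5
  have h6 : 2 / π * (|τ| / 2) = |τ| / π := by ring
  linarith

lemma intervalIntegrable_abs_rpow {r : ℝ} (hr : -1 < r) (b : ℝ) :
    IntervalIntegrable (fun τ : ℝ => |τ| ^ r) volume (-b) b := by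
  have hp : ∀ b : ℝ, 0 ≤ b → IntervalIntegrable (fun τ : ℝ => |τ| ^ r) volume 0 b := by
    intro b hb
    refine (intervalIntegral.intervalIntegrable_rpow' hr).congr fun x hx => ?_
    rw [uIoc_of_le hb] at hx
    simp only [abs_of_pos hx.1]
  have hn : ∀ b : ℝ, IntervalIntegrable (fun τ : ℝ => |τ| ^ r) volume 0 b := by
    intro b
    rcases le_total 0 b with hb | hb
    · exact hp b hb
    · rw [IntervalIntegrable.iff_comp_neg]
      simpa using hp (-b) (by linarith)
  exact (hn (-b)).symm.trans (hn b)

/-- The constant of the boundedness of the Cauchy transform on Hölder densities. -/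
def holderConst (δ : ℝ) : ℝ := ∫ τ in (-π)..π, π * (1 + |τ| ^ (δ - 1))

lemma holderConst_nonneg (δ : ℝ) : 0 ≤ holderConst δ := by
  apply intervalIntegral.integral_nonneg (by linarith [Real.pi_pos])
  intro τ _
  positivity

lemma exists_circleMap_eq (y : ℂ) : ∃ s : ℝ, y = ‖y‖ * circleMap 0 1 s :=
  ⟨y.arg, by simp [circleMap]⟩

lemma integral_two_pi_eq_integral_shift {E : Type*} [NormedAddCommGroup E] [NormedSpace ℝ E]
    {F : ℝ → E} (hF : Function.Periodic F (2 * π)) (s : ℝ) :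
    ∫ t in (0 : ℝ)..(2 * π), F t = ∫ τ in (-π)..π, F (s + τ) := by
  rw [intervalIntegral.integral_comp_add_left]
  have := hF.intervalIntegral_add_eq 0 (s + -π)
  rw [zero_add] at this
  rw [this]
  congr 1
  ring

/-- With $s$ the argument of $y$, `cauchyTransform_one` replaces $P$ by $P-P(s)$. Its modulus of
continuity then compensates the denominator $|\tau|/\pi$, leaving the integrable
$1+|\tau|^{\delta-1}$, uniformly up to the boundary. -/
lemma norm_cauchyTransform_le {P : ℝ → ℂ} (hP : Continuous P)
    (hper : Function.Periodic P (2 * π)) {B δ : ℝ} (hδ : 0 < δ)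
    (hB : ∀ s τ, |τ| ≤ π → ‖P (s + τ) - P s‖ ≤ B * (|τ| + |τ| ^ δ)) {y : ℂ} (hy : ‖y‖ < 1) :
    ‖cauchyTransform P y‖ ≤ B * holderConst δ := by
  obtain ⟨s, hs⟩ := exists_circleMap_eq y
  have hB0 : 0 ≤ B := by
    have h := (norm_nonneg _).trans (hB 0 1 (by rw [abs_one]; linarith [Real.pi_gt_three]))
    rw [abs_one, Real.one_rpow] at h
    linarith
  have h1 : cauchyTransform P y
      = ∫ t in (0 : ℝ)..(2 * π), (P t - P s) / (circleMap 0 1 t - y) := by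
    have c2 := (continuous_div_circleMap_sub (P := fun _ => P s) continuous_const
      hy).intervalIntegrable (μ := volume) 0 (2 * π)
    have c1 := (continuous_div_circleMap_sub hP hy).intervalIntegrable (μ := volume) 0 (2 * π)
    have h0 : ∫ t in (0 : ℝ)..(2 * π), P s / (circleMap 0 1 t - y) = 0 := by
      have := cauchyTransform_one hy
      rw [cauchyTransform] at this
      simp_rw [div_eq_mul_one_div (P s)]
      rw [intervalIntegral.integral_const_mul, this, mul_zero]
    simp_rw [sub_div]
    rw [intervalIntegral.integral_sub c1 c2, h0, sub_zero, cauchyTransform]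
  rw [h1, integral_two_pi_eq_integral_shift (s := s)]
  swap
  · intro t
    simp only
    rw [hper t, periodic_circleMap 0 1 t]
  rw [holderConst, ← intervalIntegral.integral_const_mul]
  refine intervalIntegral.norm_integral_le_of_norm_le (by linarith [Real.pi_pos])
    (.of_forall fun τ hτ => ?_) ?_
  · have hτ' : |τ| ≤ π := abs_le.2 ⟨hτ.1.le, hτ.2⟩
    rw [norm_div]
    have h2 := abs_div_pi_le_norm_circleMap_sub s τ ‖y‖ (norm_nonneg _) hy.le hτ'
    rw [← hs] at h2
    rcases eq_or_ne τ 0 with h0 | h0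
    · simp only [h0, add_zero, sub_self, norm_zero, zero_div]
      positivity
    · have hpos : 0 < |τ| := abs_pos.2 h0
      calc ‖P (s + τ) - P s‖ / ‖circleMap 0 1 (s + τ) - y‖
          ≤ B * (|τ| + |τ| ^ δ) / (|τ| / π) := by
            gcongr
            exact hB s τ hτ'
        _ = B * (π * (1 + |τ| ^ (δ - 1))) := by
            rw [Real.rpow_sub_one hpos.ne']
            field_simp
  · refine IntervalIntegrable.const_mul (IntervalIntegrable.const_mul
      ((intervalIntegrable_const (μ := volume)).add
        (intervalIntegrable_abs_rpow (by linarith) π)) π) B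

end

/-! ### The harmonic extension as the real part of a complex potential -/

section

lemma periodic_angular (re : ℝ) (g : ℂ → ℝ) : Function.Periodic (angular re g) (2 * π) := by
  intro t
  simp only [angular]
  rw [periodic_circleMap]

lemma _root_.Function.Periodic.deriv_of_hasDerivAt {G G' : ℝ → ℝ} {c : ℝ}
    (hper : Function.Periodic G c) (hG : ∀ t, HasDerivAt G (G' t) t) : Function.Periodic G' c := by
  intro t
  have h1 := (hG (t + c)).comp_add_const t c
  have h2 : (fun x => G (x + c)) = G := funext hper
  rw [h2] at h1
  exact h1.unique (hG t)

namespace C2HolderBound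

variable {re δ A : ℝ} {g : ℂ → ℝ}

lemma nonneg (hg : C2HolderBound re δ A g) : 0 ≤ A :=
  (abs_nonneg _).trans (hg.bound 0 (by norm_num) 0)

lemma hasDerivAt (hg : C2HolderBound re δ A g) (t : ℝ) :
    HasDerivAt (angular re g) (deriv (angular re g) t) t :=
  (hg.contDiff.differentiable (by norm_num) t).hasDerivAt

lemma hasDerivAt_deriv (hg : C2HolderBound re δ A g) (t : ℝ) :
    HasDerivAt (deriv (angular re g)) (iteratedDeriv 2 (angular re g) t) t := by
  have h : ContDiff ℝ 1 (deriv (angular re g)) := by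
    have := hg.contDiff
    rw [show (2 : WithTop ℕ∞) = 1 + 1 by norm_num, contDiff_succ_iff_deriv] at this
    exact this.2.2
  have h2 := (h.differentiable (by norm_num) t).hasDerivAt
  rwa [show iteratedDeriv 2 (angular re g) t = deriv (deriv (angular re g)) t by
    rw [iteratedDeriv_succ, iteratedDeriv_one]]

lemma continuous_iteratedDeriv (hg : C2HolderBound re δ A g) :
    Continuous (iteratedDeriv 2 (angular re g)) :=
  hg.contDiff.continuous_iteratedDeriv 2 le_rfl

lemma abs_deriv_le (hg : C2HolderBound re δ A g) (t : ℝ) : |deriv (angular re g) t| ≤ A := by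
  simpa [iteratedDeriv_one] using hg.bound 1 (by norm_num) t

lemma abs_angular_sub_le (hg : C2HolderBound re δ A g) (s τ : ℝ) :
    |angular re g (s + τ) - angular re g s| ≤ A * |τ| := by
  simpa using convex_univ.norm_image_sub_le_of_norm_hasDerivWithin_le (C := A)
    (fun x _ => (hg.hasDerivAt x).hasDerivWithinAt) (fun x _ => hg.abs_deriv_le x)
    (mem_univ s) (mem_univ (s + τ))

lemma abs_deriv_sub_le (hg : C2HolderBound re δ A g) (s τ : ℝ) :
    |deriv (angular re g) (s + τ) - deriv (angular re g) s| ≤ A * |τ| := by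
  simpa using convex_univ.norm_image_sub_le_of_norm_hasDerivWithin_le (C := A)
    (fun x _ => (hg.hasDerivAt_deriv x).hasDerivWithinAt)
    (fun x _ => hg.bound 2 le_rfl x) (mem_univ s) (mem_univ (s + τ))

end C2HolderBound

/-- The holomorphic function in `Omega re` whose real part is `Hd re g`. -/
def complexPotential (re : ℝ) (g : ℂ → ℝ) (z : ℂ) : ℂ :=
  (π : ℂ)⁻¹ * cauchyTransform (fun t => circleMap 0 1 t * angular re g t) ((z - re) / re)

/-- The derivative of `complexPotential`. -/
def complexField (re : ℝ) (g : ℂ → ℝ) (z : ℂ) : ℂ :=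
  (π : ℂ)⁻¹ * (-Complex.I * cauchyTransform (fun t => ((deriv (angular re g) t : ℝ) : ℂ))
    ((z - re) / re) / re)

/-- The derivative of `e^{-it} G'(t)`. -/
def twistedDeriv (re : ℝ) (g : ℂ → ℝ) (t : ℝ) : ℂ :=
  (circleMap 0 1 t)⁻¹ *
    (iteratedDeriv 2 (angular re g) t - Complex.I * deriv (angular re g) t)

section

variable {re δ A : ℝ} {g : ℂ → ℝ}

lemma norm_sub_div_lt_one (hre : 0 < re) {z : ℂ} (hz : z ∈ Omega re) : ‖(z - re) / re‖ < 1 := by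
  rw [norm_div, Complex.norm_real, Real.norm_of_nonneg hre.le, div_lt_one hre]
  exact mem_ball_iff_norm.1 hz

lemma hasDerivAt_cauchyTransform_comp (z : ℂ) {P : ℝ → ℂ} {P' : ℂ}
    (h : HasDerivAt (cauchyTransform P) P' ((z - re) / re)) :
    HasDerivAt (fun z : ℂ => cauchyTransform P ((z - re) / re)) (P' / re) z := by
  have h1 : HasDerivAt (fun z : ℂ => (z - re) / re) (1 / re) z :=
    ((hasDerivAt_id z).sub_const _).div_const _
  convert! h.comp z h1 using 1
  ring

/-- The factor $e^{it}$ in the density is exactly the one that the integration by parts requires. -/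
lemma hasDerivAt_complexPotential (hre : 0 < re) (hg : C2HolderBound re δ A g) {z : ℂ}
    (hz : z ∈ Omega re) : HasDerivAt (complexPotential re g) (complexField re g z) z := by
  have hy := norm_sub_div_lt_one hre hz
  have hG : ∀ t, HasDerivAt (fun t => (angular re g t : ℂ)) ((deriv (angular re g) t : ℝ) : ℂ) t :=
    fun t => (hg.hasDerivAt t).ofReal_comp
  have hG' : Continuous fun t => ((deriv (angular re g) t : ℝ) : ℂ) :=
    Complex.continuous_ofReal.comp
      (continuous_iff_continuousAt.2 fun t => (hg.hasDerivAt_deriv t).continuousAt)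
  have hc : Continuous fun t => circleMap 0 1 t * (angular re g t : ℂ) :=
    (continuous_circleMap 0 1).mul
      (continuous_iff_continuousAt.2 fun t => (hG t).continuousAt)
  have h := hasDerivAt_cauchyTransform hc hy
  rw [integral_circleMap_mul_div_sq hG hG' (fun t => by rw [periodic_angular]) hy] at h
  exact (hasDerivAt_cauchyTransform_comp z h).const_mul _

lemma hasDerivAt_inv_circleMap_mul_deriv (hg : C2HolderBound re δ A g) (t : ℝ) :
    HasDerivAt (fun t => (circleMap 0 1 t)⁻¹ * ((deriv (angular re g) t : ℝ) : ℂ))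
      (twistedDeriv re g t) t := by
  have hne : circleMap 0 1 t ≠ 0 := circleMap_ne_center one_ne_zero
  convert! ((hasDerivAt_circleMap 0 1 t).inv hne).mul (hg.hasDerivAt_deriv t).ofReal_comp using 1
  simp only [twistedDeriv, Pi.inv_apply]
  field_simp
  ring

lemma continuous_twistedDeriv (hg : C2HolderBound re δ A g) : Continuous (twistedDeriv re g) := by
  have h1 : Continuous (deriv (angular re g)) :=
    continuous_iff_continuousAt.2 fun t => (hg.hasDerivAt_deriv t).continuousAt
  have h2 := hg.continuous_iteratedDeriv
  unfold twistedDeriv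
  exact ((continuous_circleMap 0 1).inv₀ fun t => circleMap_ne_center one_ne_zero).mul
    (by fun_prop)

/-- The density $G'$ lacks the factor $e^{it}$; writing it as $e^{it}\cdot e^{-it}G'$ allows a
second integration by parts and explains `twistedDeriv`. -/
lemma hasDerivAt_complexField (hre : 0 < re) (hg : C2HolderBound re δ A g) {z : ℂ}
    (hz : z ∈ Omega re) : HasDerivAt (complexField re g)
      (-(π : ℂ)⁻¹ * cauchyTransform (twistedDeriv re g) ((z - re) / re) / re ^ 2) z := by
  have hy := norm_sub_div_lt_one hre hz
  have hper := (periodic_angular re g).deriv_of_hasDerivAt hg.hasDerivAt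
  have hQ : Function.Periodic (fun t => (circleMap 0 1 t)⁻¹ * ((deriv (angular re g) t : ℝ) : ℂ))
      (2 * π) := fun t => by
    simp only
    rw [hper t, periodic_circleMap]
  have hG' : Continuous fun t => ((deriv (angular re g) t : ℝ) : ℂ) :=
    Complex.continuous_ofReal.comp
      (continuous_iff_continuousAt.2 fun t => (hg.hasDerivAt_deriv t).continuousAt)
  have h := hasDerivAt_cauchyTransform hG' hy
  have h1 : ∀ t, ((deriv (angular re g) t : ℝ) : ℂ)
      = circleMap 0 1 t * ((circleMap 0 1 t)⁻¹ * ((deriv (angular re g) t : ℝ) : ℂ)) := fun t => by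
    rw [mul_inv_cancel_left₀ (circleMap_ne_center one_ne_zero)]
  have h2 : ∫ t in (0 : ℝ)..(2 * π), ((deriv (angular re g) t : ℝ) : ℂ)
        / (circleMap 0 1 t - (z - re) / re) ^ 2
      = -Complex.I * cauchyTransform (twistedDeriv re g) ((z - re) / re) := by
    rw [← integral_circleMap_mul_div_sq (hasDerivAt_inv_circleMap_mul_deriv hg)
      (continuous_twistedDeriv hg) hQ hy]
    exact intervalIntegral.integral_congr fun t _ => by rw [← h1]
  rw [h2] at h
  convert! (((hasDerivAt_cauchyTransform_comp z h).const_mul (-Complex.I)).div_const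
    (re : ℂ)).const_mul (π : ℂ)⁻¹ using 1
  linear_combination (π : ℂ)⁻¹ * cauchyTransform (twistedDeriv re g) ((z - re) / re) / re ^ 2
    * (-Complex.I_mul_I)

/-- Product rule for differences: $e^{-it}$ is 1-Lipschitz against a factor of size at most $2A$,
and $G''-iG'$ varies by at most $A(|\tau|+|\tau|^\delta)$. -/
lemma norm_twistedDeriv_sub_le (hg : C2HolderBound re δ A g) (s τ : ℝ) :
    ‖twistedDeriv re g (s + τ) - twistedDeriv re g s‖ ≤ 3 * A * (|τ| + |τ| ^ δ) := by
  set X : ℝ → ℂ := fun t => iteratedDeriv 2 (angular re g) t - Complex.I * deriv (angular re g) t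
    with hX
  have hA := hg.nonneg
  have h1 : ‖X (s + τ)‖ ≤ 2 * A := by
    refine (norm_sub_le _ _).trans ?_
    rw [norm_mul, Complex.norm_I, one_mul, Complex.norm_real, Complex.norm_real]
    have h1 := hg.bound 2 le_rfl (s + τ)
    have h2 := hg.abs_deriv_le (s + τ)
    simp only [Real.norm_eq_abs]
    linarith
  have h2 : ‖X (s + τ) - X s‖ ≤ A * |τ| ^ δ + A * |τ| := by
    have : X (s + τ) - X s
        = ((iteratedDeriv 2 (angular re g) (s + τ) - iteratedDeriv 2 (angular re g) s : ℝ) : ℂ)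
          - Complex.I * ((deriv (angular re g) (s + τ) - deriv (angular re g) s : ℝ) : ℂ) := by
      simp only [hX]
      push_cast
      ring
    rw [this]
    refine (norm_sub_le _ _).trans ?_
    rw [norm_mul, Complex.norm_I, one_mul, Complex.norm_real, Complex.norm_real]
    have h1 := hg.holder (s + τ) s
    rw [add_sub_cancel_left] at h1
    exact add_le_add h1 (hg.abs_deriv_sub_le s τ)
  have h3 : ‖(circleMap 0 1 (s + τ))⁻¹ - (circleMap 0 1 s)⁻¹‖ ≤ |τ| := by
    rw [inv_sub_inv (circleMap_ne_center one_ne_zero) (circleMap_ne_center one_ne_zero), norm_div,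
      norm_mul, norm_circleMap_zero_one, norm_circleMap_zero_one, mul_one, div_one]
    have := (lipschitzWith_circleMap 0 1).dist_le_mul s (s + τ)
    simpa [dist_eq_norm] using this
  have h4 : twistedDeriv re g (s + τ) - twistedDeriv re g s
      = ((circleMap 0 1 (s + τ))⁻¹ - (circleMap 0 1 s)⁻¹) * X (s + τ)
        + (circleMap 0 1 s)⁻¹ * (X (s + τ) - X s) := by
    simp only [twistedDeriv, hX]
    ring
  rw [h4]
  refine (norm_add_le _ _).trans ?_
  rw [norm_mul, norm_mul, norm_inv, norm_circleMap_zero_one, inv_one, one_mul]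
  have h5 : 0 ≤ |τ| ^ δ := by positivity
  have h6 := mul_le_mul h3 h1 (norm_nonneg _) (abs_nonneg _)
  nlinarith [mul_nonneg hA h5]

lemma norm_complexField_le (hre : 0 < re) (hδ : 0 < δ) (hg : C2HolderBound re δ A g) {z : ℂ}
    (hz : z ∈ Omega re) : ‖complexField re g z‖ ≤ holderConst δ / (π * re) * A := by
  have hy := norm_sub_div_lt_one hre hz
  have hper := (periodic_angular re g).deriv_of_hasDerivAt hg.hasDerivAt
  have hG' : Continuous fun t => ((deriv (angular re g) t : ℝ) : ℂ) :=
    Complex.continuous_ofReal.comp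
      (continuous_iff_continuousAt.2 fun t => (hg.hasDerivAt_deriv t).continuousAt)
  have h := norm_cauchyTransform_le hG' (fun t => by simp only; rw [hper t]) (B := A) hδ
      (fun s τ _ => by
    rw [← Complex.ofReal_sub, Complex.norm_real]
    refine (hg.abs_deriv_sub_le s τ).trans ?_
    have := hg.nonneg
    gcongr
    exact le_add_of_nonneg_right (by positivity)) hy
  rw [complexField, norm_mul, norm_div, norm_mul, norm_neg, Complex.norm_I, one_mul, norm_inv,
    Complex.norm_real, Complex.norm_real, Real.norm_of_nonneg hre.le,
    Real.norm_of_nonneg Real.pi_pos.le]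
  calc π⁻¹ * (_ / re) ≤ π⁻¹ * (A * holderConst δ / re) := by gcongr
    _ = _ := by field_simp

lemma norm_complexField_sub_le (hre : 0 < re) (hδ : 0 < δ) (hg : C2HolderBound re δ A g) {z w : ℂ}
    (hz : z ∈ Omega re) (hw : w ∈ Omega re) :
    ‖complexField re g z - complexField re g w‖
      ≤ 3 * holderConst δ / (π * re ^ 2) * A * ‖z - w‖ := by
  refine (convex_ball (re : ℂ) re).norm_image_sub_le_of_norm_hasDerivWithin_le
    (fun x hx => (hasDerivAt_complexField hre hg hx).hasDerivWithinAt) (fun x hx => ?_) hw hz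
  have hy := norm_sub_div_lt_one hre hx
  have hper : Function.Periodic (twistedDeriv re g) (2 * π) := by
    have h1 := (periodic_angular re g).deriv_of_hasDerivAt hg.hasDerivAt
    have h2 := h1.deriv_of_hasDerivAt hg.hasDerivAt_deriv
    intro t
    rw [twistedDeriv, twistedDeriv, h1 t, h2 t, periodic_circleMap]
  have h := norm_cauchyTransform_le (continuous_twistedDeriv hg) hper hδ
    (fun s τ _ => norm_twistedDeriv_sub_le hg s τ) hy
  rw [norm_div, norm_mul, norm_neg, norm_inv, norm_pow, Complex.norm_real, Complex.norm_real,
    Real.norm_of_nonneg hre.le, Real.norm_of_nonneg Real.pi_pos.le]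
  calc π⁻¹ * _ / re ^ 2 ≤ π⁻¹ * (3 * A * holderConst δ) / re ^ 2 := by gcongr
    _ = _ := by field_simp

lemma fderiv_log_norm_sub {x ζ : ℂ} (h : x ≠ ζ) (e : ℂ) :
    fderiv ℝ (fun ζ : ℂ => Real.log ‖x - ζ‖) ζ e = (e / (ζ - x)).re := by
  have hne : ‖x - ζ‖ ≠ 0 := norm_ne_zero_iff.2 (sub_ne_zero.2 h)
  have h1 : HasFDerivAt (fun ζ : ℂ => x - ζ) (-ContinuousLinearMap.id ℝ ℂ) ζ :=
    (hasFDerivAt_id ζ).const_sub x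
  have h2 := ((h1.norm_sq).log (pow_ne_zero 2 hne)).const_mul (1 / 2 : ℝ)
  have h3 : (fun ζ : ℂ => Real.log ‖x - ζ‖) = fun ζ => 1 / 2 * Real.log (‖x - ζ‖ ^ 2) := by
    ext ζ
    rw [Real.log_pow]
    push_cast
    ring
  rw [h3, h2.fderiv]
  rw [Complex.div_re]
  have h4 : Complex.normSq (ζ - x) = ‖x - ζ‖ ^ 2 := by
    rw [Complex.normSq_eq_norm_sq, norm_sub_rev]
  rw [h4]
  simp [innerSL_apply_apply, Complex.inner]
  field_simp
  ring

lemma Hd_eq_re_complexPotential (hre : 0 < re) (hg : C2HolderBound re δ A g) {z : ℂ}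
    (hz : z ∈ Omega re) : Hd re g z = (complexPotential re g z).re := by
  have hy := norm_sub_div_lt_one hre hz
  have hre' : (re : ℂ) ≠ 0 := Complex.ofReal_ne_zero.2 hre.ne'
  have hc : Continuous fun t => circleMap 0 1 t * (angular re g t : ℂ) :=
    (continuous_circleMap 0 1).mul (Complex.continuous_ofReal.comp hg.contDiff.continuous)
  have h1 : (cauchyTransform (fun t => circleMap 0 1 t * angular re g t) ((z - re) / re)).re
      = ∫ t in (0 : ℝ)..(2 * π), (circleMap 0 1 t * angular re g t
        / (circleMap 0 1 t - (z - re) / re)).re := by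
    have hi := (continuous_div_circleMap_sub hc hy).intervalIntegrable (μ := volume) 0 (2 * π)
    have := Complex.reCLM.intervalIntegral_comp_comm hi
    simpa [cauchyTransform] using this.symm
  rw [Hd, doubleLayer, complexPotential, ← Complex.ofReal_inv, Complex.re_ofReal_mul, h1,
    ← mul_assoc]
  congr 1
  · field_simp
  refine intervalIntegral.integral_congr fun t _ => ?_
  have hne := circleMap_sub_ne_zero hy t
  have h2 : circleMap (re : ℂ) re t - z = re * (circleMap 0 1 t - (z - re) / re) := by
    have : circleMap (re : ℂ) re t = re + re * circleMap 0 1 t := by simp [circleMap]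
    rw [this]
    field_simp
    ring
  have h3 : z ≠ circleMap (re : ℂ) re t := by
    intro h
    rw [sub_eq_zero.2 h.symm] at h2
    exact mul_ne_zero hre' hne h2.symm
  rw [fderiv_log_norm_sub h3, h2]
  have h4 : circleMap 0 1 t / (re * (circleMap 0 1 t - (z - re) / re))
      = ((re⁻¹ : ℝ) : ℂ) * (circleMap 0 1 t / (circleMap 0 1 t - (z - re) / re)) := by
    push_cast
    field_simp
  have h5 : circleMap 0 1 t * angular re g t / (circleMap 0 1 t - (z - re) / re)
      = (angular re g t : ℂ) * (circleMap 0 1 t / (circleMap 0 1 t - (z - re) / re)) := by ring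
  rw [h4, h5, Complex.re_ofReal_mul, Complex.re_ofReal_mul]
  simp only [angular]
  field_simp

end

end

/-! ### Boundary values of the complex potential -/

section

/-- The Poisson kernel of the unit disk, at `r e^{is}` and `e^{it}`. -/
def unitPoisson (r s t : ℝ) : ℝ :=
  (1 - r ^ 2) / ‖circleMap 0 1 t - r * circleMap 0 1 s‖ ^ 2

lemma norm_ofReal_mul_circleMap {r : ℝ} (hr : 0 ≤ r) (s : ℝ) : ‖(r : ℂ) * circleMap 0 1 s‖ = r := by
  rw [norm_mul, norm_circleMap_zero_one, mul_one, Complex.norm_real, Real.norm_of_nonneg hr]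

lemma continuous_unitPoisson {r : ℝ} (hr0 : 0 ≤ r) (hr : r < 1) (s : ℝ) :
    Continuous (unitPoisson r s) := by
  unfold unitPoisson
  refine continuous_const.div
    (((continuous_circleMap 0 1).sub continuous_const).norm.pow 2) fun t => ?_
  have : ‖(r : ℂ) * circleMap 0 1 s‖ < 1 := by rwa [norm_ofReal_mul_circleMap hr0]
  exact pow_ne_zero _ (norm_ne_zero_iff.2 (circleMap_sub_ne_zero this t))

lemma unitPoisson_nonneg {r : ℝ} (hr0 : 0 ≤ r) (hr : r ≤ 1) (s t : ℝ) : 0 ≤ unitPoisson r s t := by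
  unfold unitPoisson
  have : 0 ≤ 1 - r ^ 2 := by nlinarith
  positivity

lemma integral_unitPoisson {r : ℝ} (hr0 : 0 ≤ r) (hr : r < 1) (s : ℝ) :
    ∫ t in (0 : ℝ)..(2 * π), unitPoisson r s t = 2 * π := by
  have h := DiffContOnCl.circleAverage_poissonKernel_smul (f := fun _ => (1 : ℂ)) (c := 0) (R := 1)
    (w := r * circleMap 0 1 s) diffContOnCl_const
    (by rw [mem_ball_zero_iff, norm_ofReal_mul_circleMap hr0]; exact hr)
  have h2 : ∫ t in (0 : ℝ)..(2 * π), ((unitPoisson r s t : ℝ) : ℂ) = 2 * π := by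
    rw [Real.circleAverage, Complex.real_smul] at h
    have h3 : ((2 * π : ℝ) : ℂ) ≠ 0 := Complex.ofReal_ne_zero.2 Real.two_pi_pos.ne'
    rw [Complex.ofReal_inv, inv_mul_eq_iff_eq_mul₀ h3, mul_one] at h
    rw [← Complex.ofReal_ofNat, ← Complex.ofReal_mul, ← h]
    refine intervalIntegral.integral_congr fun t _ => ?_
    simp only [unitPoisson, Pi.smul_apply', Complex.real_smul, mul_one, poissonKernel_def,
      sub_zero, norm_circleMap_zero_one, norm_ofReal_mul_circleMap hr0, one_pow]
  rw [intervalIntegral.integral_ofReal] at h2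
  exact_mod_cast h2

/-- If $N$ is the distance in the denominator, then $1-r^2\le2N$ and $|\tau|\le\pi N$. Against a
Lipschitz function the Poisson kernel is thus dominated by a constant. -/
lemma unitPoisson_mul_le {r : ℝ} (hr0 : 0 ≤ r) (hr : r < 1) (s τ : ℝ) (hτ : |τ| ≤ π) :
    unitPoisson r s (s + τ) * |τ| ≤ 2 * π := by
  have h1 := abs_div_pi_le_norm_circleMap_sub s τ r hr0 hr.le hτ
  have h2 := one_sub_norm_le_norm_circleMap_sub (s + τ) (r * circleMap 0 1 s)
  rw [norm_ofReal_mul_circleMap hr0] at h2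
  unfold unitPoisson
  set N := ‖circleMap 0 1 (s + τ) - r * circleMap 0 1 s‖
  have hN : 0 < N := by linarith
  rw [div_le_iff₀ Real.pi_pos] at h1
  rw [div_mul_eq_mul_div, div_le_iff₀ (by positivity)]
  have h3 : 1 - r ^ 2 ≤ 2 * N := by nlinarith
  calc (1 - r ^ 2) * |τ| ≤ 2 * N * (N * π) := by gcongr
    _ = _ := by ring

lemma tendsto_unitPoisson (s τ : ℝ) (hτ : |τ| ≤ π) (h0 : τ ≠ 0) :
    Tendsto (fun r : ℝ => unitPoisson r s (s + τ)) (𝓝[<] 1) (𝓝 0) := by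
  have hpos : 0 < |τ| := abs_pos.2 h0
  have h1 : Tendsto (fun r : ℝ => (1 - r ^ 2) / (|τ| / π) ^ 2) (𝓝[<] 1) (𝓝 0) := by
    have : Tendsto (fun r : ℝ => (1 - r ^ 2) / (|τ| / π) ^ 2) (𝓝 1)
        (𝓝 ((1 - 1 ^ 2) / (|τ| / π) ^ 2)) :=
      Continuous.tendsto (f := fun r : ℝ => (1 - r ^ 2) / (|τ| / π) ^ 2) (by fun_prop) 1
    simp only [one_pow, sub_self, zero_div] at this
    exact this.mono_left nhdsWithin_le_nhds
  have hev : ∀ᶠ r : ℝ in 𝓝[<] 1, 0 ≤ r ∧ r < 1 := by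
    filter_upwards [self_mem_nhdsWithin, mem_nhdsWithin_of_mem_nhds (Ici_mem_nhds one_pos)]
      with r h1 h2 using ⟨h2, h1⟩
  refine tendsto_of_tendsto_of_tendsto_of_le_of_le' tendsto_const_nhds h1 ?_ ?_
  · filter_upwards [hev] with r hr using unitPoisson_nonneg hr.1 hr.2.le _ _
  · filter_upwards [hev] with r hr
    have h2 := abs_div_pi_le_norm_circleMap_sub s τ r hr.1 hr.2.le hτ
    have : 0 ≤ 1 - r ^ 2 := by nlinarith [hr.1, hr.2]
    unfold unitPoisson
    have := Real.pi_pos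
    gcongr

lemma tendsto_integral_unitPoisson_mul {G : ℝ → ℝ} (hG : Continuous G)
    (hper : Function.Periodic G (2 * π)) {A : ℝ} (hA : ∀ s τ, |G (s + τ) - G s| ≤ A * |τ|)
    (s : ℝ) : Tendsto (fun r : ℝ => ∫ t in (0 : ℝ)..(2 * π), unitPoisson r s t * (G t - G s))
      (𝓝[<] 1) (𝓝 0) := by
  have hev : ∀ᶠ r : ℝ in 𝓝[<] 1, 0 ≤ r ∧ r < 1 := by
    filter_upwards [self_mem_nhdsWithin, mem_nhdsWithin_of_mem_nhds (Ici_mem_nhds one_pos)]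
      with r h1 h2 using ⟨h2, h1⟩
  have h1 : ∀ r : ℝ, ∫ t in (0 : ℝ)..(2 * π), unitPoisson r s t * (G t - G s)
      = ∫ τ in (-π)..π, unitPoisson r s (s + τ) * (G (s + τ) - G s) := fun r =>
    integral_two_pi_eq_integral_shift (fun t => by
      simp only [unitPoisson]
      rw [periodic_circleMap, hper]) s
  simp_rw [h1]
  have hA0 : 0 ≤ A := by
    have := (abs_nonneg _).trans (hA 0 1)
    rwa [abs_one, mul_one] at this
  have hmem : ∀ τ ∈ uIoc (-π) π, |τ| ≤ π := by
    intro τ hτ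
    rw [uIoc_of_le (by linarith [Real.pi_pos])] at hτ
    exact abs_le.2 ⟨hτ.1.le, hτ.2⟩
  have hlim := intervalIntegral.tendsto_integral_filter_of_dominated_convergence (μ := volume)
    (a := -π) (b := π) (l := 𝓝[<] (1 : ℝ)) (fun _ => A * (2 * π))
    (F := fun r τ => unitPoisson r s (s + τ) * (G (s + τ) - G s)) (f := fun _ => 0)
    (by
      filter_upwards [hev] with r hr
      exact Continuous.aestronglyMeasurable
        (((continuous_unitPoisson hr.1 hr.2 s).comp (continuous_const.add continuous_id)).mul
          ((hG.comp (continuous_const.add continuous_id)).sub continuous_const)))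
    (by
      filter_upwards [hev] with r hr
      refine .of_forall fun τ hτ => ?_
      rw [norm_mul, Real.norm_of_nonneg (unitPoisson_nonneg hr.1 hr.2.le _ _)]
      calc _ ≤ unitPoisson r s (s + τ) * (A * |τ|) := by
            gcongr
            · exact unitPoisson_nonneg hr.1 hr.2.le _ _
            · exact hA s τ
        _ = A * (unitPoisson r s (s + τ) * |τ|) := by ring
        _ ≤ _ := mul_le_mul_of_nonneg_left (unitPoisson_mul_le hr.1 hr.2 s τ (hmem τ hτ)) hA0)
    intervalIntegrable_const
    (by
      rw [← ae_restrict_iff' measurableSet_uIoc]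
      filter_upwards [ae_restrict_mem measurableSet_uIoc,
        ae_restrict_of_ae (compl_mem_ae_iff.2 (measure_singleton (0 : ℝ)))] with τ h1 h2
      simpa using (tendsto_unitPoisson s τ (hmem τ h1) h2).mul_const (G (s + τ) - G s))
  simpa using hlim

/-- On the circle $\mathrm{Re}\,\zeta/(\zeta-y)$ is half of one plus the Poisson kernel. The
mean-zero condition removes the constant half, so the potential has boundary values $g$ and not $g$
plus a constant. -/
lemma re_complexPotential_radial {re δ A : ℝ} {g : ℂ → ℝ} (hre : 0 < re)
    (hg : C2HolderBound re δ A g) (hmean : Real.circleAverage g (re : ℂ) re = 0) {r : ℝ}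
    (hr0 : 0 ≤ r) (hr : r < 1) (s : ℝ) :
    (complexPotential re g (re + re * (r * circleMap 0 1 s))).re - angular re g s
      = (2 * π)⁻¹ * ∫ t in (0 : ℝ)..(2 * π),
        unitPoisson r s t * (angular re g t - angular re g s) := by
  have hre' : (re : ℂ) ≠ 0 := Complex.ofReal_ne_zero.2 hre.ne'
  set y : ℂ := r * circleMap 0 1 s with hy_def
  have hyn : ‖y‖ = r := norm_ofReal_mul_circleMap hr0 s
  have hy : ‖y‖ < 1 := by rwa [hyn]
  have hGc : Continuous (angular re g) := hg.contDiff.continuous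
  have hPc := continuous_unitPoisson hr0 hr s
  have hc : Continuous fun t => circleMap 0 1 t * (angular re g t : ℂ) :=
    (continuous_circleMap 0 1).mul (Complex.continuous_ofReal.comp hGc)
  have h1 : (cauchyTransform (fun t => circleMap 0 1 t * angular re g t) y).re
      = ∫ t in (0 : ℝ)..(2 * π), (circleMap 0 1 t * angular re g t
        / (circleMap 0 1 t - y)).re := by
    have hi := (continuous_div_circleMap_sub hc hy).intervalIntegrable (μ := volume) 0 (2 * π)
    have := Complex.reCLM.intervalIntegral_comp_comm hi
    simpa [cauchyTransform] using this.symm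
  have h2 : ∀ t, (circleMap 0 1 t * angular re g t / (circleMap 0 1 t - y)).re
      = (1 / 2) * (angular re g t + (unitPoisson r s t * (angular re g t - angular re g s)
        + unitPoisson r s t * angular re g s)) := by
    intro t
    have hne := circleMap_sub_ne_zero hy t
    have h3 : circleMap 0 1 t * angular re g t / (circleMap 0 1 t - y)
        = ((angular re g t / 2 : ℝ) : ℂ)
          * (1 + (circleMap 0 1 t + y) / (circleMap 0 1 t - y)) := by
      push_cast
      field_simp
      ring
    have h4 : ((circleMap 0 1 t + y) / (circleMap 0 1 t - y)).re = unitPoisson r s t := by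
      have := congrFun (poissonKernel_eq_re_herglotzRieszKernel (c := 0) (w := y))
        (circleMap 0 1 t)
      rw [Function.comp_apply, herglotzRieszKernel_def, poissonKernel_def] at this
      simp only [sub_zero, norm_circleMap_zero_one, hyn, one_pow] at this
      rw [← this, unitPoisson]
    rw [h3, Complex.re_ofReal_mul, Complex.add_re, h4, Complex.one_re]
    ring
  have hm : ∫ t in (0 : ℝ)..(2 * π), angular re g t = 0 := by
    rw [Real.circleAverage, smul_eq_zero] at hmean
    exact hmean.resolve_left (inv_ne_zero Real.two_pi_pos.ne')
  have hi1 := hGc.intervalIntegrable (μ := volume) 0 (2 * π)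
  have hi2 : IntervalIntegrable
      (fun t => unitPoisson r s t * (angular re g t - angular re g s)) volume 0 (2 * π) :=
    (hPc.mul (hGc.sub continuous_const)).intervalIntegrable _ _
  have hi3 : IntervalIntegrable (fun t => unitPoisson r s t * angular re g s) volume 0 (2 * π) :=
    (hPc.mul continuous_const).intervalIntegrable _ _
  have h5 : complexPotential re g (re + re * y)
      = ((π⁻¹ : ℝ) : ℂ) * cauchyTransform (fun t => circleMap 0 1 t * angular re g t) y := by
    rw [complexPotential, add_sub_cancel_left, mul_div_cancel_left₀ _ hre', Complex.ofReal_inv]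
  rw [h5, Complex.re_ofReal_mul, h1]
  simp_rw [h2]
  rw [intervalIntegral.integral_const_mul, intervalIntegral.integral_add hi1 (hi2.add hi3),
    intervalIntegral.integral_add hi2 hi3, hm, intervalIntegral.integral_mul_const,
    integral_unitPoisson hr0 hr]
  field_simp
  ring

/-- The Dirichlet data of the unperturbed problem: a holomorphic potential `h` with Lipschitz
derivative `f`, whose real part extends continuously by the boundary datum. -/
structure DirichletData (re Λ : ℝ) (g : ℂ → ℝ) (h f : ℂ → ℂ) (H : ℂ → ℝ) : Prop where
  hasDerivAt : ∀ z ∈ Omega re, HasDerivAt h (f z) z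
  norm_le : ∀ z ∈ Omega re, ‖f z‖ ≤ Λ
  norm_sub_le : ∀ z ∈ Omega re, ∀ w ∈ Omega re, ‖f z - f w‖ ≤ Λ * ‖z - w‖
  continuous : Continuous H
  eq_re : ∀ z ∈ Omega re, H z = (h z).re
  boundary : ∀ z ∈ frontier (Omega re), H z = g z

/-- The bound on $f$ makes $\mathrm{Re}\,h$ Lipschitz on the convex set $\Omega$, so it extends
continuously to the plane. Radial limits then suffice to identify the extension on $\partial\Omega$.
-/
theorem exists_dirichletData {re δ : ℝ} (hre : 0 < re) (hδ : 0 < δ) : ∃ K : ℝ, 0 ≤ K ∧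
    ∀ (g : ℂ → ℝ) (A : ℝ), C2HolderBound re δ A g → Real.circleAverage g (re : ℂ) re = 0 →
      ∃ H, DirichletData re (K * A) g (complexPotential re g) (complexField re g) H := by
  set K := max (holderConst δ / (π * re)) (3 * holderConst δ / (π * re ^ 2)) with hK
  have hc := holderConst_nonneg δ
  refine ⟨K, le_max_of_le_left (by positivity), fun g A hg hmean => ?_⟩
  have hA := hg.nonneg
  have hb : ∀ z ∈ Omega re, ‖complexField re g z‖ ≤ K * A := fun z hz =>
    (norm_complexField_le hre hδ hg hz).trans (by gcongr; exact le_max_left _ _)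
  have hLip : LipschitzOnWith (K * A).toNNReal (fun z => (complexPotential re g z).re)
      (Omega re) := by
    refine LipschitzOnWith.of_dist_le_mul fun z hz w hw => ?_
    rw [Real.coe_toNNReal _ ((norm_nonneg _).trans (hb z hz)), dist_eq_norm, dist_eq_norm,
      ← Complex.sub_re]
    refine (Complex.abs_re_le_norm _).trans ?_
    exact (convex_ball (re : ℂ) re).norm_image_sub_le_of_norm_hasDerivWithin_le
      (fun x hx => (hasDerivAt_complexPotential hre hg hx).hasDerivWithinAt) hb hw hz
  obtain ⟨H, hH, hEq⟩ := hLip.extend_real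
  refine ⟨H, fun z hz => hasDerivAt_complexPotential hre hg hz, hb, fun z hz w hw => ?_,
    hH.continuous, fun z hz => (hEq hz).symm, fun z hz => ?_⟩
  · refine (norm_complexField_sub_le hre hδ hg hz hw).trans ?_
    gcongr
    exact le_max_right _ _
  · rw [Omega, frontier_ball _ hre.ne'] at hz
    obtain ⟨s, hs⟩ : ∃ s, circleMap (re : ℂ) re s = z := by
      have := range_circleMap (re : ℂ) re
      rw [abs_of_pos hre] at this
      rw [← this] at hz
      exact hz
    have hz' : z = re + re * ((1 : ℝ) * circleMap 0 1 s) := by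
      rw [← hs]
      simp [circleMap]
    have hev : ∀ᶠ r : ℝ in 𝓝[<] 1, 0 ≤ r ∧ r < 1 := by
      filter_upwards [self_mem_nhdsWithin, mem_nhdsWithin_of_mem_nhds (Ici_mem_nhds one_pos)]
        with r h1 h2 using ⟨h2, h1⟩
    have h1 : Tendsto (fun r : ℝ => H (re + re * (r * circleMap 0 1 s))) (𝓝[<] 1) (𝓝 (H z)) := by
      rw [hz']
      refine Tendsto.mono_left (Continuous.tendsto
        (f := fun r : ℝ => H (re + re * (r * circleMap 0 1 s))) ?_ 1) nhdsWithin_le_nhds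
      have := hH.continuous
      fun_prop
    have h2 := ((tendsto_integral_unitPoisson_mul hg.contDiff.continuous (periodic_angular re g)
      hg.abs_angular_sub_le s).const_mul (2 * π)⁻¹).add_const (angular re g s)
    rw [mul_zero, zero_add] at h2
    have h3 : angular re g s = g z := by rw [angular, hs]
    rw [← h3]
    refine tendsto_nhds_unique h1 (h2.congr' ?_)
    filter_upwards [hev] with r hr
    rw [← re_complexPotential_radial hre hg hmean hr.1 hr.2 s, sub_add_cancel]
    refine hEq ?_
    rw [Omega, mem_ball_iff_norm, add_sub_cancel_left, norm_mul, norm_ofReal_mul_circleMap hr.1,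
      Complex.norm_real, Real.norm_of_nonneg hre.le]
    nlinarith [hr.2]

end

/-! ### Maximum principle and uniqueness for the transmission problem -/

section

open InnerProductSpace

/-- Locally $v=\mathrm{Re}\,F$ with $F$ analytic, and the maximum modulus principle applies to
$e^F$, whose modulus is $e^v$. -/
lemma eventually_eq_of_harmonicAt_of_isLocalMax {v : ℂ → ℝ} {x : ℂ} (hv : HarmonicAt v x)
    (hmax : IsLocalMax v x) : ∀ᶠ y in 𝓝 x, v y = v x := by
  obtain ⟨R, hR, hball⟩ := Metric.eventually_nhds_iff_ball.1 hv.eventually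
  obtain ⟨F, hF, hEq⟩ := HarmonicOnNhd.exists_analyticOnNhd_ball_re_eq hball
  have hmem := Metric.ball_mem_nhds x hR
  have h1 : ∀ᶠ y in 𝓝 x, ‖Complex.exp (F y)‖ = Real.exp (v y) := by
    filter_upwards [hmem] with y hy
    rw [Complex.norm_exp, ← hEq hy]
  have h2 := Complex.eventually_eq_of_isLocalMax_norm (f := fun y => Complex.exp (F y)) (c := x)
    (by
      filter_upwards [hmem] with y hy
      exact (hF y hy).differentiableAt.cexp)
    (by
      filter_upwards [hmax, h1] with y h3 h4
      simp only [Function.comp_apply]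
      rw [h4, h1.self_of_nhds]
      exact Real.exp_le_exp.2 h3)
  filter_upwards [h1, h2] with y h3 h4
  rw [h4, h1.self_of_nhds] at h3
  exact (Real.exp_injective h3).symm

/-- The weak maximum principle for harmonic functions on bounded open sets of the plane. -/
lemma exists_mem_frontier_le_of_harmonicOnNhd {v : ℂ → ℝ} {S : Set ℂ} (hS : IsOpen S)
    (hb : Bornology.IsBounded S) (hv : HarmonicOnNhd v S) (hc : ContinuousOn v (closure S))
    {z : ℂ} (hz : z ∈ closure S) : ∃ y ∈ frontier S, v z ≤ v y := by
  have hK : IsCompact (closure S) := hb.isCompact_closure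
  obtain ⟨m, hm, hmax⟩ := hK.exists_isMaxOn ⟨z, hz⟩ hc
  -- Among the maximisers, one of largest real part is chosen. If it were interior, $v$ would be
  -- constant nearby and a shift to the right would give another maximiser; no connectedness is
  -- needed.
  have hK2 : IsCompact (closure S ∩ v ⁻¹' {v m}) :=
    hK.of_isClosed_subset (hc.preimage_isClosed_of_isClosed isClosed_closure isClosed_singleton)
      inter_subset_left
  obtain ⟨p, hp, hpmax⟩ := hK2.exists_isMaxOn ⟨m, hm, rfl⟩ Complex.continuous_re.continuousOn
  have hpv : v p = v m := hp.2
  refine ⟨p, ?_, (hmax hz).trans hpv.ge⟩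
  rw [frontier, hS.interior_eq]
  refine ⟨hp.1, fun hpS => ?_⟩
  have hloc : IsLocalMax v p := by
    filter_upwards [hS.mem_nhds hpS] with y hy
    exact (hmax (subset_closure hy)).trans hpv.ge
  have h1 := eventually_eq_of_harmonicAt_of_isLocalMax (hv p hpS) hloc
  have h2 := h1.and (hS.mem_nhds hpS)
  have ht : Tendsto (fun t : ℝ => p + t) (𝓝[>] 0) (𝓝 p) := by
    have : Tendsto (fun t : ℝ => p + t) (𝓝 0) (𝓝 (p + (0 : ℝ))) :=
      Continuous.tendsto (f := fun t : ℝ => p + t) (by fun_prop) 0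
    rw [Complex.ofReal_zero, add_zero] at this
    exact this.mono_left nhdsWithin_le_nhds
  obtain ⟨t, ⟨ht1, ht2⟩, ht3⟩ := ((ht.eventually h2).and self_mem_nhdsWithin).exists
  have h3 : (p + t).re ≤ p.re := hpmax ⟨subset_closure ht2, ht1.trans hpv⟩
  rw [Complex.add_re, Complex.ofReal_re] at h3
  have : (0 : ℝ) < t := ht3
  linarith

lemma nonpos_of_hasDerivWithinAt_Ici {f : ℝ → ℝ} {d : ℝ} (hd : HasDerivWithinAt f d (Ici 0) 0)
    (hmax : ∀ᶠ t in 𝓝 (0 : ℝ), f t ≤ f 0) : d ≤ 0 := by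
  have h := (hasDerivWithinAt_iff_tendsto_slope' (by simp)).1 (hd.mono Ioi_subset_Ici_self)
  refine le_of_tendsto h ?_
  filter_upwards [self_mem_nhdsWithin, mem_nhdsWithin_of_mem_nhds hmax] with t ht h1
  rw [slope_def_field, sub_zero]
  exact div_nonpos_of_nonpos_of_nonneg (sub_nonpos.2 h1) (le_of_lt ht)

lemma nonneg_of_hasDerivWithinAt_Iic {f : ℝ → ℝ} {d : ℝ} (hd : HasDerivWithinAt f d (Iic 0) 0)
    (hmax : ∀ᶠ t in 𝓝 (0 : ℝ), f t ≤ f 0) : 0 ≤ d := by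
  have h := (hasDerivWithinAt_iff_tendsto_slope' (by simp)).1 (hd.mono Iio_subset_Iic_self)
  refine ge_of_tendsto h ?_
  filter_upwards [self_mem_nhdsWithin, mem_nhdsWithin_of_mem_nhds hmax] with t ht h1
  rw [slope_def_field, sub_zero]
  exact div_nonneg_of_nonpos (sub_nonpos.2 h1) (le_of_lt ht)

section

variable {re ri ε k : ℝ} {g : ℂ → ℝ}

lemma closure_Incl (hri : 0 < ri) : closure (Incl ri ε) = Metric.closedBall (centreD ri ε) ri :=
  closure_ball _ hri.ne'

lemma closure_Incl_subset (hri : 0 < ri) (hε : 0 < ε) (hεr : ε < re - ri) :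
    closure (Incl ri ε) ⊆ Omega re := by
  rw [closure_Incl hri, Omega]
  refine Metric.closedBall_subset_ball' ?_
  rw [centreD, dist_comm, dist_eq_norm, ← Complex.ofReal_sub, Complex.norm_real,
    Real.norm_of_nonneg (by linarith)]
  linarith

lemma isOpen_Gap : IsOpen (Gap re ri ε) := Metric.isOpen_ball.sdiff isClosed_closure

lemma frontier_Gap_subset :
    frontier (Gap re ri ε) ⊆ frontier (Omega re) ∪ frontier (Incl ri ε) := by
  intro z hz
  rw [frontier, isOpen_Gap.interior_eq] at hz
  have hO : IsOpen (Omega re) := Metric.isOpen_ball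
  have hI : IsOpen (Incl ri ε) := Metric.isOpen_ball
  by_cases h : z ∈ Omega re
  · right
    rw [frontier, hI.interior_eq]
    refine ⟨by_contra fun h2 => hz.2 ⟨h, h2⟩, ?_⟩
    have : closure (Gap re ri ε) ⊆ (Incl ri ε)ᶜ :=
      closure_minimal (fun x hx hx2 => hx.2 (subset_closure hx2)) hI.isClosed_compl
    exact this hz.1
  · left
    rw [frontier, hO.interior_eq]
    exact ⟨closure_mono sdiff_subset hz.1, h⟩

lemma closure_Omega_subset : closure (Omega re) ⊆
    closure (Incl ri ε) ∪ closure (Gap re ri ε) := by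
  rw [← closure_union]
  intro z hz
  by_cases h : z ∈ closure (Incl ri ε)
  · exact closure_mono subset_union_left h
  · rw [mem_closure_iff_nhds] at hz ⊢
    intro t ht
    obtain ⟨y, hy1, hy2⟩ := hz (t ∩ (closure (Incl ri ε))ᶜ)
      (inter_mem ht (isClosed_closure.isOpen_compl.mem_nhds h))
    exact ⟨y, hy1.1, Or.inr ⟨hy2, hy1.2⟩⟩

/-! ### Uniqueness for the transmission problem -/

/-- The comparison function of the uniqueness proof. -/
def barrier (ri ε : ℝ) (z : ℂ) : ℝ := Real.log (max ‖z - centreD ri ε‖ ri)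

lemma continuous_barrier (hri : 0 < ri) : Continuous (barrier ri ε) :=
  Continuous.log (by fun_prop) fun z => (lt_max_of_lt_right hri).ne'

lemma harmonicOnNhd_barrier_incl : HarmonicOnNhd (barrier ri ε) (Incl ri ε) := by
  intro x hx
  have : barrier ri ε =ᶠ[𝓝 x] fun _ => Real.log ri := by
    filter_upwards [Metric.isOpen_ball.mem_nhds hx] with y hy
    rw [barrier, max_eq_right (mem_ball_iff_norm.1 hy).le]
  rw [harmonicAt_congr_nhds this]
  exact (analyticAt_const (v := (Real.log ri : ℂ))).harmonicAt_re

lemma harmonicOnNhd_barrier_gap (hri : 0 < ri) :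
    HarmonicOnNhd (barrier ri ε) (Gap re ri ε) := by
  intro x hx
  have hx2 : x ∉ Metric.closedBall (centreD ri ε) ri := by
    rw [← closure_Incl hri]
    exact hx.2
  have : barrier ri ε =ᶠ[𝓝 x] fun z => Real.log ‖z - centreD ri ε‖ := by
    filter_upwards [Metric.isClosed_closedBall.isOpen_compl.mem_nhds hx2] with y hy
    rw [mem_compl_iff, mem_closedBall_iff_norm, not_le] at hy
    rw [barrier, max_eq_left hy.le]
  rw [harmonicAt_congr_nhds this]
  refine AnalyticAt.harmonicAt_log_norm (f := fun z => z - centreD ri ε) (by fun_prop) ?_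
  rw [mem_closedBall_iff_norm, not_le] at hx2
  exact norm_pos_iff.1 (hri.trans hx2)

lemma norm_normal_line (hri : 0 < ri) {x : ℂ} (hx : x ∈ frontier (Incl ri ε)) (t : ℝ) :
    ‖x + t • (ri⁻¹ • (x - centreD ri ε)) - centreD ri ε‖ = |ri + t| := by
  rw [Incl, frontier_ball _ hri.ne', mem_sphere_iff_norm] at hx
  have : x + t • (ri⁻¹ • (x - centreD ri ε)) - centreD ri ε
      = (1 + t * ri⁻¹) • (x - centreD ri ε) := by
    rw [smul_smul, add_smul, one_smul]
    abel
  rw [this, norm_smul, hx, Real.norm_eq_abs, ← abs_of_pos hri, ← abs_mul, abs_of_pos hri]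
  congr 1
  field_simp

lemma hasDerivWithinAt_barrier_Ici (hri : 0 < ri) {x : ℂ} (hx : x ∈ frontier (Incl ri ε)) :
    HasDerivWithinAt (fun t : ℝ => barrier ri ε (x + t • (ri⁻¹ • (x - centreD ri ε)))) ri⁻¹
      (Ici 0) 0 := by
  have h : HasDerivAt (fun t : ℝ => Real.log (ri + t)) ri⁻¹ 0 := by
    convert! ((hasDerivAt_id (0 : ℝ)).const_add ri).log (by simp [hri.ne']) using 1
    simp
  refine h.hasDerivWithinAt.congr (fun t ht => ?_) ?_
  · have ht : 0 ≤ t := ht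
    simp only [barrier]
    rw [norm_normal_line hri hx, abs_of_nonneg (by linarith), max_eq_left (by linarith)]
  · simp only [barrier]
    rw [norm_normal_line hri hx, add_zero, abs_of_pos hri, max_self]

lemma hasDerivWithinAt_barrier_Iic (hri : 0 < ri) {x : ℂ} (hx : x ∈ frontier (Incl ri ε)) :
    HasDerivWithinAt (fun t : ℝ => barrier ri ε (x + t • (ri⁻¹ • (x - centreD ri ε)))) 0
      (Iic 0) 0 := by
  refine (hasDerivWithinAt_const (0 : ℝ) (Iic 0) (Real.log ri)).congr_of_eventuallyEq ?_ ?_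
  · filter_upwards [self_mem_nhdsWithin,
      mem_nhdsWithin_of_mem_nhds (Ici_mem_nhds (neg_neg_of_pos hri))] with t ht ht2
    have ht : t ≤ 0 := ht
    have ht2 : -ri ≤ t := ht2
    simp only [barrier]
    rw [norm_normal_line hri hx, abs_of_nonneg (by linarith), max_eq_right (by linarith)]
  · simp only [barrier]
    rw [norm_normal_line hri hx, add_zero, abs_of_pos hri, max_self]

/-- Adding $\eta$ times the barrier gives $v_1-v_2$ an extra outer slope $\eta/r_i$ and no inner
one. A maximum on $\partial D$ would need inner slope $\ge0$ and outer slope $\le0$, contradicting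
$\partial_+=k\,\partial_-$. So the maximum lies on $\partial\Omega$, and $\eta\to0$; no Hopf lemma
is needed. -/
lemma IsSolution.le (hri : 0 < ri) (hε : 0 < ε) (hεr : ε < re - ri) (hk : 0 < k) {v₁ v₂ : ℂ → ℝ}
    (h₁ : IsSolution re ri ε k g v₁) (h₂ : IsSolution re ri ε k g v₂) {z : ℂ}
    (hz : z ∈ closure (Omega re)) : v₁ z ≤ v₂ z := by
  have hO : IsOpen (Omega re) := Metric.isOpen_ball
  have hK : IsCompact (closure (Omega re)) := Metric.isBounded_ball.isCompact_closure
  have hsub := closure_Incl_subset hri hε hεr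
  obtain ⟨m, -, hm⟩ := hK.exists_isMaxOn ⟨z, hz⟩ (continuous_barrier (ε := ε) hri).continuousOn
  have hlow : ∀ y, Real.log ri ≤ barrier ri ε y := fun y =>
    Real.log_le_log hri (le_max_right _ _)
  have key : ∀ η : ℝ, 0 < η → v₁ z - v₂ z ≤ η * (barrier ri ε m - Real.log ri) := by
    intro η hη
    set W : ℂ → ℝ := fun y => v₁ y - v₂ y + η * barrier ri ε y with hW
    have hWc : ContinuousOn W (closure (Omega re)) :=
      (h₁.continuousOn.sub h₂.continuousOn).add
        (continuousOn_const.mul (continuous_barrier hri).continuousOn)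
    have hWI : HarmonicOnNhd W (Incl ri ε) :=
      (h₁.harmonic_incl.sub h₂.harmonic_incl).add
        (harmonicOnNhd_barrier_incl.const_smul (c := η))
    have hWG : HarmonicOnNhd W (Gap re ri ε) :=
      (h₁.harmonic_gap.sub h₂.harmonic_gap).add
        ((harmonicOnNhd_barrier_gap hri).const_smul (c := η))
    obtain ⟨p, hp, hpmax⟩ := hK.exists_isMaxOn ⟨z, hz⟩ hWc
    have hnot : ∀ x ∈ frontier (Incl ri ε), ¬ IsMaxOn W (closure (Omega re)) x := by
      intro x hx hmax
      obtain ⟨a₁, b₁, ha₁, hb₁, e₁⟩ := h₁.transmission x hx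
      obtain ⟨a₂, b₂, ha₂, hb₂, e₂⟩ := h₂.transmission x hx
      have hxO : x ∈ Omega re := hsub (frontier_subset_closure hx)
      have hev : ∀ᶠ t : ℝ in 𝓝 0, W (x + t • (ri⁻¹ • (x - centreD ri ε)))
          ≤ W (x + (0 : ℝ) • (ri⁻¹ • (x - centreD ri ε))) := by
        have ht : Tendsto (fun t : ℝ => x + t • (ri⁻¹ • (x - centreD ri ε))) (𝓝 0) (𝓝 x) := by
          have := Continuous.tendsto
            (f := fun t : ℝ => x + t • (ri⁻¹ • (x - centreD ri ε))) (by fun_prop) 0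
          simpa using this
        filter_upwards [ht.eventually (hO.mem_nhds hxO)] with t ht
        rw [zero_smul, add_zero]
        exact hmax (subset_closure ht)
      have d1 := nonpos_of_hasDerivWithinAt_Ici
        ((ha₁.sub ha₂).add ((hasDerivWithinAt_barrier_Ici hri hx).const_mul η)) hev
      have d2 := nonneg_of_hasDerivWithinAt_Iic
        ((hb₁.sub hb₂).add ((hasDerivWithinAt_barrier_Iic hri hx).const_mul η)) hev
      have h3 : 0 < η * ri⁻¹ := by positivity
      have h4 : 0 ≤ k * (b₁ - b₂) := by
        apply mul_nonneg hk.le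
        linarith
      nlinarith
    obtain ⟨y, hy, hyp⟩ : ∃ y ∈ frontier (Omega re) ∪ frontier (Incl ri ε), W p ≤ W y := by
      rcases closure_Omega_subset (ri := ri) (ε := ε) hp with h | h
      · obtain ⟨y, hy, h⟩ := exists_mem_frontier_le_of_harmonicOnNhd Metric.isOpen_ball
          Metric.isBounded_ball hWI (hWc.mono (hsub.trans subset_closure)) h
        exact ⟨y, Or.inr hy, h⟩
      · obtain ⟨y, hy, h⟩ := exists_mem_frontier_le_of_harmonicOnNhd isOpen_Gap
          (Metric.isBounded_ball.subset sdiff_subset) hWG (hWc.mono (closure_mono sdiff_subset)) h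
        exact ⟨y, frontier_Gap_subset hy, h⟩
    have hymax : IsMaxOn W (closure (Omega re)) y := fun x hx => (hpmax hx).trans hyp
    rcases hy with hy | hy
    · have h3 := hymax hz
      have h4 := hm (frontier_subset_closure hy)
      simp only [mem_ofPred_eq, hW] at h3 h4
      rw [h₁.boundary y hy, h₂.boundary y hy] at h3
      have h5 := hlow z
      nlinarith
    · exact absurd hymax (hnot y hy)
  by_contra hlt
  rw [not_le] at hlt
  have hC : 0 ≤ barrier ri ε m - Real.log ri := sub_nonneg.2 (hlow m)
  set C := barrier ri ε m - Real.log ri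
  -- The value of $\eta$ is chosen so that the right-hand side is at most half of $v_1(z)-v_2(z)$;
  -- the $+1$ covers $C=0$.
  have h3 := key ((v₁ z - v₂ z) / (2 * (C + 1))) (by
    apply div_pos <;> linarith)
  rw [div_mul_eq_mul_div, le_div_iff₀ (by linarith)] at h3
  nlinarith

lemma IsSolution.eqOn (hri : 0 < ri) (hε : 0 < ε) (hεr : ε < re - ri) (hk : 0 < k)
    {v₁ v₂ : ℂ → ℝ} (h₁ : IsSolution re ri ε k g v₁) (h₂ : IsSolution re ri ε k g v₂) :
    EqOn v₁ v₂ (closure (Omega re)) := fun _ hz =>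
  le_antisymm (h₁.le hri hε hεr hk h₂ hz) (h₂.le hri hε hεr hk h₁ hz)

end

end

/-! ### Pencils of circles and their charts -/

section

/-- The real points `a`, `b` are the common pair of inverse points of the circles
`|z - re| = re` and `|z - c| = ri`, with `a` inside and `b` outside. -/
structure Pencil (re ri c a b : ℝ) : Prop where
  ri_pos : 0 < ri
  ri_lt : ri < c
  c_lt : c < re
  a_pos : 0 < a
  b_neg : b < 0
  outer : (re - a) * (re - b) = re ^ 2
  inner : (c - a) * (c - b) = ri ^ 2

/-- The Möbius chart sending `a` to `0` and `b` to `∞`. -/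
def chart (a b : ℝ) (z : ℂ) : ℂ := (z - a) / (z - b)

/-- The inverse of `chart`. -/
def param (a b : ℝ) (φ : ℂ) : ℂ := b + (a - b) / (1 - φ)

/-- The squared radius of the image under `chart` of a circle centred at `c`. -/
def sqRadius (a b c : ℝ) : ℝ := (c - a) / (c - b)

/-- The multiplier of the composition of the two reflections. -/
def multiplier (re c a b : ℝ) : ℝ := sqRadius a b c / sqRadius a b re

/-- The reflection across the circle of centre `c` and radius `ri`. -/
def reflection (ri c : ℝ) (z : ℂ) : ℂ := c + ri ^ 2 / conj (z - c)

lemma normSq_sub_ofReal (z : ℂ) (a : ℝ) : ‖z - a‖ ^ 2 = (z.re - a) ^ 2 + z.im ^ 2 := by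
  rw [← Complex.normSq_eq_norm_sq, Complex.normSq_apply]
  simp
  ring

section chart

variable {a b : ℝ}

lemma chart_param (hab : b < a) {φ : ℂ} (hφ : φ ≠ 1) : chart a b (param a b φ) = φ := by
  have h1 : (1 : ℂ) - φ ≠ 0 := sub_ne_zero.2 hφ.symm
  have h2 : (a : ℂ) - b ≠ 0 := by
    rw [← Complex.ofReal_sub]
    exact Complex.ofReal_ne_zero.2 (sub_ne_zero.2 hab.ne')
  have h3 : param a b φ - b = (a - b) / (1 - φ) := by rw [param, add_sub_cancel_left]
  have h4 : param a b φ - a = φ * ((a - b) / (1 - φ)) := by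
    rw [param]
    field_simp
    ring
  rw [chart, h3, h4, mul_div_cancel_right₀ _ (div_ne_zero h2 h1)]

lemma param_ne (hab : b < a) {φ : ℂ} (hφ : φ ≠ 1) : param a b φ ≠ b := by
  have h1 : (1 : ℂ) - φ ≠ 0 := sub_ne_zero.2 hφ.symm
  have h2 : (a : ℂ) - b ≠ 0 := by
    rw [← Complex.ofReal_sub]
    exact Complex.ofReal_ne_zero.2 (sub_ne_zero.2 hab.ne')
  intro h
  rw [param, add_eq_left] at h
  exact div_ne_zero h2 h1 h

lemma one_sub_chart {z : ℂ} (hz : z ≠ b) : 1 - chart a b z = (a - b) / (z - b) := by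
  have h1 : z - b ≠ 0 := sub_ne_zero.2 hz
  rw [chart]
  field_simp
  ring

lemma param_chart (hab : b < a) {z : ℂ} (hz : z ≠ b) : param a b (chart a b z) = z := by
  have h1 : z - b ≠ 0 := sub_ne_zero.2 hz
  have h2 : (a : ℂ) - b ≠ 0 := by
    rw [← Complex.ofReal_sub]
    exact Complex.ofReal_ne_zero.2 (sub_ne_zero.2 hab.ne')
  rw [param, one_sub_chart hz]
  field_simp
  ring

lemma hasDerivAt_chart {z : ℂ} (hz : z ≠ b) :
    HasDerivAt (chart a b) ((a - b) / (z - b) ^ 2) z := by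
  have h1 : z - b ≠ 0 := sub_ne_zero.2 hz
  convert! ((hasDerivAt_id z).sub_const (a : ℂ)).div ((hasDerivAt_id z).sub_const (b : ℂ)) h1
    using 1
  simp

lemma hasDerivAt_param {φ : ℂ} (hφ : φ ≠ 1) :
    HasDerivAt (param a b) ((a - b) / (1 - φ) ^ 2) φ := by
  have h1 : (1 : ℂ) - φ ≠ 0 := sub_ne_zero.2 hφ.symm
  convert! ((hasDerivAt_const φ ((a : ℂ) - b)).div ((hasDerivAt_id φ).const_sub 1) h1).const_add
    (b : ℂ) using 1
  simp

/-- The relation $(c-a)(c-b)=r^2$ makes the circle an Apollonius circle of $a,b$: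
$(c-b)|z-a|^2-(c-a)|z-b|^2$ is a multiple of $|z-c|^2-r^2$. Disks become disks centred at $0$. -/
lemma sq_norm_chart_sub {c r : ℝ} (hcb : b < c) (hr : (c - a) * (c - b) = r ^ 2) {z : ℂ}
    (hz : z ≠ b) : ‖chart a b z‖ ^ 2 - sqRadius a b c
      = (a - b) / ((c - b) * ‖z - b‖ ^ 2) * (‖z - c‖ ^ 2 - r ^ 2) := by
  have h1 : ‖z - b‖ ≠ 0 := norm_ne_zero_iff.2 (sub_ne_zero.2 hz)
  have h2 : c - b ≠ 0 := sub_ne_zero.2 hcb.ne'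
  rw [chart, norm_div, div_pow, sqRadius]
  field_simp
  rw [normSq_sub_ofReal, normSq_sub_ofReal, normSq_sub_ofReal]
  linear_combination -(a - b) * hr

lemma sq_norm_chart_lt_iff {c r : ℝ} (hab : b < a) (hcb : b < c) (hr0 : 0 ≤ r)
    (hr : (c - a) * (c - b) = r ^ 2) {z : ℂ} (hz : z ≠ b) :
    ‖chart a b z‖ ^ 2 < sqRadius a b c ↔ ‖z - c‖ < r := by
  have h1 : 0 < ‖z - b‖ := norm_pos_iff.2 (sub_ne_zero.2 hz)
  have h2 : 0 < c - b := sub_pos.2 hcb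
  have h3 : 0 < a - b := sub_pos.2 hab
  have h4 : 0 < (a - b) / ((c - b) * ‖z - b‖ ^ 2) := by positivity
  rw [← sub_neg, sq_norm_chart_sub hcb hr hz, ← not_le, mul_nonneg_iff_of_pos_left h4, not_le,
    sub_neg, sq_lt_sq₀ (norm_nonneg _) hr0]

lemma sq_norm_chart_le_iff {c r : ℝ} (hab : b < a) (hcb : b < c) (hr0 : 0 ≤ r)
    (hr : (c - a) * (c - b) = r ^ 2) {z : ℂ} (hz : z ≠ b) :
    ‖chart a b z‖ ^ 2 ≤ sqRadius a b c ↔ ‖z - c‖ ≤ r := by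
  have h1 : 0 < ‖z - b‖ := norm_pos_iff.2 (sub_ne_zero.2 hz)
  have h2 : 0 < c - b := sub_pos.2 hcb
  have h3 : 0 < a - b := sub_pos.2 hab
  have h4 : 0 < (a - b) / ((c - b) * ‖z - b‖ ^ 2) := by positivity
  rw [← sub_nonpos, sq_norm_chart_sub hcb hr hz, ← not_lt, mul_pos_iff_of_pos_left h4, not_lt,
    sub_nonpos, sq_le_sq₀ (norm_nonneg _) hr0]

lemma sq_norm_chart_eq_iff {c r : ℝ} (hab : b < a) (hcb : b < c) (hr0 : 0 ≤ r)
    (hr : (c - a) * (c - b) = r ^ 2) {z : ℂ} (hz : z ≠ b) :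
    ‖chart a b z‖ ^ 2 = sqRadius a b c ↔ ‖z - c‖ = r := by
  have h1 := sq_norm_chart_lt_iff hab hcb hr0 hr hz
  have h2 := sq_norm_chart_le_iff hab hcb hr0 hr hz
  constructor
  · intro h
    exact le_antisymm (h2.1 h.le) (not_lt.1 fun h3 => (h1.2 h3).ne h)
  · intro h
    exact le_antisymm (h2.2 h.le) (not_lt.1 fun h3 => (h1.1 h3).ne h)

end chart

namespace Pencil

variable {re ri c a b : ℝ}

section

variable (P : Pencil re ri c a b)
include P

lemma re_pos : 0 < re := by linarith [P.ri_pos, P.ri_lt, P.c_lt]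

lemma c_pos : 0 < c := by linarith [P.ri_pos, P.ri_lt]

lemma lt : b < a := P.b_neg.trans P.a_pos

lemma re_sub_b_pos : 0 < re - b := by linarith [P.re_pos, P.b_neg]

lemma c_sub_b_pos : 0 < c - b := by linarith [P.c_pos, P.b_neg]

lemma re_sub_a_pos : 0 < re - a :=
  pos_of_mul_pos_left (by rw [P.outer]; have := P.re_pos; positivity) P.re_sub_b_pos.le

lemma c_sub_a_pos : 0 < c - a :=
  pos_of_mul_pos_left (by rw [P.inner]; have := P.ri_pos; positivity) P.c_sub_b_pos.le

lemma sqRadius_re_pos : 0 < sqRadius a b re := div_pos P.re_sub_a_pos P.re_sub_b_pos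

lemma sqRadius_c_pos : 0 < sqRadius a b c := div_pos P.c_sub_a_pos P.c_sub_b_pos

lemma sqRadius_re_lt_one : sqRadius a b re < 1 := by
  rw [sqRadius, div_lt_one P.re_sub_b_pos]
  linarith [P.lt]

lemma sqRadius_lt : sqRadius a b c < sqRadius a b re := by
  rw [sqRadius, sqRadius, div_lt_div_iff₀ P.c_sub_b_pos P.re_sub_b_pos]
  nlinarith [mul_pos (sub_pos.2 P.lt) (sub_pos.2 P.c_lt)]

lemma multiplier_pos : 0 < multiplier re c a b := div_pos P.sqRadius_c_pos P.sqRadius_re_pos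

lemma multiplier_lt_one : multiplier re c a b < 1 := by
  rw [multiplier, div_lt_one P.sqRadius_re_pos]
  exact P.sqRadius_lt

lemma one_sub_multiplier :
    1 - multiplier re c a b = (re - c) * (a - b) / ((c - b) * (re - a)) := by
  have h1 := P.c_sub_b_pos.ne'
  have h2 := P.re_sub_a_pos.ne'
  have h3 := P.re_sub_b_pos.ne'
  rw [multiplier, sqRadius, sqRadius]
  field_simp
  ring

lemma ne_b {z : ℂ} (hz : ‖z - re‖ ≤ re) : z ≠ b := by
  rintro rfl
  rw [← Complex.ofReal_sub, Complex.norm_real, Real.norm_eq_abs] at hz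
  linarith [neg_abs_le (b - re), P.b_neg]

lemma sq_norm_chart_lt_re {z : ℂ} (hz : z ≠ b) :
    ‖chart a b z‖ ^ 2 < sqRadius a b re ↔ ‖z - re‖ < re :=
  sq_norm_chart_lt_iff P.lt (by linarith [P.re_sub_b_pos]) P.re_pos.le P.outer hz

lemma sq_norm_chart_le_re {z : ℂ} (hz : z ≠ b) :
    ‖chart a b z‖ ^ 2 ≤ sqRadius a b re ↔ ‖z - re‖ ≤ re :=
  sq_norm_chart_le_iff P.lt (by linarith [P.re_sub_b_pos]) P.re_pos.le P.outer hz

lemma sq_norm_chart_eq_re {z : ℂ} (hz : z ≠ b) :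
    ‖chart a b z‖ ^ 2 = sqRadius a b re ↔ ‖z - re‖ = re :=
  sq_norm_chart_eq_iff P.lt (by linarith [P.re_sub_b_pos]) P.re_pos.le P.outer hz

lemma sq_norm_chart_eq_c {z : ℂ} (hz : z ≠ b) :
    ‖chart a b z‖ ^ 2 = sqRadius a b c ↔ ‖z - c‖ = ri :=
  sq_norm_chart_eq_iff P.lt (by linarith [P.c_sub_b_pos]) P.ri_pos.le P.inner hz

lemma norm_chart_lt_one {z : ℂ} (hz : ‖z - re‖ ≤ re) : ‖chart a b z‖ < 1 := by
  have h := ((P.sq_norm_chart_le_re (P.ne_b hz)).2 hz).trans_lt P.sqRadius_re_lt_one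
  exact (sq_lt_one_iff₀ (norm_nonneg _)).1 h

lemma param_mem_iff {φ : ℂ} (hφ : φ ≠ 1) :
    ‖param a b φ - re‖ < re ↔ ‖φ‖ ^ 2 < sqRadius a b re := by
  rw [← P.sq_norm_chart_lt_re (param_ne P.lt hφ), chart_param P.lt hφ]

lemma norm_sub_re_lt_of_norm_sub_c_le {z : ℂ} (hz : ‖z - c‖ ≤ ri) : ‖z - re‖ < re := by
  have h1 : ‖z - re‖ ≤ ‖z - c‖ + ‖(c : ℂ) - re‖ := norm_sub_le_norm_sub_add_norm_sub _ _ _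
  rw [← Complex.ofReal_sub, Complex.norm_real, Real.norm_eq_abs, abs_sub_comm,
    abs_of_pos (sub_pos.2 P.c_lt)] at h1
  linarith [P.ri_lt]

lemma norm_reflection_sub {z : ℂ} (hz : ri ≤ ‖z - c‖) : ‖reflection ri c z - c‖ ≤ ri := by
  have h0 : 0 < ‖z - c‖ := P.ri_pos.trans_le hz
  rw [reflection, add_sub_cancel_left, norm_div, RCLike.norm_conj, norm_pow, Complex.norm_real,
    Real.norm_of_nonneg P.ri_pos.le, div_le_iff₀ h0, sq]
  exact mul_le_mul_of_nonneg_left hz P.ri_pos.le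

lemma reflection_eq_self {z : ℂ} (hz : ‖z - c‖ = ri) : reflection ri c z = z := by
  have h0 : z - c ≠ 0 := norm_pos_iff.1 (by rw [hz]; exact P.ri_pos)
  have h1 : (ri : ℂ) ^ 2 = (z - c) * conj (z - c) := by
    rw [Complex.mul_conj, Complex.normSq_eq_norm_sq, hz]
    push_cast
    rfl
  rw [reflection, h1, mul_div_cancel_right₀ _ ((map_ne_zero _).2 h0)]
  ring

/-- Möbius maps preserve inverse points, so reflection in $\partial D$ becomes inversion in the
image circle. -/
lemma chart_reflection {z : ℂ} (hz : z ≠ c) (ha : z ≠ a) (hb : z ≠ b) :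
    chart a b (reflection ri c z) = sqRadius a b c / conj (chart a b z) := by
  have h1 : conj z - (c : ℂ) ≠ 0 := by
    have : conj (z - c) ≠ 0 := (map_ne_zero _).2 (sub_ne_zero.2 hz)
    simpa using this
  have h2 : conj z - (a : ℂ) ≠ 0 := by
    have : conj (z - a) ≠ 0 := (map_ne_zero _).2 (sub_ne_zero.2 ha)
    simpa using this
  have h3 : conj z - (b : ℂ) ≠ 0 := by
    have : conj (z - b) ≠ 0 := (map_ne_zero _).2 (sub_ne_zero.2 hb)
    simpa using this
  have h4 : (c : ℂ) - b ≠ 0 := by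
    rw [← Complex.ofReal_sub]
    exact Complex.ofReal_ne_zero.2 P.c_sub_b_pos.ne'
  have h5 : ((c : ℂ) - a) * (c - b) = ri ^ 2 := by exact_mod_cast congrArg Complex.ofReal P.inner
  have e1 : reflection ri c z - a = (c - a) * (conj z - b) / (conj z - c) := by
    rw [reflection, map_sub, Complex.conj_ofReal, ← h5]
    field_simp
    ring
  have e2 : reflection ri c z - b = (c - b) * (conj z - a) / (conj z - c) := by
    rw [reflection, map_sub, Complex.conj_ofReal, ← h5]
    field_simp
    ring
  rw [chart, e1, e2, chart, sqRadius]
  simp only [map_div₀, map_sub, Complex.conj_ofReal, Complex.ofReal_div, Complex.ofReal_sub]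
  field_simp

/-- On the outer circle $1/\bar\varphi=\varphi/|\varphi|^2$ with $|\varphi|^2$ constant, so the
antiholomorphic inversion agrees there with a holomorphic dilation. -/
lemma chart_reflection_of_norm_eq {z : ℂ} (hz : ‖z - re‖ = re) :
    chart a b (reflection ri c z) = multiplier re c a b * chart a b z := by
  have hb := P.ne_b hz.le
  have h1 := (P.sq_norm_chart_eq_re hb).2 hz
  have hc : z ≠ c := by
    rintro rfl
    have := P.norm_sub_re_lt_of_norm_sub_c_le (z := c) (by simpa using P.ri_pos.le)
    linarith
  have h0 : chart a b z ≠ 0 := by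
    intro h
    rw [h, norm_zero, zero_pow two_ne_zero] at h1
    exact P.sqRadius_re_pos.ne h1
  have ha : z ≠ a := by
    rintro rfl
    simp [chart] at h0
  rw [P.chart_reflection hc ha hb, div_eq_iff ((map_ne_zero _).2 h0), mul_assoc, Complex.mul_conj,
    Complex.normSq_eq_norm_sq, h1, multiplier, ← Complex.ofReal_mul,
    div_mul_cancel₀ _ P.sqRadius_re_pos.ne']

/-- Because $c-b\le r_e-b$, the denominator $(c-b)(r_e-a)$ is at most $(r_e-b)(r_e-a)=r_e^2$. -/
lemma le_one_sub_multiplier : (re - c) * (a - b) / re ^ 2 ≤ 1 - multiplier re c a b := by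
  rw [P.one_sub_multiplier, ← P.outer]
  have h1 := P.c_sub_b_pos
  have h2 := P.re_sub_a_pos
  have h3 := P.c_lt
  have h4 : 0 < (re - c) * (a - b) := mul_pos (sub_pos.2 P.c_lt) (sub_pos.2 P.lt)
  rw [mul_comm (re - a)]
  gcongr

lemma one_sub_multiplier_le : 1 - multiplier re c a b ≤ (re - c) * (a - b) / (re * ri) := by
  rw [P.one_sub_multiplier]
  have h1 := P.c_sub_b_pos
  have h2 := P.re_sub_a_pos
  have h3 := P.re_sub_b_pos
  have h4 : 0 < (re - c) * (a - b) := mul_pos (sub_pos.2 P.c_lt) (sub_pos.2 P.lt)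
  have h5 : re * ri ≤ (c - b) * (re - a) := by
    have h6 : re * ri * (re - b) ≤ (c - b) * (re - a) * (re - b) := by
      rw [mul_assoc (c - b), P.outer]
      have h7 : ri * (re - b) ≤ (c - b) * re := by
        nlinarith [P.ri_lt, P.c_lt, P.b_neg, P.re_pos]
      nlinarith [P.re_pos]
    exact le_of_mul_le_mul_right h6 h3
  have := mul_pos P.re_pos P.ri_pos
  gcongr

/-- Subtracting the two circle relations gives $a+b$, and the outer one gives $ab=r_e(a+b)$. The
product with $r_e-c$ is the useful quantity, since $a-b$ alone blows up as the disks become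
concentric. -/
lemma sq_mul_sub : ((re - c) * (a - b)) ^ 2
    = (c ^ 2 - ri ^ 2) ^ 2 + 4 * re * (re - c) * (c ^ 2 - ri ^ 2) := by
  have h1 := P.outer
  have h2 := P.inner
  have e1 : a * b = re * (a + b) := by linear_combination h1
  have e2 : (re - c) * (a + b) = -(c ^ 2 - ri ^ 2) := by linear_combination h2 - h1
  have e3 : ((re - c) * (a - b)) ^ 2
      = ((re - c) * (a + b)) ^ 2 - 4 * (re - c) ^ 2 * (a * b) := by ring
  rw [e3, e1, e2]
  linear_combination (-4 * re * (re - c)) * e2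

end

end Pencil

lemma exists_pencil {re ri c : ℝ} (hri : 0 < ri) (h1 : ri < c) (h2 : c < re) :
    ∃ a b, Pencil re ri c a b := by
  have hd : 0 < re - c := sub_pos.2 h2
  have hE : 0 < c ^ 2 - ri ^ 2 := by nlinarith
  set e := (c ^ 2 - ri ^ 2) / (re - c) with he
  have he0 : 0 < e := div_pos hE hd
  have hre : 0 < re := by linarith
  have hed : (re - c) * e = c ^ 2 - ri ^ 2 := mul_div_cancel₀ _ hd.ne'
  -- The points $a,b$ are the roots of $x^2+ex-r_ee=0$, because $a+b=-e$ and $ab=r_e(a+b)$.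
  set L := √(e ^ 2 + 4 * re * e) with hL
  have hLsq : L ^ 2 = e ^ 2 + 4 * re * e := Real.sq_sqrt (by positivity)
  have hLe : e < L := by
    rw [hL]
    exact Real.lt_sqrt_of_sq_lt (by nlinarith [mul_pos hre he0])
  refine ⟨(L - e) / 2, -(L + e) / 2, hri, h1, h2, by linarith, by linarith, ?_, ?_⟩
  · linear_combination -hLsq / 4
  · linear_combination -hLsq / 4 - hed

end

/-! ### Sums of weights -/

section

/-- The derivative of the map acting as multiplication by `t` in the chart. -/
def weight (φ : ℂ) (t : ℝ) : ℂ := t * (1 - φ) ^ 2 / (1 - t * φ) ^ 2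

section

variable {φ : ℂ} {t : ℝ}

lemma one_sub_le_norm_one_sub_mul (hφ : ‖φ‖ ≤ 1) (ht0 : 0 ≤ t) : 1 - t ≤ ‖1 - t * φ‖ := by
  have h := norm_sub_norm_le (1 : ℂ) (t * φ)
  rw [norm_one, norm_mul, Complex.norm_real, Real.norm_of_nonneg ht0] at h
  nlinarith

lemma norm_one_sub_le_two_mul (hφ : ‖φ‖ ≤ 1) (ht0 : 0 ≤ t) (ht1 : t ≤ 1) :
    ‖1 - φ‖ ≤ 2 * ‖1 - t * φ‖ := by
  have h1 : 1 - φ = (1 - t * φ) - ((1 - t : ℝ) : ℂ) * φ := by push_cast; ring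
  have h2 : ‖1 - φ‖ ≤ ‖1 - t * φ‖ + ‖((1 - t : ℝ) : ℂ) * φ‖ := by
    conv_lhs => rw [h1]
    exact norm_sub_le _ _
  rw [norm_mul, Complex.norm_real, Real.norm_of_nonneg (by linarith)] at h2
  have h3 := one_sub_le_norm_one_sub_mul hφ ht0
  nlinarith

/-- Together with `norm_one_sub_mul_le`, this says that $|1-t\varphi|$ is comparable with
$|1-\varphi|+(1-t)$, a quantity that is monotone in $t$ and can be telescoped. -/
lemma norm_one_sub_add_le (hφ : ‖φ‖ ≤ 1) (ht0 : 0 ≤ t) (ht1 : t ≤ 1) :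
    ‖1 - φ‖ + (1 - t) ≤ 3 * ‖1 - t * φ‖ := by
  have h1 := norm_one_sub_le_two_mul hφ ht0 ht1
  have h2 := one_sub_le_norm_one_sub_mul hφ ht0
  linarith

lemma norm_one_sub_mul_le (hφ : ‖φ‖ ≤ 1) (ht1 : t ≤ 1) :
    ‖1 - t * φ‖ ≤ ‖1 - φ‖ + (1 - t) := by
  have h1 : 1 - t * φ = (1 - φ) + ((1 - t : ℝ) : ℂ) * φ := by push_cast; ring
  rw [h1]
  refine (norm_add_le _ _).trans ?_
  rw [norm_mul, Complex.norm_real, Real.norm_of_nonneg (by linarith)]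
  nlinarith

lemma norm_one_sub_mul_pos (hφ : ‖φ‖ ≤ 1) (hφ1 : φ ≠ 1) (ht0 : 0 ≤ t) (ht1 : t ≤ 1) :
    0 < ‖1 - t * φ‖ := by
  have h1 : 0 < ‖1 - φ‖ := norm_pos_iff.2 (sub_ne_zero.2 hφ1.symm)
  have h2 := norm_one_sub_le_two_mul hφ ht0 ht1
  linarith

lemma norm_weight (ht0 : 0 ≤ t) : ‖weight φ t‖ = t * ‖1 - φ‖ ^ 2 / ‖1 - t * φ‖ ^ 2 := by
  rw [weight, norm_div, norm_mul, norm_pow, norm_pow, Complex.norm_real, Real.norm_of_nonneg ht0]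

lemma norm_weight_le (hφ : ‖φ‖ ≤ 1) (hφ1 : φ ≠ 1) (ht0 : 0 ≤ t) (ht1 : t ≤ 1) :
    ‖weight φ t‖ ≤ 4 * t := by
  rw [norm_weight ht0]
  have h1 := norm_one_sub_le_two_mul hφ ht0 ht1
  have h2 := norm_one_sub_mul_pos hφ hφ1 ht0 ht1
  rw [div_le_iff₀ (by positivity)]
  have h3 : ‖1 - φ‖ ^ 2 ≤ (2 * ‖1 - t * φ‖) ^ 2 := by gcongr
  nlinarith

lemma weight_one (hφ1 : φ ≠ 1) : weight φ 1 = 1 := by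
  have : 1 - φ ≠ 0 := sub_ne_zero.2 hφ1.symm
  rw [weight, Complex.ofReal_one, one_mul, one_mul, div_self (pow_ne_zero _ this)]

/-- The variation of the weights is dominated by increments of one monotone function of $t$, so
summing along $t=\mu^n$ telescopes, although the weights themselves are complex. -/
lemma norm_weight_sub_le (hφ : ‖φ‖ ≤ 1) (hφ1 : φ ≠ 1) {s : ℝ} (hs0 : 0 ≤ s) (hst : s ≤ t)
    (ht1 : t ≤ 1) : ‖weight φ s - weight φ t‖
      ≤ 36 * ‖1 - φ‖ * (1 / (‖1 - φ‖ + (1 - t)) - 1 / (‖1 - φ‖ + (1 - s))) := by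
  have hθ : 0 < ‖1 - φ‖ := norm_pos_iff.2 (sub_ne_zero.2 hφ1.symm)
  have ht0 := hs0.trans hst
  have hs1 := hst.trans ht1
  have pt := norm_one_sub_mul_pos hφ hφ1 ht0 ht1
  have ps := norm_one_sub_mul_pos hφ hφ1 hs0 hs1
  have nt := norm_pos_iff.1 pt
  have ns := norm_pos_iff.1 ps
  have key : weight φ s - weight φ t = -((1 - φ) ^ 2 * ((t - s : ℝ) : ℂ)
      * ((1 - t * φ) + t * φ * (1 - s * φ)) / ((1 - t * φ) ^ 2 * (1 - s * φ) ^ 2)) := by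
    rw [weight, weight, div_sub_div _ _ (pow_ne_zero 2 ns) (pow_ne_zero 2 nt), ← neg_div,
      div_eq_div_iff (mul_ne_zero (pow_ne_zero 2 ns) (pow_ne_zero 2 nt))
        (mul_ne_zero (pow_ne_zero 2 nt) (pow_ne_zero 2 ns))]
    push_cast
    ring
  have hA : ‖(1 - t * φ) + t * φ * (1 - s * φ)‖ ≤ ‖1 - t * φ‖ + ‖1 - s * φ‖ := by
    refine (norm_add_le _ _).trans ?_
    rw [norm_mul, norm_mul, Complex.norm_real, Real.norm_of_nonneg ht0]
    have : t * ‖φ‖ ≤ 1 := by nlinarith [norm_nonneg φ]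
    nlinarith
  rw [key, norm_neg, norm_div, norm_mul, norm_mul, norm_mul, norm_pow, norm_pow, norm_pow,
    Complex.norm_real, Real.norm_of_nonneg (sub_nonneg.2 hst)]
  have b1 := norm_one_sub_le_two_mul hφ ht0 ht1
  have b2 := norm_one_sub_le_two_mul hφ hs0 hs1
  have b3 := norm_one_sub_add_le hφ ht0 ht1
  have b4 := norm_one_sub_add_le hφ hs0 hs1
  set θ := ‖1 - φ‖
  set x := ‖1 - t * φ‖
  set y := ‖1 - s * φ‖
  have ts : 0 ≤ t - s := sub_nonneg.2 hst
  have d1 : 0 < θ + (1 - t) := by linarith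
  have d2 : 0 < θ + (1 - s) := by linarith
  have e1 : 1 / (θ + (1 - t)) - 1 / (θ + (1 - s))
      = (t - s) / ((θ + (1 - t)) * (θ + (1 - s))) := by
    field_simp
    ring
  calc θ ^ 2 * (t - s) * ‖(1 - t * φ) + t * φ * (1 - s * φ)‖ / (x ^ 2 * y ^ 2)
      ≤ θ ^ 2 * (t - s) * (x + y) / (x ^ 2 * y ^ 2) := by gcongr
    _ ≤ θ * (4 * x * y) * (t - s) / (x ^ 2 * y ^ 2) := by
        have h1 : θ * (x + y) ≤ 4 * x * y := by nlinarith
        have h2 := mul_le_mul_of_nonneg_left h1 (mul_nonneg hθ.le ts)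
        refine div_le_div_of_nonneg_right (le_of_eq_of_le ?_ (h2.trans_eq ?_)) (by positivity)
        · ring
        · ring
    _ = 36 * θ * ((t - s) / ((3 * x) * (3 * y))) := by
        field_simp
        ring
    _ ≤ 36 * θ * ((t - s) / ((θ + (1 - t)) * (θ + (1 - s)))) := by gcongr
    _ = _ := by rw [e1]

end

section

variable {φ : ℂ} {μ q : ℝ}

lemma summable_geometric_mul (hμ0 : 0 ≤ μ) (hμ1 : μ < 1) (hq : |q| ≤ 1) :
    HasSum (fun n : ℕ => |q| ^ n * (4 * μ ^ n)) (4 / (1 - |q| * μ)) := by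
  have h := (hasSum_geometric_of_lt_one (r := |q| * μ) (by positivity)
    (by nlinarith [abs_nonneg q])).mul_left 4
  convert! h using 1
  ext n
  rw [mul_pow]
  ring

lemma norm_pow_mul_weight_le (hφ : ‖φ‖ ≤ 1) (hφ1 : φ ≠ 1) (hμ0 : 0 ≤ μ) (hμ1 : μ < 1) (n : ℕ) :
    ‖(q : ℂ) ^ n * weight φ (μ ^ n)‖ ≤ |q| ^ n * (4 * μ ^ n) := by
  rw [norm_mul, norm_pow, Complex.norm_real, Real.norm_eq_abs]
  gcongr
  exact norm_weight_le hφ hφ1 (by positivity) (pow_le_one₀ hμ0 hμ1.le)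

lemma summable_weight (hφ : ‖φ‖ ≤ 1) (hφ1 : φ ≠ 1) (hμ0 : 0 ≤ μ) (hμ1 : μ < 1) (hq : |q| ≤ 1) :
    Summable fun n : ℕ => (q : ℂ) ^ n * weight φ (μ ^ n) :=
  Summable.of_norm_bounded (summable_geometric_mul hμ0 hμ1 hq).summable
    (norm_pow_mul_weight_le hφ hφ1 hμ0 hμ1)

/-- The sum of the image weights. -/
def weightSum (q μ : ℝ) (φ : ℂ) : ℂ := ∑' n : ℕ, (q : ℂ) ^ n * weight φ (μ ^ n)

lemma norm_weightSum_le (hφ : ‖φ‖ ≤ 1) (hφ1 : φ ≠ 1) (hμ0 : 0 ≤ μ) (hμ1 : μ < 1)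
    (hq : |q| ≤ 1) : ‖weightSum q μ φ‖ ≤ 4 / (1 - |q| * μ) :=
  tsum_of_norm_bounded (summable_geometric_mul hμ0 hμ1 hq)
    (norm_pow_mul_weight_le hφ hφ1 hμ0 hμ1)

/-- Abel summation: $(1-q)S=1+\sum q^{n+1}(w_{n+1}-w_n)$. The weights have total variation at most
$36$, and $1-q\ge1$ when $q\le0$. -/
lemma norm_weightSum_le_of_nonpos (hφ : ‖φ‖ ≤ 1) (hφ1 : φ ≠ 1) (hμ0 : 0 ≤ μ) (hμ1 : μ < 1)
    (hq : |q| ≤ 1) (hq0 : q ≤ 0) : ‖weightSum q μ φ‖ ≤ 37 := by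
  have hθ : 0 < ‖1 - φ‖ := norm_pos_iff.2 (sub_ne_zero.2 hφ1.symm)
  have hs := summable_weight hφ hφ1 hμ0 hμ1 hq
  set x : ℕ → ℝ := fun n => 36 * ‖1 - φ‖ * (1 / (‖1 - φ‖ + (1 - μ ^ n))) with hx
  have hpow : ∀ n : ℕ, μ ^ n ≤ 1 := fun n => pow_le_one₀ hμ0 hμ1.le
  have hxpos : ∀ n, 0 ≤ x n := fun n => by
    have := hpow n
    have : 0 < ‖1 - φ‖ + (1 - μ ^ n) := by linarith
    positivity
  have hbound : ∀ n : ℕ, ‖(q : ℂ) ^ (n + 1) * (weight φ (μ ^ (n + 1)) - weight φ (μ ^ n))‖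
      ≤ x n - x (n + 1) := by
    intro n
    have h1 := norm_weight_sub_le hφ hφ1 (s := μ ^ (n + 1)) (t := μ ^ n) (by positivity)
      (pow_le_pow_of_le_one hμ0 hμ1.le (Nat.le_succ n)) (hpow n)
    rw [norm_mul, norm_pow, Complex.norm_real, Real.norm_eq_abs]
    have h2 : |q| ^ (n + 1) ≤ 1 := pow_le_one₀ (abs_nonneg q) hq
    calc _ ≤ 1 * ‖weight φ (μ ^ (n + 1)) - weight φ (μ ^ n)‖ := by gcongr
      _ ≤ _ := by
        rw [one_mul]
        refine h1.trans (le_of_eq ?_)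
        simp only [hx]
        ring
  have hx0 : x 0 = 36 := by
    simp only [hx, pow_zero, sub_self, add_zero]
    field_simp
  have hpart : ∀ s : Finset ℕ,
      ∑ n ∈ s, ‖(q : ℂ) ^ (n + 1) * (weight φ (μ ^ (n + 1)) - weight φ (μ ^ n))‖ ≤ 36 := by
    intro s
    obtain ⟨N, hN⟩ := s.exists_nat_subset_range
    calc _ ≤ ∑ n ∈ Finset.range N,
          ‖(q : ℂ) ^ (n + 1) * (weight φ (μ ^ (n + 1)) - weight φ (μ ^ n))‖ :=
          Finset.sum_le_sum_of_subset_of_nonneg hN fun _ _ _ => norm_nonneg _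
      _ ≤ ∑ n ∈ Finset.range N, (x n - x (n + 1)) := Finset.sum_le_sum fun n _ => hbound n
      _ = x 0 - x N := Finset.sum_range_sub' x N
      _ ≤ 36 := by linarith [hxpos N]
  have hsum : Summable fun n : ℕ =>
      ‖(q : ℂ) ^ (n + 1) * (weight φ (μ ^ (n + 1)) - weight φ (μ ^ n))‖ :=
    summable_of_sum_le (fun _ => norm_nonneg _) hpart
  have hT : ‖∑' n : ℕ, (q : ℂ) ^ (n + 1) * (weight φ (μ ^ (n + 1)) - weight φ (μ ^ n))‖ ≤ 36 :=
    (norm_tsum_le_tsum_norm hsum).trans (hsum.tsum_le_of_sum_le hpart)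
  have e1 : weightSum q μ φ
      = 1 + ∑' n : ℕ, (q : ℂ) ^ (n + 1) * weight φ (μ ^ (n + 1)) := by
    rw [weightSum, hs.tsum_eq_zero_add]
    simp [weight_one hφ1]
  have e2 : (1 - (q : ℂ)) * weightSum q μ φ
      = 1 + ∑' n : ℕ, (q : ℂ) ^ (n + 1) * (weight φ (μ ^ (n + 1)) - weight φ (μ ^ n)) := by
    have h1 : (q : ℂ) * weightSum q μ φ = ∑' n : ℕ, (q : ℂ) ^ (n + 1) * weight φ (μ ^ n) := by
      rw [weightSum, ← tsum_mul_left]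
      congr 1
      ext n
      ring
    have h2 : Summable fun n : ℕ => (q : ℂ) ^ (n + 1) * weight φ (μ ^ (n + 1)) :=
      (summable_nat_add_iff 1).2 hs
    have h3 : Summable fun n : ℕ => (q : ℂ) ^ (n + 1) * weight φ (μ ^ n) := by
      convert! hs.mul_left (q : ℂ) using 2
      ring
    simp_rw [mul_sub]
    rw [h2.tsum_sub h3, ← h1, one_sub_mul]
    nth_rewrite 1 [e1]
    ring
  have h3 : ‖weightSum q μ φ‖ ≤ ‖(1 - (q : ℂ)) * weightSum q μ φ‖ := by
    rw [norm_mul, ← Complex.ofReal_one, ← Complex.ofReal_sub, Complex.norm_real,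
      Real.norm_of_nonneg (by linarith)]
    nlinarith [norm_nonneg (weightSum q μ φ)]
  refine h3.trans ?_
  rw [e2]
  refine (norm_add_le _ _).trans ?_
  rw [norm_one]
  linarith

/-- The cube, in place of the square in the weight, comes from $|T^nz-a|\le(a-b)/|1-\mu^n\varphi|$
when $f\circ T^n$ is compared with a constant. The sum costs only one factor $1/(1-\mu)$. -/
lemma sum_weight_cube_le (hφ : ‖φ‖ ≤ 1) (hφ1 : φ ≠ 1) (hμ0 : 0 ≤ μ) (hμ1 : μ < 1)
    (s : Finset ℕ) : ∑ n ∈ s, μ ^ n * ‖1 - φ‖ ^ 2 / ‖1 - (μ ^ n : ℝ) * φ‖ ^ 3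
      ≤ 27 * (1 + (1 - μ) / ‖1 - φ‖) / (1 - μ) := by
  have hθ : 0 < ‖1 - φ‖ := norm_pos_iff.2 (sub_ne_zero.2 hφ1.symm)
  set θ := ‖1 - φ‖ with hθ_def
  have hμ : 0 < 1 - μ := sub_pos.2 hμ1
  have hpow : ∀ n : ℕ, μ ^ n ≤ 1 := fun n => pow_le_one₀ hμ0 hμ1.le
  -- `M` bounds the ratio of consecutive denominators $|1-\varphi|+1-\mu^n$. Their difference is
  -- $\mu^n(1-\mu)$, whence the telescoping majorant `x`.
  set M := 1 + (1 - μ) / θ with hM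
  have hM0 : 0 < M := by positivity
  have hMθ : M * θ = θ + (1 - μ) := by
    rw [hM]
    field_simp
  set x : ℕ → ℝ := fun n => 27 * M / (1 - μ) * θ * (1 / (θ + (1 - μ ^ n))) with hx
  have hd : ∀ n : ℕ, 0 < θ + (1 - μ ^ n) := fun n => by linarith [hpow n]
  have hxpos : ∀ n, 0 ≤ x n := fun n => by
    have := hd n
    positivity
  have hterm : ∀ n : ℕ, μ ^ n * θ ^ 2 / ‖1 - (μ ^ n : ℝ) * φ‖ ^ 3 ≤ x n - x (n + 1) := by
    intro n
    have h1 := norm_one_sub_add_le hφ (t := μ ^ n) (by positivity) (hpow n)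
    rw [← hθ_def] at h1
    have h2 : θ + (1 - μ ^ (n + 1)) ≤ M * (θ + (1 - μ ^ n)) := by
      have h3 : M * (θ + (1 - μ ^ n)) = θ + (1 - μ) + M * (1 - μ ^ n) := by rw [mul_add, hMθ]
      have h4 : 1 ≤ M := by
        rw [hM]
        exact le_add_of_nonneg_right (by positivity)
      have h5 := hpow n
      rw [h3, pow_succ]
      nlinarith [pow_nonneg hμ0 n]
    have e1 : x n - x (n + 1)
        = 27 * M * θ * μ ^ n / ((θ + (1 - μ ^ n)) * (θ + (1 - μ ^ (n + 1)))) := by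
      have a1 := (hd n).ne'
      have a2 := (hd (n + 1)).ne'
      have a3 := hμ.ne'
      simp only [hx]
      rw [← mul_sub, div_sub_div _ _ a1 a2, div_mul_eq_mul_div, div_mul_div_comm,
        div_eq_div_iff (mul_ne_zero a3 (mul_ne_zero a1 a2)) (mul_ne_zero a1 a2)]
      ring
    have hdn := hd n
    have hdn1 := hd (n + 1)
    have hpn := pow_nonneg hμ0 n
    have hNpos : 0 < ‖1 - (μ ^ n : ℝ) * φ‖ := by linarith
    set D := θ + (1 - μ ^ n)
    set D' := θ + (1 - μ ^ (n + 1))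
    set N := ‖1 - (μ ^ n : ℝ) * φ‖
    rw [e1]
    have hθD : θ ≤ D := by simp only [D]; linarith [hpow n]
    calc μ ^ n * θ ^ 2 / N ^ 3 = 27 * (μ ^ n * θ ^ 2) / (3 * N) ^ 3 := by
          field_simp
          ring
      _ ≤ 27 * (μ ^ n * θ ^ 2) / D ^ 3 := by gcongr
      _ ≤ 27 * M * θ * μ ^ n / (D * D') := by
          rw [div_le_div_iff₀ (by positivity) (by positivity)]
          have h6 : θ * D' ≤ M * D ^ 2 := by nlinarith [mul_pos hM0 hdn]
          have h7 : 0 ≤ 27 * (μ ^ n * θ) * D := by positivity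
          nlinarith [mul_le_mul_of_nonneg_left h6 h7]
  obtain ⟨N, hN⟩ := s.exists_nat_subset_range
  calc _ ≤ ∑ n ∈ Finset.range N, μ ^ n * θ ^ 2 / ‖1 - (μ ^ n : ℝ) * φ‖ ^ 3 :=
        Finset.sum_le_sum_of_subset_of_nonneg hN fun _ _ _ => by positivity
    _ ≤ ∑ n ∈ Finset.range N, (x n - x (n + 1)) := Finset.sum_le_sum fun n _ => hterm n
    _ = x 0 - x N := Finset.sum_range_sub' x N
    _ ≤ x 0 := by linarith [hxpos N]
    _ = _ := by
        simp only [hx, pow_zero, sub_self, add_zero]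
        field_simp

end

end

/-! ### Lower bounds for sums of weights -/

section

/-- The unit normal of the circle of radius `‖φ‖`, transported from the chart to the plane. -/
def unitNormal (φ : ℂ) : ℂ := φ / ‖φ‖ * (‖1 - φ‖ ^ 2 / (1 - φ) ^ 2)

variable {φ : ℂ} {μ q : ℝ}

lemma hasSum_weightSum (hφ : ‖φ‖ ≤ 1) (hφ1 : φ ≠ 1) (hμ0 : 0 ≤ μ) (hμ1 : μ < 1)
    (hq : |q| ≤ 1) : HasSum (fun n : ℕ => (q : ℂ) ^ n * weight φ (μ ^ n)) (weightSum q μ φ) :=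
  (summable_weight hφ hφ1 hμ0 hμ1 hq).hasSum

/-- Along the negative real axis of the chart all image weights are positive. -/
lemma le_re_weightSum_neg {ρ : ℝ} (hρ0 : 0 ≤ ρ) (hρ : ρ ≤ 1) (hμ0 : 0 ≤ μ) (hμ1 : μ < 1)
    (hq0 : 0 ≤ q) (hq : q ≤ 1) : 1 / (1 - q * μ) ≤ (weightSum q μ (-ρ : ℝ)).re := by
  have hφ : ‖((-ρ : ℝ) : ℂ)‖ ≤ 1 := by
    rwa [Complex.norm_real, norm_neg, Real.norm_of_nonneg hρ0]
  have hφ1 : ((-ρ : ℝ) : ℂ) ≠ 1 := by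
    rw [← Complex.ofReal_one]
    exact fun h => by linarith [Complex.ofReal_injective h]
  have hs := Complex.hasSum_re (hasSum_weightSum (q := q) hφ hφ1 hμ0 hμ1
    (by rwa [abs_of_nonneg hq0]))
  have hg := hasSum_geometric_of_lt_one (r := q * μ) (by positivity) (by nlinarith)
  rw [one_div]
  refine hasSum_le (fun n => ?_) hg hs
  have ht0 : 0 ≤ μ ^ n := by positivity
  have ht1 : μ ^ n ≤ 1 := pow_le_one₀ hμ0 hμ1.le
  have e : (q : ℂ) ^ n * weight (-ρ : ℝ) (μ ^ n)
      = ((q ^ n * (μ ^ n * (1 + ρ) ^ 2 / (1 + μ ^ n * ρ) ^ 2) : ℝ) : ℂ) := by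
    rw [weight]
    push_cast
    ring
  rw [e, Complex.ofReal_re, mul_pow]
  gcongr
  rw [le_div_iff₀ (by positivity)]
  gcongr
  nlinarith

/-- The cross term in $\varphi(1-t\bar\varphi)^2$ is real, and the last term contributes
$t^2|\varphi|^2\bar\varphi$. So for $|\varphi|\le1$ and $0\le t\le1$ the sign is that of
$\mathrm{Im}\,\varphi$, whatever $t$. -/
lemma im_div_one_sub_mul_sq (t : ℝ) : (φ / (1 - t * φ) ^ 2).im
    = φ.im * (1 - t ^ 2 * ‖φ‖ ^ 2) / ‖1 - t * φ‖ ^ 4 := by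
  have h1 : ‖1 - t * φ‖ ^ 4 = Complex.normSq ((1 - t * φ) ^ 2) := by
    rw [Complex.normSq_eq_norm_sq, norm_pow]
    ring
  have h2 : ‖φ‖ ^ 2 = φ.re ^ 2 + φ.im ^ 2 := by
    rw [← Complex.normSq_eq_norm_sq, Complex.normSq_apply]
    ring
  rw [Complex.div_im, ← h1, h2, ← sub_div]
  congr 1
  simp only [sq, Complex.mul_re, Complex.mul_im, Complex.sub_re, Complex.sub_im, Complex.one_re,
    Complex.one_im, Complex.ofReal_re, Complex.ofReal_im]
  ring

lemma im_unitNormal_mul_weight (hφ0 : φ ≠ 0) (hφ : ‖φ‖ ≤ 1) (hφ1 : φ ≠ 1) {t : ℝ} (ht0 : 0 ≤ t)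
    (ht1 : t ≤ 1) (n : ℕ) : (unitNormal φ * ((q : ℂ) ^ n * weight φ t)).im
      = q ^ n * t * (‖1 - φ‖ ^ 2 / ‖φ‖)
        * (φ.im * (1 - t ^ 2 * ‖φ‖ ^ 2) / ‖1 - t * φ‖ ^ 4) := by
  have h1 : 1 - φ ≠ 0 := sub_ne_zero.2 hφ1.symm
  have h2 := norm_pos_iff.1 (norm_one_sub_mul_pos hφ hφ1 ht0 ht1)
  have h3 : (‖φ‖ : ℂ) ≠ 0 := Complex.ofReal_ne_zero.2 (norm_ne_zero_iff.2 hφ0)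
  have e : unitNormal φ * ((q : ℂ) ^ n * weight φ t)
      = ((q ^ n * t * (‖1 - φ‖ ^ 2 / ‖φ‖) : ℝ) : ℂ) * (φ / (1 - t * φ) ^ 2) := by
    rw [unitNormal, weight]
    push_cast
    field_simp
  rw [e, Complex.im_ofReal_mul, im_div_one_sub_mul_sq t]

/-- All terms are nonnegative, so a window of indices suffices. With $\alpha=(1-\mu)/\sigma$, the
indices $1/(4\sigma)\le n\le1/(2\sigma)$ have $(q\mu)^n\ge1/2$ and
$1-\mu^n\asymp\alpha\asymp|1-\varphi|$. Each such term is then at least $1/40000$, and there are at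
least $1/(8\sigma)$ of them. -/
lemma le_im_unitNormal_mul_weightSum (hφ : ‖φ‖ ≤ 1) (hφ1 : φ ≠ 1) (hμ0 : 0 < μ)
    (hμ1 : μ < 1) (hq0 : 0 ≤ q) (hq1 : q < 1) (hσ : 8 * (1 - q * μ) ≤ 1)
    (hy : (1 - μ) / (1 - q * μ) / 4 ≤ φ.im)
    (hθ : ‖1 - φ‖ ≤ 2 * ((1 - μ) / (1 - q * μ))) :
    1 / 320000 / (1 - q * μ) ≤ (unitNormal φ * weightSum q μ φ).im := by
  set σ := 1 - q * μ with hσ_def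
  have hqμ : q * μ < 1 := by nlinarith
  have hσ0 : 0 < σ := sub_pos.2 hqμ
  set α := (1 - μ) / σ with hα
  have hα0 : 0 < α := div_pos (sub_pos.2 hμ1) hσ0
  have hασ : α * σ = 1 - μ := div_mul_cancel₀ _ hσ0.ne'
  have hα1 : α ≤ 1 := by
    rw [hα, div_le_one hσ0]
    nlinarith
  have him : 0 < φ.im := by linarith
  have hφ0 : φ ≠ 0 := by
    rintro rfl
    simp at him
  have hφpos : 0 < ‖φ‖ := norm_pos_iff.2 hφ0
  have hs := Complex.hasSum_im ((hasSum_weightSum (q := q) hφ hφ1 hμ0.le hμ1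
    (by rw [abs_of_nonneg hq0]; exact hq1.le)).mul_left (unitNormal φ))
  have hterm : ∀ n : ℕ, (unitNormal φ * ((q : ℂ) ^ n * weight φ (μ ^ n))).im
      = (q * μ) ^ n * (‖1 - φ‖ ^ 2 / ‖φ‖)
        * (φ.im * (1 - (μ ^ n) ^ 2 * ‖φ‖ ^ 2) / ‖1 - (μ ^ n : ℝ) * φ‖ ^ 4) := fun n => by
    rw [im_unitNormal_mul_weight hφ0 hφ hφ1 (by positivity) (pow_le_one₀ hμ0.le hμ1.le), mul_pow]
  have hlow1 : ∀ n : ℕ, 1 - μ ^ n ≤ 1 - (μ ^ n) ^ 2 * ‖φ‖ ^ 2 := fun n => by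
    have h0 : 0 ≤ μ ^ n := by positivity
    have h1 : μ ^ n ≤ 1 := pow_le_one₀ hμ0.le hμ1.le
    have h2 : ‖φ‖ ^ 2 ≤ 1 := pow_le_one₀ (norm_nonneg _) hφ
    nlinarith [sq_nonneg ‖φ‖]
  have hnonneg : ∀ n : ℕ, 0 ≤ (unitNormal φ * ((q : ℂ) ^ n * weight φ (μ ^ n))).im := fun n => by
    rw [hterm]
    have h1 : μ ^ n ≤ 1 := pow_le_one₀ hμ0.le hμ1.le
    have := hlow1 n
    have h2 : 0 ≤ 1 - (μ ^ n) ^ 2 * ‖φ‖ ^ 2 := by linarith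
    positivity
  have hmain : ∀ n : ℕ, 1 / (4 * σ) ≤ n → n ≤ 1 / (2 * σ) →
      1 / 40000 ≤ (unitNormal φ * ((q : ℂ) ^ n * weight φ (μ ^ n))).im := by
    intro n hn1 hn2
    rw [div_le_iff₀ (by positivity)] at hn1
    rw [le_div_iff₀ (by positivity)] at hn2
    have hη0 : 0 < 1 - μ := sub_pos.2 hμ1
    have hnη1 : α / 4 ≤ n * (1 - μ) := by rw [← hασ]; nlinarith
    have hnη2 : n * (1 - μ) ≤ α / 2 := by rw [← hασ]; nlinarith
    have hpow0 : 0 < μ ^ n := by positivity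
    have hup : 1 - μ ^ n ≤ α / 2 := by
      have := one_add_mul_le_pow (a := μ - 1) (by linarith) n
      rw [add_sub_cancel] at this
      linarith
    -- Lower Bernoulli bound applied to $(2-\mu)^n$, transferred to $\mu^n$ through
    -- $(2-\mu)\mu\le1$.
    have hlow : α / 8 ≤ 1 - μ ^ n := by
      have h1 : 1 + n * (1 - μ) ≤ (1 + (1 - μ)) ^ n := one_add_mul_le_pow (by linarith) n
      have h2 : (1 + (1 - μ)) ^ n * μ ^ n ≤ 1 := by
        rw [← mul_pow]
        exact pow_le_one₀ (by nlinarith) (by nlinarith)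
      have h3 : (1 + α / 4) * μ ^ n ≤ 1 := by
        refine le_trans ?_ h2
        gcongr
        linarith
      nlinarith
    have hqn : 1 / 2 ≤ (q * μ) ^ n := by
      have := one_add_mul_le_pow (a := q * μ - 1) (by nlinarith [mul_nonneg hq0 hμ0.le]) n
      rw [add_sub_cancel] at this
      have e : q * μ - 1 = -σ := by rw [hσ_def]; ring
      rw [e] at this
      nlinarith
    have hN : ‖1 - (μ ^ n : ℝ) * φ‖ ≤ 5 / 2 * α := by
      have := norm_one_sub_mul_le hφ (t := μ ^ n) (pow_le_one₀ hμ0.le hμ1.le)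
      linarith
    have hNpos := norm_one_sub_mul_pos hφ hφ1 hpow0.le (pow_le_one₀ hμ0.le hμ1.le)
    have hθ2 : α / 4 ≤ ‖1 - φ‖ := by
      refine hy.trans ?_
      have := Complex.abs_im_le_norm (1 - φ)
      rw [Complex.sub_im, Complex.one_im, zero_sub, abs_neg, abs_of_pos him] at this
      exact this
    have hθφ : (α / 4) ^ 2 ≤ ‖1 - φ‖ ^ 2 / ‖φ‖ := by
      rw [le_div_iff₀ hφpos]
      calc (α / 4) ^ 2 * ‖φ‖ ≤ (α / 4) ^ 2 * 1 := by gcongr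
        _ ≤ _ := by rw [mul_one]; gcongr
    rw [hterm]
    have h9 : 0 ≤ φ.im * (1 - (μ ^ n) ^ 2 * ‖φ‖ ^ 2) :=
      mul_nonneg him.le ((by positivity : (0 : ℝ) ≤ α / 8).trans (hlow.trans (hlow1 n)))
    have h8 : α / 8 ≤ 1 - (μ ^ n) ^ 2 * ‖φ‖ ^ 2 := hlow.trans (hlow1 n)
    calc (1 : ℝ) / 40000 = 1 / 2 * (α / 4) ^ 2 * (α / 4 * (α / 8) / (5 / 2 * α) ^ 4) := by
          field_simp
          norm_num
      _ ≤ _ := by gcongr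
  set S := Finset.Icc ⌈1 / (4 * σ)⌉₊ ⌊1 / (2 * σ)⌋₊ with hS
  have hsum : ∑ n ∈ S, (unitNormal φ * ((q : ℂ) ^ n * weight φ (μ ^ n))).im
      ≤ (unitNormal φ * weightSum q μ φ).im := by
    rw [← hs.tsum_eq]
    exact hs.summable.sum_le_tsum S fun n _ => hnonneg n
  refine le_trans ?_ hsum
  have hge : (S.card : ℝ) * (1 / 40000) ≤
      ∑ n ∈ S, (unitNormal φ * ((q : ℂ) ^ n * weight φ (μ ^ n))).im := by
    rw [← nsmul_eq_mul]
    refine Finset.card_nsmul_le_sum _ _ _ fun n hn => ?_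
    rw [hS, Finset.mem_Icc] at hn
    exact hmain n (Nat.ceil_le.1 hn.1) ((Nat.le_floor_iff (by positivity)).1 hn.2)
  refine le_trans ?_ hge
  -- With $x=1/(8\sigma)\ge1$ the window is $[2x,4x]$; rounding leaves more than $2x-1\ge x$
  -- integers.
  have hcard : 1 / (8 * σ) ≤ (S.card : ℝ) := by
    rw [hS, Nat.card_Icc]
    have h1 : ((⌊1 / (2 * σ)⌋₊ + 1 - ⌈1 / (4 * σ)⌉₊ : ℕ) : ℝ)
        ≥ (⌊1 / (2 * σ)⌋₊ : ℝ) + 1 - ⌈1 / (4 * σ)⌉₊ := by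
      have h : ⌊1 / (2 * σ)⌋₊ + 1 ≤ (⌊1 / (2 * σ)⌋₊ + 1 - ⌈1 / (4 * σ)⌉₊) + ⌈1 / (4 * σ)⌉₊ := by
        omega
      have h' : ((⌊1 / (2 * σ)⌋₊ : ℝ) + 1)
          ≤ ((⌊1 / (2 * σ)⌋₊ + 1 - ⌈1 / (4 * σ)⌉₊ : ℕ) : ℝ) + ⌈1 / (4 * σ)⌉₊ := by
        exact_mod_cast h
      linarith
    have h2 := Nat.lt_floor_add_one (1 / (2 * σ))
    have h3 := Nat.ceil_lt_add_one (a := 1 / (4 * σ)) (by positivity)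
    have h4 : 1 / (2 * σ) = 4 * (1 / (8 * σ)) := by field_simp; norm_num
    have h5 : 1 / (4 * σ) = 2 * (1 / (8 * σ)) := by field_simp; norm_num
    have h6 : 1 ≤ 1 / (8 * σ) := by
      rw [le_div_iff₀ (by positivity)]
      linarith
    linarith
  calc 1 / 320000 / σ = 1 / (8 * σ) * (1 / 40000) := by field_simp; norm_num
    _ ≤ _ := by gcongr

end

/-! ### The image series solves the transmission problem -/

section

open InnerProductSpace

/-- Multiplication by `t` in the chart. -/
def flow (a b t : ℝ) (z : ℂ) : ℂ := param a b (t * chart a b z)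

/-- The image series of a holomorphic potential. -/
def potSeries (q μ a b : ℝ) (h : ℂ → ℂ) (z : ℂ) : ℂ :=
  ∑' n : ℕ, (q : ℂ) ^ n * h (flow a b (μ ^ n) z)

/-- The derivative of the image series. -/
def fieldSeries (q μ a b : ℝ) (f : ℂ → ℂ) (z : ℂ) : ℂ :=
  ∑' n : ℕ, (q : ℂ) ^ n * (weight (chart a b z) (μ ^ n) * f (flow a b (μ ^ n) z))

/-- The holomorphic potential of the solution outside the inclusion. -/
def gapPotential (q ri c : ℝ) (U : ℂ → ℂ) (z : ℂ) : ℂ := U z - q * conj (U (reflection ri c z))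

/-- The derivative of `gapPotential`. -/
def gapField (q ri c : ℝ) (w : ℂ → ℂ) (z : ℂ) : ℂ :=
  w z + q * (ri ^ 2 / (z - c) ^ 2) * conj (w (reflection ri c z))

/-- The explicit solution of the transmission problem. -/
def explicitSolution (q μ ri c a b : ℝ) (h : ℂ → ℂ) (H : ℂ → ℝ) (z : ℂ) : ℝ :=
  open scoped Classical in
  if ‖z - c‖ ≤ ri then (1 - q) * (potSeries q μ a b h z).re
  else H z + q * (potSeries q μ a b h (flow a b μ z)).re
    - q * (potSeries q μ a b h (reflection ri c z)).re

lemma mul_ne_one {φ : ℂ} {t : ℝ} (hφ : ‖φ‖ < 1) (ht0 : 0 ≤ t) (ht1 : t ≤ 1) : (t : ℂ) * φ ≠ 1 := by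
  intro h
  have h1 : ‖(t : ℂ) * φ‖ = 1 := by rw [h, norm_one]
  rw [norm_mul, Complex.norm_real, Real.norm_of_nonneg ht0] at h1
  nlinarith [norm_nonneg φ]

lemma hasDerivAt_reflection_conj {ri c : ℝ} {z : ℂ} (hz : z ≠ c) :
    HasDerivAt (fun z : ℂ => conj (reflection ri c z)) (-(ri ^ 2 / (z - c) ^ 2)) z := by
  have h1 : z - c ≠ 0 := sub_ne_zero.2 hz
  have e : (fun z : ℂ => conj (reflection ri c z)) = fun z : ℂ => c + (ri : ℂ) ^ 2 / (z - c) := by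
    ext z
    simp [reflection]
  rw [e]
  convert! ((hasDerivAt_const z ((ri : ℂ) ^ 2)).div ((hasDerivAt_id z).sub_const (c : ℂ))
    h1).const_add (c : ℂ) using 1
  simp [neg_div]

lemma hasDerivAt_gapPotential {q ri c : ℝ} {U w : ℂ → ℂ} {z : ℂ} (hz : z ≠ c)
    (h1 : HasDerivAt U (w z) z)
    (h2 : HasDerivAt U (w (reflection ri c z)) (reflection ri c z)) :
    HasDerivAt (gapPotential q ri c U) (gapField q ri c w z) z := by
  have h3 := h2.conj_conj.comp z (hasDerivAt_reflection_conj (ri := ri) hz)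
  have e : (⇑(starRingEnd ℂ) ∘ U ∘ ⇑(starRingEnd ℂ)) ∘ (fun z => conj (reflection ri c z))
      = fun z => conj (U (reflection ri c z)) := by
    ext z
    simp
  rw [e] at h3
  convert! h1.sub (h3.const_mul (q : ℂ)) using 1
  rw [gapField]
  ring

lemma hasDerivAt_re_line {V : ℂ → ℂ} {V' x ν : ℂ} (h : HasDerivAt V V' x) :
    HasDerivAt (fun t : ℝ => (V (x + t • ν)).re) (V' * ν).re 0 := by
  have h1 : HasDerivAt (fun t : ℂ => x + t * ν) ν ((0 : ℝ) : ℂ) := by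
    simpa using ((hasDerivAt_id ((0 : ℝ) : ℂ)).mul_const ν).const_add x
  have h2 : HasDerivAt (fun t : ℂ => V (x + t * ν)) (V' * ν) ((0 : ℝ) : ℂ) := by
    refine HasDerivAt.comp (h₂ := V) ((0 : ℝ) : ℂ) ?_ h1
    simpa using h
  simpa using h2.real_of_complex

lemma hasGradientAt_re {V : ℂ → ℂ} {V' x : ℂ} (h : HasDerivAt V V' x) :
    HasGradientAt (fun z => (V z).re) (conj V') x := by
  rw [hasGradientAt_iff_hasFDerivAt]
  have h1 := Complex.reCLM.hasFDerivAt.comp x (h.hasFDerivAt.restrictScalars ℝ)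
  convert! h1 using 1
  ext y
  simp [Complex.inner]

namespace DirichletData

variable {re Λ : ℝ} {g : ℂ → ℝ} {h f : ℂ → ℂ} {H : ℂ → ℝ}

lemma exists_bound (hD : DirichletData re Λ g h f H) : ∃ B, ∀ z ∈ Omega re, ‖h z‖ ≤ B := by
  refine ⟨‖h re‖ + Λ * re, fun z hz => ?_⟩
  have hre : 0 < re := by
    have := mem_ball_iff_norm.1 hz
    exact (norm_nonneg _).trans_lt this
  have hc : (re : ℂ) ∈ Omega re := Metric.mem_ball_self hre
  have hΛ : 0 ≤ Λ := (norm_nonneg _).trans (hD.norm_le z hz)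
  have h1 := (convex_ball (re : ℂ) re).norm_image_sub_le_of_norm_hasDerivWithin_le
    (fun x hx => (hD.hasDerivAt x hx).hasDerivWithinAt) hD.norm_le hc hz
  have h2 := norm_le_norm_add_norm_sub' (h z) (h re)
  have h3 := (mem_ball_iff_norm.1 hz).le
  nlinarith [mul_le_mul_of_nonneg_left h3 hΛ]

end DirichletData

namespace Pencil

variable {re ri c a b : ℝ}

section

variable (P : Pencil re ri c a b)
include P

lemma flow_mem {z : ℂ} (hz : ‖z - re‖ ≤ re) {t : ℝ} (ht0 : 0 ≤ t) (ht1 : t < 1) :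
    flow a b t z ∈ Omega re := by
  have h1 := P.norm_chart_lt_one hz
  rw [Omega, mem_ball_iff_norm, flow, P.param_mem_iff (mul_ne_one h1 ht0 ht1.le), norm_mul,
    Complex.norm_real, Real.norm_of_nonneg ht0, mul_pow]
  have h2 := (P.sq_norm_chart_le_re (P.ne_b hz)).2 hz
  have h3 : t ^ 2 < 1 := by nlinarith
  nlinarith [P.sqRadius_re_pos, sq_nonneg t]

lemma flow_one {z : ℂ} (hz : ‖z - re‖ ≤ re) : flow a b 1 z = z := by
  rw [flow, Complex.ofReal_one, one_mul, param_chart P.lt (P.ne_b hz)]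

lemma flow_mem' {z : ℂ} (hz : z ∈ Omega re) {t : ℝ} (ht0 : 0 ≤ t) (ht1 : t ≤ 1) :
    flow a b t z ∈ Omega re := by
  have hz' := (mem_ball_iff_norm.1 hz).le
  rcases ht1.lt_or_eq with h | rfl
  · exact P.flow_mem hz' ht0 h
  · rwa [P.flow_one hz']

lemma flow_flow {z : ℂ} (hz : ‖z - re‖ ≤ re) {s t : ℝ} (ht0 : 0 ≤ t) (ht1 : t ≤ 1) :
    flow a b s (flow a b t z) = flow a b (s * t) z := by
  rw [flow, flow, chart_param P.lt (mul_ne_one (P.norm_chart_lt_one hz) ht0 ht1), flow]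
  push_cast
  rw [mul_assoc]

lemma hasDerivAt_flow {z : ℂ} (hz : ‖z - re‖ ≤ re) {t : ℝ} (ht0 : 0 ≤ t) (ht1 : t ≤ 1) :
    HasDerivAt (flow a b t) (weight (chart a b z) t) z := by
  have hb := P.ne_b hz
  have h1 := (hasDerivAt_param (a := a) (b := b)
    (mul_ne_one (P.norm_chart_lt_one hz) ht0 ht1)).comp z
    ((hasDerivAt_chart (a := a) hb).const_mul (t : ℂ))
  convert! h1 using 1
  rw [weight, one_sub_chart hb, div_pow]
  ring

/-- This is what makes the image series meet the Dirichlet condition: on $\partial\Omega$ the terms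
$U\circ T$ and $U\circ R$ cancel. -/
lemma flow_eq_reflection {z : ℂ} (hz : ‖z - re‖ = re) :
    flow a b (multiplier re c a b) z = reflection ri c z := by
  rw [flow, ← P.chart_reflection_of_norm_eq hz]
  refine param_chart P.lt (P.ne_b (P.norm_sub_re_lt_of_norm_sub_c_le ?_).le)
  refine P.norm_reflection_sub ?_
  by_contra hlt
  have := P.norm_sub_re_lt_of_norm_sub_c_le (not_le.1 hlt).le
  linarith

lemma reflection_mem {z : ℂ} (hz : ri ≤ ‖z - c‖) : reflection ri c z ∈ Omega re :=
  mem_ball_iff_norm.2 (P.norm_sub_re_lt_of_norm_sub_c_le (P.norm_reflection_sub hz))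

lemma multiplier_pow_mem (n : ℕ) :
    0 ≤ multiplier re c a b ^ n ∧ multiplier re c a b ^ n ≤ 1 :=
  ⟨pow_nonneg P.multiplier_pos.le n, pow_le_one₀ P.multiplier_pos.le P.multiplier_lt_one.le⟩

end

section

variable (P : Pencil re ri c a b) {q Λ : ℝ} (hq : |q| < 1) {g : ℂ → ℝ} {h f : ℂ → ℂ}
  {H : ℂ → ℝ} (hD : DirichletData re Λ g h f H)
include P hq hD

lemma summable_potSeries {z : ℂ} (hz : z ∈ Omega re) :
    Summable fun n : ℕ => (q : ℂ) ^ n * h (flow a b (multiplier re c a b ^ n) z) := by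
  obtain ⟨B, hB⟩ := hD.exists_bound
  refine Summable.of_norm_bounded ((summable_geometric_of_lt_one (abs_nonneg q) hq).mul_right B)
    fun n => ?_
  rw [norm_mul, norm_pow, Complex.norm_real, Real.norm_eq_abs]
  obtain ⟨h0, h1⟩ := P.multiplier_pow_mem n
  gcongr
  exact hB _ (P.flow_mem' hz h0 h1)

/-- Peeling off the term $n=0$, since the dilations in the chart compose multiplicatively. -/
lemma potSeries_eq {z : ℂ} (hz : z ∈ Omega re) :
    potSeries q (multiplier re c a b) a b h z
      = h z + q * potSeries q (multiplier re c a b) a b h (flow a b (multiplier re c a b) z) := by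
  have hz' := (mem_ball_iff_norm.1 hz).le
  rw [potSeries, (P.summable_potSeries hq hD hz).tsum_eq_zero_add, pow_zero, one_mul, pow_zero,
    P.flow_one hz', potSeries, ← tsum_mul_left]
  congr 2
  ext n
  rw [P.flow_flow hz' P.multiplier_pos.le P.multiplier_lt_one.le, ← pow_succ]
  ring

/-- Uniform geometric convergence of holomorphic functions permits termwise differentiation. -/
lemma hasDerivAt_potSeries {z : ℂ} (hz : z ∈ Omega re) :
    HasDerivAt (potSeries q (multiplier re c a b) a b h)
      (fieldSeries q (multiplier re c a b) a b f z) z := by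
  obtain ⟨B, hB⟩ := hD.exists_bound
  have hO : IsOpen (Omega re) := Metric.isOpen_ball
  have hsum := (summable_geometric_of_lt_one (abs_nonneg q) hq).mul_right B
  set μ := multiplier re c a b
  have hder : ∀ n : ℕ, ∀ x ∈ Omega re, HasDerivAt (fun x => (q : ℂ) ^ n * h (flow a b (μ ^ n) x))
      ((q : ℂ) ^ n * (weight (chart a b x) (μ ^ n) * f (flow a b (μ ^ n) x))) x := by
    intro n x hx
    obtain ⟨h0, h1⟩ := P.multiplier_pow_mem n
    have h2 := (hD.hasDerivAt _ (P.flow_mem' hx h0 h1)).comp x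
      (P.hasDerivAt_flow (mem_ball_iff_norm.1 hx).le h0 h1)
    convert! h2.const_mul ((q : ℂ) ^ n) using 1
    ring
  have hdiff : ∀ n : ℕ, DifferentiableOn ℂ (fun x => (q : ℂ) ^ n * h (flow a b (μ ^ n) x))
      (Omega re) := fun n x hx => (hder n x hx).differentiableAt.differentiableWithinAt
  have hle : ∀ (n : ℕ) (x : ℂ), x ∈ Omega re →
      ‖(q : ℂ) ^ n * h (flow a b (μ ^ n) x)‖ ≤ |q| ^ n * B := by
    intro n x hx
    rw [norm_mul, norm_pow, Complex.norm_real, Real.norm_eq_abs]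
    obtain ⟨h0, h1⟩ := P.multiplier_pow_mem n
    gcongr
    exact hB _ (P.flow_mem' hx h0 h1)
  have h1 := Complex.differentiableOn_tsum_of_summable_norm hsum hdiff hO hle
  have h2 := Complex.hasSum_deriv_of_summable_norm hsum hdiff hO hle hz
  have h3 : fieldSeries q μ a b f z
      = deriv (fun w : ℂ => ∑' n : ℕ, (q : ℂ) ^ n * h (flow a b (μ ^ n) w)) z := by
    rw [← h2.tsum_eq, fieldSeries]
    congr 1
    ext n
    rw [(hder n z hz).deriv]
  rw [h3]
  exact (h1.differentiableAt (hO.mem_nhds hz)).hasDerivAt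

lemma differentiableOn_potSeries :
    DifferentiableOn ℂ (potSeries q (multiplier re c a b) a b h) (Omega re) := fun _ hz =>
  (P.hasDerivAt_potSeries hq hD hz).differentiableAt.differentiableWithinAt

lemma continuousOn_fieldSeries :
    ContinuousOn (fieldSeries q (multiplier re c a b) a b f) (Omega re) := by
  have hO : IsOpen (Omega re) := Metric.isOpen_ball
  exact ((P.differentiableOn_potSeries hq hD).deriv hO).continuousOn.congr
    fun z hz => (P.hasDerivAt_potSeries hq hD hz).deriv.symm

lemma hasDerivAt_gapPotential {z : ℂ} (hz : z ∈ Omega re) (hzc : ri ≤ ‖z - c‖) :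
    HasDerivAt (gapPotential q ri c (potSeries q (multiplier re c a b) a b h))
      (gapField q ri c (fieldSeries q (multiplier re c a b) a b f) z) z :=
  NearlyTouchingDisks.hasDerivAt_gapPotential
    (sub_ne_zero.1 (norm_pos_iff.1 (P.ri_pos.trans_le hzc)))
    (P.hasDerivAt_potSeries hq hD hz) (P.hasDerivAt_potSeries hq hD (P.reflection_mem hzc))

/-- In `explicitSolution` the term $U$ is written as $H+q\,U\circ T$, because $U$ is controlled only
in the open disk, whereas $T$ maps the closed disk into it; this gives continuity up to
$\partial\Omega$. -/
lemma explicitSolution_of_le {z : ℂ} (hz : z ∈ Omega re) (hzc : ri ≤ ‖z - c‖) :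
    explicitSolution q (multiplier re c a b) ri c a b h H z
      = (gapPotential q ri c (potSeries q (multiplier re c a b) a b h) z).re := by
  have h1 := congrArg Complex.re (P.potSeries_eq hq hD hz)
  rw [Complex.add_re, Complex.re_ofReal_mul, ← hD.eq_re z hz] at h1
  rw [explicitSolution, gapPotential, Complex.sub_re, Complex.re_ofReal_mul, Complex.conj_re]
  split_ifs with hle
  · rw [P.reflection_eq_self (le_antisymm hle hzc)]
    ring
  · rw [h1]

/-- The hypothesis on $q$ says $q=(k-1)/(k+1)$. On $\partial D$ the normal derivatives are $(1+q)$
and $(1-q)$ times $\mathrm{Re}(U'\nu)$, whose ratio is $k$. -/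
lemma isSolution_explicitSolution {ε k : ℝ} (hc : c = ri + ε) (hqk : 1 + q = k * (1 - q)) :
    IsSolution re ri ε k g (explicitSolution q (multiplier re c a b) ri c a b h H) := by
  subst hc
  set c := ri + ε with hc
  have hcd : centreD ri ε = c := rfl
  have hO : IsOpen (Omega re) := Metric.isOpen_ball
  have hre := P.re_pos
  have hIcl : closure (Incl ri ε) = Metric.closedBall (c : ℂ) ri := closure_Incl P.ri_pos
  have hUan : ∀ z ∈ Omega re, AnalyticAt ℂ (potSeries q (multiplier re c a b) a b h) z :=
    fun z hz => (P.differentiableOn_potSeries hq hD).analyticAt (hO.mem_nhds hz)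
  have hclO : closure (Omega re) = Metric.closedBall (re : ℂ) re := closure_ball _ hre.ne'
  have hin : ∀ z : ℂ, ‖z - c‖ ≤ ri → z ∈ Omega re := fun z hz =>
    mem_ball_iff_norm.2 (P.norm_sub_re_lt_of_norm_sub_c_le hz)
  have hgapnhds : ∀ x ∈ Gap re ri ε, ∀ᶠ z in 𝓝 x, z ∈ Omega re ∧ ri ≤ ‖z - c‖ := by
    intro x hx
    filter_upwards [isOpen_Gap.mem_nhds hx] with z hz
    refine ⟨hz.1, ?_⟩
    have := hz.2
    rw [hIcl, mem_closedBall_iff_norm, not_le] at this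
    exact this.le
  refine ⟨fun x hx => ?_, fun x hx => ?_, ?_, fun x hx => ?_, fun x hx => ?_⟩
  · have hxc : ‖x - c‖ < ri := mem_ball_iff_norm.1 hx
    have : explicitSolution q (multiplier re c a b) ri c a b h H
        =ᶠ[𝓝 x] fun z => (((1 - q : ℝ) : ℂ) * potSeries q (multiplier re c a b) a b h z).re := by
      filter_upwards [Metric.isOpen_ball.mem_nhds hx] with y hy
      have hy' : ‖y - c‖ ≤ ri := (mem_ball_iff_norm.1 hy).le
      rw [explicitSolution, if_pos hy', Complex.re_ofReal_mul]
    rw [harmonicAt_congr_nhds this]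
    exact (analyticAt_const.mul (hUan x (hin x hxc.le))).harmonicAt_re
  · have : explicitSolution q (multiplier re c a b) ri c a b h H
        =ᶠ[𝓝 x] fun z =>
          (gapPotential q ri c (potSeries q (multiplier re c a b) a b h) z).re := by
      filter_upwards [hgapnhds x hx] with y hy
      exact P.explicitSolution_of_le hq hD hy.1 hy.2
    rw [harmonicAt_congr_nhds this]
    refine AnalyticAt.harmonicAt_re (DifferentiableOn.analyticAt (s := Gap re ri ε) (fun y hy => ?_)
      (isOpen_Gap.mem_nhds hx))
    obtain ⟨h1, h2⟩ := (hgapnhds y hy).self_of_nhds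
    exact (P.hasDerivAt_gapPotential hq hD h1 h2).differentiableAt.differentiableWithinAt
  · have hUc := (P.differentiableOn_potSeries hq hD).continuousOn
    have hcl : closure {z : ℂ | ‖z - c‖ ≤ ri} = {z : ℂ | ‖z - c‖ ≤ ri} :=
      (isClosed_le (by fun_prop) (by fun_prop)).closure_eq
    have hcl2 : closure {z : ℂ | ¬ ‖z - c‖ ≤ ri} ⊆ {z : ℂ | ri ≤ ‖z - c‖} :=
      closure_minimal (fun z hz => (not_le.1 hz).le) (isClosed_le (by fun_prop) (by fun_prop))
    unfold explicitSolution
    refine ContinuousOn.if ?_ ?_ ?_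
    · intro z hz
      have h1 : ‖z - c‖ ≤ ri := by
        have := frontier_subset_closure hz.2
        rwa [hcl] at this
      have h2 : ri ≤ ‖z - c‖ := by
        rw [frontier_eq_closure_inter_closure] at hz
        exact hcl2 hz.2.2
      have h3 := congrArg Complex.re (P.potSeries_eq hq hD (hin z h1))
      rw [Complex.add_re, Complex.re_ofReal_mul, ← hD.eq_re z (hin z h1)] at h3
      rw [P.reflection_eq_self (le_antisymm h1 h2)]
      linarith
    · rw [hcl]
      refine ContinuousOn.mul continuousOn_const
        (Complex.continuous_re.comp_continuousOn (hUc.mono fun z hz => hin z hz.2))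
    · have hz1 : ∀ z ∈ closure (Omega re) ∩ closure {z : ℂ | ¬ ‖z - c‖ ≤ ri},
          ‖z - re‖ ≤ re ∧ ri ≤ ‖z - c‖ := fun z hz => by
        refine ⟨?_, hcl2 hz.2⟩
        have := hz.1
        rwa [hclO, mem_closedBall_iff_norm] at this
      refine (hD.continuous.continuousOn.add (continuousOn_const.mul
        (Complex.continuous_re.comp_continuousOn (hUc.comp (fun z hz => ?_) fun z hz => ?_)))).sub
        (continuousOn_const.mul
          (Complex.continuous_re.comp_continuousOn (hUc.comp (fun z hz => ?_) fun z hz => ?_)))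
      · exact (P.hasDerivAt_flow (hz1 z hz).1 P.multiplier_pos.le
          P.multiplier_lt_one.le).continuousAt.continuousWithinAt
      · exact P.flow_mem (hz1 z hz).1 P.multiplier_pos.le P.multiplier_lt_one
      · have hne : z - c ≠ 0 := norm_pos_iff.1 (P.ri_pos.trans_le (hz1 z hz).2)
        have h4 := (hasDerivAt_reflection_conj (ri := ri) (sub_ne_zero.1 hne)).continuousAt
        have h5 := Complex.continuous_conj.continuousAt.comp h4
        have e : (⇑(starRingEnd ℂ) ∘ fun z => conj (reflection ri c z)) = reflection ri c := by
          ext z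
          simp
        rw [e] at h5
        exact h5.continuousWithinAt
      · exact P.reflection_mem (hz1 z hz).2
  · have hxc : ‖x - c‖ = ri := by
      rw [Incl, frontier_ball _ P.ri_pos.ne', mem_sphere_iff_norm] at hx
      exact hx
    have hxO := hin x hxc.le
    set ν : ℂ := ri⁻¹ • (x - centreD ri ε) with hν
    have hri : (ri : ℂ) ≠ 0 := Complex.ofReal_ne_zero.2 P.ri_pos.ne'
    have hxν : x - c = ri * ν := by
      rw [hν, hcd, Complex.real_smul]
      push_cast
      field_simp
    have hνn : ‖ν‖ = 1 := by
      rw [hxν, norm_mul, Complex.norm_real, Real.norm_of_nonneg P.ri_pos.le] at hxc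
      exact (mul_eq_left₀ P.ri_pos.ne').1 hxc
    have hνν : ν * conj ν = 1 := by
      rw [Complex.mul_conj, Complex.normSq_eq_norm_sq, hνn]
      norm_num
    have hν0 : ν ≠ 0 := left_ne_zero_of_mul_eq_one hνν
    set w := fieldSeries q (multiplier re c a b) a b f x with hw
    have hline : ∀ t : ℝ, ‖x + t • ν - c‖ = |ri + t| := fun t => norm_normal_line P.ri_pos hx t
    refine ⟨(1 + q) * (w * ν).re, (1 - q) * (w * ν).re, ?_, ?_, ?_⟩
    · have h1 := hasDerivAt_re_line (ν := ν) (P.hasDerivAt_gapPotential hq hD hxO hxc.ge)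
      have e : (gapField q ri c (fieldSeries q (multiplier re c a b) a b f) x * ν).re
          = (1 + q) * (w * ν).re := by
        -- For $z-c=r_i\nu$ with $|\nu|=1$, the factor $r_i^2/(z-c)^2\cdot\nu$ is $\bar\nu$.
        have e1 : gapField q ri c (fieldSeries q (multiplier re c a b) a b f) x * ν
            = w * ν + ((q : ℝ) : ℂ) * conj (w * ν) := by
          rw [gapField, P.reflection_eq_self hxc, hxν, map_mul]
          have e2 : (ri : ℂ) ^ 2 / (ri * ν) ^ 2 * ν = conj ν := by
            field_simp
            linear_combination -hνν
          linear_combination (q : ℂ) * conj w * e2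
        rw [e1, Complex.add_re, Complex.re_ofReal_mul, Complex.conj_re]
        ring
      rw [e] at h1
      have ht : Tendsto (fun t : ℝ => x + t • ν) (𝓝 0) (𝓝 x) := by
        have := Continuous.tendsto (f := fun t : ℝ => x + t • ν) (by fun_prop) 0
        simpa using this
      refine h1.hasDerivWithinAt.congr_of_eventuallyEq ?_ ?_
      · filter_upwards [self_mem_nhdsWithin,
          mem_nhdsWithin_of_mem_nhds (ht.eventually (hO.mem_nhds hxO))] with t ht0 htO
        have ht0 : 0 ≤ t := ht0
        refine P.explicitSolution_of_le hq hD htO ?_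
        rw [hline, abs_of_nonneg (by linarith [P.ri_pos])]
        linarith
      · rw [zero_smul, add_zero]
        exact P.explicitSolution_of_le hq hD hxO hxc.ge
    · have h1 := (hasDerivAt_re_line (ν := ν) (P.hasDerivAt_potSeries hq hD hxO)).const_mul (1 - q)
      refine h1.hasDerivWithinAt.congr_of_eventuallyEq ?_ ?_
      · filter_upwards [self_mem_nhdsWithin, mem_nhdsWithin_of_mem_nhds
          (Ici_mem_nhds (neg_neg_of_pos P.ri_pos))] with t ht0 ht1
        have ht0 : t ≤ 0 := ht0
        have ht1 : -ri ≤ t := ht1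
        rw [explicitSolution, if_pos]
        rw [hline, abs_of_nonneg (by linarith)]
        linarith
      · rw [explicitSolution, if_pos]
        rw [hline, add_zero, abs_of_pos P.ri_pos]
    · rw [hqk]
      ring
  · have hxr : ‖x - re‖ = re := by
      rw [Omega, frontier_ball _ hre.ne', mem_sphere_iff_norm] at hx
      exact hx
    rw [explicitSolution, if_neg, P.flow_eq_reflection hxr, hD.boundary x hx]
    · ring
    · intro hle
      have := P.norm_sub_re_lt_of_norm_sub_c_le hle
      linarith

end

end Pencil

end

/-! ### The gradient norm in the gap -/

section

open InnerProductSpace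

lemma tsum_norm_le_of_sum_le {u : ℕ → ℂ} {B : ℝ} (h : ∀ s : Finset ℕ, ∑ n ∈ s, ‖u n‖ ≤ B) :
    Summable u ∧ ‖∑' n, u n‖ ≤ B := by
  have hs : Summable fun n => ‖u n‖ := summable_of_sum_le (fun _ => norm_nonneg _) h
  exact ⟨hs.of_norm, (norm_tsum_le_tsum_norm hs).trans (hs.tsum_le_of_sum_le h)⟩

lemma norm_flow_sub_le {a b t : ℝ} (hab : b < a) {z : ℂ} (hφ : ‖chart a b z‖ ≤ 1)
    (hφ1 : chart a b z ≠ 1) (ht0 : 0 ≤ t) (ht1 : t ≤ 1) :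
    ‖flow a b t z - a‖ ≤ (a - b) / ‖1 - t * chart a b z‖ := by
  have hpos := norm_one_sub_mul_pos hφ hφ1 ht0 ht1
  have hne := norm_pos_iff.1 hpos
  have e : flow a b t z - a = ((a - b : ℝ) : ℂ) * (t * chart a b z) / (1 - t * chart a b z) := by
    rw [flow, param]
    push_cast
    field_simp
    ring
  rw [e, norm_div, norm_mul, norm_mul, Complex.norm_real, Complex.norm_real,
    Real.norm_of_nonneg (sub_pos.2 hab).le, Real.norm_of_nonneg ht0]
  have h1 : t * ‖chart a b z‖ ≤ 1 := by nlinarith [norm_nonneg (chart a b z)]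
  have h2 := sub_pos.2 hab
  gcongr
  nlinarith

namespace Pencil

variable {re ri c a b : ℝ}

section

variable (P : Pencil re ri c a b)
include P

lemma chart_ne_one {z : ℂ} (hz : z ∈ Omega re) : chart a b z ≠ 1 := by
  intro h
  have := P.norm_chart_lt_one (mem_ball_iff_norm.1 hz).le
  rw [h, norm_one] at this
  exact lt_irrefl _ this

lemma a_mem : (a : ℂ) ∈ Omega re := by
  rw [Omega, mem_ball_iff_norm, ← Complex.ofReal_sub, Complex.norm_real, Real.norm_eq_abs,
    abs_lt]
  constructor
  · linarith [P.a_pos]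
  · linarith [P.re_sub_a_pos, P.re_pos]

lemma one_sub_multiplier_div_le {z : ℂ} (hz : z ∈ Omega re) :
    (1 - multiplier re c a b) / ‖1 - chart a b z‖
      ≤ (1 - multiplier re c a b) * (2 * re + (a - b)) / (a - b) := by
  have hz' := mem_ball_iff_norm.1 hz
  have hb := P.ne_b hz'.le
  have hμ := sub_pos.2 P.multiplier_lt_one
  have hL := sub_pos.2 P.lt
  have hzb : 0 < ‖z - b‖ := norm_pos_iff.2 (sub_ne_zero.2 hb)
  rw [one_sub_chart hb, norm_div, ← Complex.ofReal_sub, Complex.norm_real,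
    Real.norm_of_nonneg hL.le, div_div_eq_mul_div]
  have h1 : ‖z - b‖ ≤ 2 * re + (a - b) := by
    have h2 := norm_sub_le_norm_sub_add_norm_sub z re b
    rw [← Complex.ofReal_sub, Complex.norm_real, Real.norm_of_nonneg P.re_sub_b_pos.le] at h2
    linarith [P.a_pos]
  gcongr

lemma norm_gapField_le {q W : ℝ} (hq : |q| < 1) {f : ℂ → ℂ}
    (hW : ∀ z ∈ Omega re, ‖fieldSeries q (multiplier re c a b) a b f z‖ ≤ W) {z : ℂ}
    (hz : z ∈ Omega re) (hzc : ri ≤ ‖z - c‖) :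
    ‖gapField q ri c (fieldSeries q (multiplier re c a b) a b f) z‖ ≤ 2 * W := by
  have h1 := hW z hz
  have h2 := hW _ (P.reflection_mem hzc)
  have h0 : 0 < ‖z - c‖ := P.ri_pos.trans_le hzc
  have h3 : ‖(q : ℂ) * (ri ^ 2 / (z - c) ^ 2)‖ ≤ 1 := by
    rw [norm_mul, norm_div, norm_pow, norm_pow, Complex.norm_real, Complex.norm_real,
      Real.norm_eq_abs, Real.norm_of_nonneg P.ri_pos.le]
    have h4 : ri ^ 2 / ‖z - c‖ ^ 2 ≤ 1 := by
      rw [div_le_one (by positivity)]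
      have := P.ri_pos
      gcongr
    have h5 : 0 ≤ ri ^ 2 / ‖z - c‖ ^ 2 := by positivity
    nlinarith [abs_nonneg q]
  rw [gapField]
  refine (norm_add_le _ _).trans ?_
  rw [norm_mul, RCLike.norm_conj]
  nlinarith [norm_nonneg (fieldSeries q (multiplier re c a b) a b f (reflection ri c z)),
    norm_nonneg ((q : ℂ) * (ri ^ 2 / (z - c) ^ 2))]

/-- On $\partial D$ the normal component of the gradient is $(1+q)\,\mathrm{Re}(U'\nu)$: for $q\ge0$
the image reinforces it. -/
lemma le_norm_gapField {q : ℝ} (hq0 : 0 ≤ q) {f : ℂ → ℂ} {z : ℂ} (hzc : ‖z - c‖ = ri) :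
    |(fieldSeries q (multiplier re c a b) a b f z * ((z - c) / ri)).re|
      ≤ ‖gapField q ri c (fieldSeries q (multiplier re c a b) a b f) z‖ := by
  have hri : (ri : ℂ) ≠ 0 := Complex.ofReal_ne_zero.2 P.ri_pos.ne'
  set ν : ℂ := (z - c) / ri with hν
  have hxν : z - c = ri * ν := by
    rw [hν]
    field_simp
  have hνn : ‖ν‖ = 1 := by
    rw [hν, norm_div, hzc, Complex.norm_real, Real.norm_of_nonneg P.ri_pos.le,
      div_self P.ri_pos.ne']
  have hνν : ν * conj ν = 1 := by
    rw [Complex.mul_conj, Complex.normSq_eq_norm_sq, hνn]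
    norm_num
  have hν0 : ν ≠ 0 := left_ne_zero_of_mul_eq_one hνν
  set w := fieldSeries q (multiplier re c a b) a b f z with hw
  have e1 : gapField q ri c (fieldSeries q (multiplier re c a b) a b f) z * ν
      = w * ν + (q : ℂ) * conj (w * ν) := by
    rw [gapField, P.reflection_eq_self hzc, hxν, map_mul]
    have e2 : (ri : ℂ) ^ 2 / (ri * ν) ^ 2 * ν = conj ν := by
      field_simp
      linear_combination -hνν
    linear_combination (q : ℂ) * conj w * e2
  have e2 : (gapField q ri c (fieldSeries q (multiplier re c a b) a b f) z * ν).re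
      = (1 + q) * (w * ν).re := by
    rw [e1, Complex.add_re, Complex.re_ofReal_mul, Complex.conj_re]
    ring
  calc |(w * ν).re| ≤ (1 + q) * |(w * ν).re| := by nlinarith [abs_nonneg (w * ν).re]
    _ = |(gapField q ri c (fieldSeries q (multiplier re c a b) a b f) z * ν).re| := by
        rw [e2, abs_mul, abs_of_nonneg (by linarith : 0 ≤ 1 + q)]
    _ ≤ ‖gapField q ri c (fieldSeries q (multiplier re c a b) a b f) z * ν‖ :=
        Complex.abs_re_le_norm _
    _ = _ := by rw [norm_mul, hνn, mul_one]

end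

section

variable (P : Pencil re ri c a b) {q Λ : ℝ} (hq : |q| < 1) {g : ℂ → ℝ} {h f : ℂ → ℂ}
  {H : ℂ → ℝ} (hD : DirichletData re Λ g h f H)
include P hq hD

/-- A crude bound that ignores $q$ and the variation of $f$; it serves when the gap is wide and
$1-\mu$ is bounded below. -/
lemma norm_fieldSeries_le {z : ℂ} (hz : z ∈ Omega re) :
    ‖fieldSeries q (multiplier re c a b) a b f z‖ ≤ 4 * Λ / (1 - multiplier re c a b) := by
  have hφ := (P.norm_chart_lt_one (mem_ball_iff_norm.1 hz).le).le
  have hφ1 := P.chart_ne_one hz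
  have hμ0 := P.multiplier_pos
  have hμ1 := P.multiplier_lt_one
  have hg := (hasSum_geometric_of_lt_one hμ0.le hμ1).mul_left (4 * Λ)
  rw [div_eq_mul_inv]
  refine tsum_of_norm_bounded hg fun n => ?_
  obtain ⟨h0, h1⟩ := P.multiplier_pow_mem n
  have hfn := hD.norm_le _ (P.flow_mem' hz h0 h1)
  have hΛ := (norm_nonneg _).trans hfn
  rw [norm_mul, norm_mul, norm_pow, Complex.norm_real, Real.norm_eq_abs]
  have h2 := norm_weight_le hφ hφ1 h0 h1
  have h3 : |q| ^ n ≤ 1 := pow_le_one₀ (abs_nonneg q) hq.le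
  calc _ ≤ 1 * (4 * multiplier re c a b ^ n * Λ) := by gcongr
    _ = _ := by ring

/-- $|f(T^nz)-f_0|$ is estimated through the fixed point $a$ of $T$: the distance from $T^nz$ to $a$
leads to `sum_weight_cube_le`, and $|a|\le a-b$ to a geometric series. The outcome is proportional
to $(a-b)/(1-\mu)$, which stays bounded as the gap closes. -/
lemma norm_fieldSeries_sub_le {f₀ : ℂ} (hf₀ : ∀ z ∈ Omega re, ‖f z - f₀‖ ≤ Λ * ‖z‖) {z : ℂ}
    (hz : z ∈ Omega re) :
    ‖fieldSeries q (multiplier re c a b) a b f z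
        - f₀ * weightSum q (multiplier re c a b) (chart a b z)‖
      ≤ Λ * (27 * (1 + (1 - multiplier re c a b) * (2 * re + (a - b)) / (a - b)) + 4)
        * ((a - b) / (1 - multiplier re c a b)) := by
  have hφ := (P.norm_chart_lt_one (mem_ball_iff_norm.1 hz).le).le
  have hφ1 := P.chart_ne_one hz
  have hμ0 := P.multiplier_pos
  have hμ1 := P.multiplier_lt_one
  have hL := sub_pos.2 P.lt
  have hquot := P.one_sub_multiplier_div_le hz
  set μ := multiplier re c a b with hμ
  set φ := chart a b z with hφdef
  have hΛ : 0 ≤ Λ := (norm_nonneg _).trans (hD.norm_le z hz)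
  set u : ℕ → ℂ := fun n => (q : ℂ) ^ n * (weight φ (μ ^ n) * (f (flow a b (μ ^ n) z) - f₀))
    with hu
  have hbd : ∀ n : ℕ, ‖u n‖ ≤ Λ * (a - b) * (μ ^ n * ‖1 - φ‖ ^ 2 / ‖1 - (μ ^ n : ℝ) * φ‖ ^ 3)
      + Λ * (a - b) * 4 * μ ^ n := by
    intro n
    obtain ⟨h0, h1⟩ : 0 ≤ μ ^ n ∧ μ ^ n ≤ 1 := P.multiplier_pow_mem n
    have hm := P.flow_mem' hz h0 h1
    have hpos := norm_one_sub_mul_pos hφ hφ1 h0 h1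
    have e1 : ‖f (flow a b (μ ^ n) z) - f₀‖
        ≤ Λ * ((a - b) / ‖1 - (μ ^ n : ℝ) * φ‖) + Λ * (a - b) := by
      have h2 := norm_sub_le_norm_sub_add_norm_sub (f (flow a b (μ ^ n) z)) (f a) f₀
      have h3 := hD.norm_sub_le _ hm _ P.a_mem
      have h4 := norm_flow_sub_le P.lt hφ hφ1 h0 h1
      have h5 := hf₀ _ P.a_mem
      rw [Complex.norm_real, Real.norm_of_nonneg P.a_pos.le] at h5
      have h6 := mul_le_mul_of_nonneg_left h4 hΛ
      have h7 : Λ * a ≤ Λ * (a - b) := mul_le_mul_of_nonneg_left (by linarith [P.b_neg]) hΛ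
      linarith
    have e2 := norm_weight_le hφ hφ1 h0 h1
    have h3 : |q| ^ n ≤ 1 := pow_le_one₀ (abs_nonneg q) hq.le
    rw [hu]
    simp only
    rw [norm_mul, norm_mul, norm_pow, Complex.norm_real, Real.norm_eq_abs]
    calc |q| ^ n * (‖weight φ (μ ^ n)‖ * ‖f (flow a b (μ ^ n) z) - f₀‖)
        ≤ 1 * (‖weight φ (μ ^ n)‖
          * (Λ * ((a - b) / ‖1 - (μ ^ n : ℝ) * φ‖) + Λ * (a - b))) := by gcongr
      _ = ‖weight φ (μ ^ n)‖ * (Λ * ((a - b) / ‖1 - (μ ^ n : ℝ) * φ‖))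
          + ‖weight φ (μ ^ n)‖ * (Λ * (a - b)) := by ring
      _ ≤ ‖weight φ (μ ^ n)‖ * (Λ * ((a - b) / ‖1 - (μ ^ n : ℝ) * φ‖))
          + 4 * μ ^ n * (Λ * (a - b)) := by gcongr
      _ = _ := by
        rw [norm_weight h0]
        field_simp
  have hpart : ∀ s : Finset ℕ, ∑ n ∈ s, ‖u n‖
      ≤ Λ * (27 * (1 + (1 - μ) * (2 * re + (a - b)) / (a - b)) + 4) * ((a - b) / (1 - μ)) := by
    intro s
    have hμ' : 0 < 1 - μ := sub_pos.2 hμ1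
    have hgeo : ∑ n ∈ s, μ ^ n ≤ (1 - μ)⁻¹ :=
      sum_le_hasSum s (fun n _ => by positivity) (hasSum_geometric_of_lt_one hμ0.le hμ1)
    calc ∑ n ∈ s, ‖u n‖
        ≤ ∑ n ∈ s, (Λ * (a - b) * (μ ^ n * ‖1 - φ‖ ^ 2 / ‖1 - (μ ^ n : ℝ) * φ‖ ^ 3)
          + Λ * (a - b) * 4 * μ ^ n) := Finset.sum_le_sum fun n _ => hbd n
      _ = Λ * (a - b) * ∑ n ∈ s, μ ^ n * ‖1 - φ‖ ^ 2 / ‖1 - (μ ^ n : ℝ) * φ‖ ^ 3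
          + Λ * (a - b) * 4 * ∑ n ∈ s, μ ^ n := by
        rw [Finset.sum_add_distrib, Finset.mul_sum, Finset.mul_sum]
      _ ≤ Λ * (a - b) * (27 * (1 + (1 - μ) / ‖1 - φ‖) / (1 - μ))
          + Λ * (a - b) * 4 * (1 - μ)⁻¹ := by
        have := sum_weight_cube_le hφ hφ1 hμ0.le hμ1 s
        gcongr
      _ ≤ Λ * (a - b) * (27 * (1 + (1 - μ) * (2 * re + (a - b)) / (a - b)) / (1 - μ))
          + Λ * (a - b) * 4 * (1 - μ)⁻¹ := by gcongr
      _ = _ := by field_simp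
  obtain ⟨hsu, hle⟩ := tsum_norm_le_of_sum_le hpart
  have hsw := summable_weight (q := q) hφ hφ1 hμ0.le hμ1 hq.le
  have e : fieldSeries q μ a b f z - f₀ * weightSum q μ φ = ∑' n, u n := by
    rw [sub_eq_iff_eq_add, weightSum, ← tsum_mul_left, ← hsu.tsum_add (hsw.mul_left f₀),
      fieldSeries]
    congr 1
    ext n
    simp only [hu]
    ring
  rw [e]
  exact hle

lemma continuousWithinAt_gapField {z : ℂ} (hz : z ∈ Omega re) (hzc : ri ≤ ‖z - c‖) :
    ContinuousWithinAt (gapField q ri c (fieldSeries q (multiplier re c a b) a b f))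
      {z | ri ≤ ‖z - c‖} z := by
  have hO : IsOpen (Omega re) := Metric.isOpen_ball
  have hw := P.continuousOn_fieldSeries hq hD
  have hne : z - c ≠ 0 := norm_pos_iff.1 (P.ri_pos.trans_le hzc)
  have h4 := (hasDerivAt_reflection_conj (ri := ri) (sub_ne_zero.1 hne)).continuousAt
  have h5 := Complex.continuous_conj.continuousAt.comp h4
  have e : (⇑(starRingEnd ℂ) ∘ fun z => conj (reflection ri c z)) = reflection ri c := by
    ext z
    simp
  rw [e] at h5
  have h6 := (hw.continuousAt (hO.mem_nhds hz)).continuousWithinAt (s := {z : ℂ | ri ≤ ‖z - c‖})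
  have h7 : ContinuousWithinAt
      (fun z => fieldSeries q (multiplier re c a b) a b f (reflection ri c z))
      {z : ℂ | ri ≤ ‖z - c‖} z :=
    ((hw.continuousAt (hO.mem_nhds (P.reflection_mem hzc))).comp h5).continuousWithinAt
  have h8 : ContinuousWithinAt (fun z : ℂ => (q : ℂ) * ((ri : ℂ) ^ 2 / (z - c) ^ 2))
      {z : ℂ | ri ≤ ‖z - c‖} z :=
    (continuousAt_const.mul (ContinuousAt.div (f := fun _ => (ri : ℂ) ^ 2)
      (g := fun z : ℂ => (z - c) ^ 2) continuousAt_const (by fun_prop)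
      (pow_ne_zero 2 hne))).continuousWithinAt
  exact h6.add (h8.mul (Complex.continuous_conj.continuousAt.comp_continuousWithinAt h7))

variable {ε k : ℝ} {v : ℂ → ℝ}

lemma gradient_eq (hc : c = ri + ε) (hk : 0 < k) (hqk : 1 + q = k * (1 - q))
    (hv : IsSolution re ri ε k g v) {z : ℂ} (hz : z ∈ Gap re ri ε) :
    gradient v z = conj (gapField q ri c (fieldSeries q (multiplier re c a b) a b f) z) := by
  have hε : 0 < ε := by linarith [P.ri_lt]
  have hεr : ε < re - ri := by linarith [P.c_lt]
  have heq := hv.eqOn P.ri_pos hε hεr hk (P.isSolution_explicitSolution hq hD hc hqk)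
  have hmem : ∀ y ∈ Gap re ri ε, y ∈ Omega re ∧ ri ≤ ‖y - c‖ := by
    intro y hy
    refine ⟨hy.1, ?_⟩
    have := hy.2
    rw [closure_Incl P.ri_pos, mem_closedBall_iff_norm, not_le, centreD, ← hc] at this
    exact this.le
  obtain ⟨h1, h2⟩ := hmem z hz
  refine HasGradientAt.gradient ?_
  refine (hasGradientAt_re (P.hasDerivAt_gapPotential hq hD h1 h2)).congr_of_eventuallyEq ?_
  filter_upwards [isOpen_Gap.mem_nhds hz] with y hy
  obtain ⟨h3, h4⟩ := hmem y hy
  rw [heq (subset_closure h3), P.explicitSolution_of_le hq hD h3 h4]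

lemma gapGradNorm_le (hc : c = ri + ε) (hk : 0 < k) (hqk : 1 + q = k * (1 - q))
    (hv : IsSolution re ri ε k g v) {W : ℝ}
    (hW : ∀ z ∈ Omega re, ‖fieldSeries q (multiplier re c a b) a b f z‖ ≤ W) :
    gapGradNorm re ri ε v ≤ ENNReal.ofReal (2 * W) := by
  rw [gapGradNorm, eLpNorm_exponent_top]
  refine eLpNormEssSup_le_of_ae_bound ?_
  filter_upwards [ae_restrict_mem isOpen_Gap.measurableSet] with z hz
  rw [P.gradient_eq hq hD hc hk hqk hv hz, RCLike.norm_conj]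
  refine P.norm_gapField_le hq hW hz.1 ?_
  have := hz.2
  rw [closure_Incl P.ri_pos, mem_closedBall_iff_norm, not_le, centreD, ← hc] at this
  exact this.le

/-- The gradient extends continuously from the gap to $\partial D$. A larger value at a boundary
point would persist on a nonempty open part of the gap, which has positive measure. -/
lemma le_gapGradNorm (hc : c = ri + ε) (hk : 0 < k) (hqk : 1 + q = k * (1 - q))
    (hv : IsSolution re ri ε k g v) {z : ℂ} (hzc : ‖z - c‖ = ri) :
    ENNReal.ofReal ‖gapField q ri c (fieldSeries q (multiplier re c a b) a b f) z‖
      ≤ gapGradNorm re ri ε v := by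
  set F := gapField q ri c (fieldSeries q (multiplier re c a b) a b f) with hF
  have hO : IsOpen (Omega re) := Metric.isOpen_ball
  have hzO : z ∈ Omega re := mem_ball_iff_norm.2 (P.norm_sub_re_lt_of_norm_sub_c_le hzc.le)
  have hcl : closure (Incl ri ε) = Metric.closedBall (c : ℂ) ri := by
    rw [closure_Incl P.ri_pos, centreD, hc]
  have hsub : Gap re ri ε ⊆ {z : ℂ | ri ≤ ‖z - c‖} := fun y hy => by
    have := hy.2
    rw [hcl, mem_closedBall_iff_norm, not_le] at this
    exact this.le
  have hzG : z ∈ closure (Gap re ri ε) := by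
    have h1 : z ∈ closure (Metric.closedBall (c : ℂ) ri)ᶜ := by
      have h2 : z ∈ frontier (Metric.closedBall (c : ℂ) ri) := by
        rw [frontier_closedBall _ P.ri_pos.ne', mem_sphere_iff_norm]
        exact hzc
      rw [frontier_eq_closure_inter_closure] at h2
      exact h2.2
    have h3 := hO.inter_closure ⟨hzO, h1⟩
    rwa [Gap, hcl, sdiff_eq]
  by_contra hlt
  rw [not_le, ofReal_norm] at hlt
  have hcont := ((P.continuousWithinAt_gapField hq hD hzO hzc.ge).mono hsub).enorm
  have hev : ∀ᶠ y in 𝓝[Gap re ri ε] z, gapGradNorm re ri ε v < ‖F y‖ₑ :=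
    hcont.eventually (lt_mem_nhds hlt)
  rw [eventually_nhdsWithin_iff, eventually_nhds_iff] at hev
  obtain ⟨t, ht, hto, hzt⟩ := hev
  have hpos : 0 < volume (t ∩ Gap re ri ε) :=
    (hto.inter isOpen_Gap).measure_pos volume (mem_closure_iff.1 hzG t hto hzt)
  have hae : ∀ᵐ y ∂(volume.restrict (Gap re ri ε)), ‖gradient v y‖ₑ ≤ gapGradNorm re ri ε v := by
    rw [gapGradNorm, eLpNorm_exponent_top]
    exact enorm_ae_le_eLpNormEssSup _ _
  rw [ae_restrict_iff' isOpen_Gap.measurableSet, ae_iff] at hae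
  refine hpos.ne' (measure_mono_null (fun y hy => ?_) hae)
  intro hcontra
  have h1 := hcontra hy.2
  rw [P.gradient_eq hq hD hc hk hqk hv hy.2] at h1
  have h2 := ht y hy.1 hy.2
  rw [← hF, ← ofReal_norm, RCLike.norm_conj, ofReal_norm] at h1
  exact absurd h1 (not_le.2 h2)

end

end Pencil

end

/-! ### Bounds in terms of the distance and of the contrast -/

section

/-- The coefficient `(k - 1) / (k + 1)` of the image series. -/
def contrast (k : ℝ) : ℝ := (k - 1) / (k + 1)

section

variable {k : ℝ}

lemma one_sub_contrast (hk : 0 < k) : 1 - contrast k = 2 / (k + 1) := by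
  rw [contrast]
  field_simp
  ring

lemma one_add_contrast (hk : 0 < k) : 1 + contrast k = k * (1 - contrast k) := by
  rw [contrast]
  field_simp
  ring

lemma abs_contrast_lt_one (hk : 0 < k) : |contrast k| < 1 := by
  rw [contrast, abs_div, abs_of_pos (by linarith : 0 < k + 1), div_lt_one (by linarith), abs_lt]
  constructor <;> linarith

lemma contrast_nonneg (hk : 1 ≤ k) : 0 ≤ contrast k :=
  div_nonneg (by linarith) (by linarith)

lemma contrast_nonpos (hk : 0 < k) (hk1 : k ≤ 1) : contrast k ≤ 0 :=
  div_nonpos_of_nonpos_of_nonneg (by linarith) (by linarith)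

lemma one_div_le_one_sub_contrast (hk : 1 ≤ k) : 1 / k ≤ 1 - contrast k := by
  rw [one_sub_contrast (by linarith), div_le_div_iff₀ (by linarith) (by linarith)]
  linarith

lemma one_sub_contrast_le (hk : 0 < k) : 1 - contrast k ≤ 2 * (1 / k) := by
  rw [one_sub_contrast hk, mul_one_div]
  gcongr
  linarith

end

/-- The remainder constant of the comparison of the field with its leading term. -/
def remainderConst (re ri : ℝ) : ℝ :=
  (27 * (1 + (2 * re + 8 * re ^ 2 / (re - ri)) / ri) + 4) * (2 * re ^ 2 / (re - ri))

lemma remainderConst_nonneg {re ri : ℝ} (hri : 0 < ri) (hre : ri < re) :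
    0 ≤ remainderConst re ri := by
  have := sub_pos.2 hre
  have : 0 < re := hri.trans hre
  unfold remainderConst
  positivity

namespace Pencil

variable {re ri ε a b : ℝ}

section

variable (P : Pencil re ri (ri + ε) a b)
include P

lemma eps_pos : 0 < ε := by linarith [P.ri_lt]

lemma eps_lt : ε < re - ri := by linarith [P.c_lt]

/-- In `sq_mul_sub` the square term is enough for $\epsilon\ge(r_e-r_i)/2$; otherwise
$r_e-c\ge(r_e-r_i)/2$ and the cross term is enough. -/
lemma sqrt_mul_sqrt_le :
    √(2 * ri ^ 2 * (re - ri)) * √ε ≤ (re - (ri + ε)) * (a - b) := by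
  have h1 := P.eps_pos
  have h2 := P.eps_lt
  have h3 := P.ri_pos
  have h4 : 0 < re - ri := by linarith
  have hd : 0 < re - (ri + ε) := sub_pos.2 P.c_lt
  rw [← Real.sqrt_mul (by positivity), Real.sqrt_le_iff]
  refine ⟨mul_nonneg hd.le (sub_pos.2 P.lt).le, ?_⟩
  have hE : 2 * ri * ε ≤ (ri + ε) ^ 2 - ri ^ 2 := by nlinarith
  have hE0 : 0 < 2 * ri * ε := by positivity
  have hre := P.re_pos
  rw [P.sq_mul_sub]
  set E := (ri + ε) ^ 2 - ri ^ 2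
  rcases le_total ((re - ri) / 2) ε with h | h
  · have h5 : (2 * ri * ε) ^ 2 ≤ E ^ 2 := by gcongr
    have h6 : 0 ≤ 4 * re * (re - (ri + ε)) * E := by
      have : 0 < E := by linarith
      positivity
    have h7 : 2 * ri ^ 2 * (re - ri) * ε ≤ (2 * ri * ε) ^ 2 := by
      have : 0 ≤ 4 * ri ^ 2 * ε * (ε - (re - ri) / 2) :=
        mul_nonneg (by positivity) (by linarith)
      nlinarith
    linarith
  · have h5 : 4 * re * ((re - ri) / 2) * (2 * ri * ε) ≤ 4 * re * (re - (ri + ε)) * E := by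
      gcongr
      linarith
    have h6 : 2 * ri ^ 2 * (re - ri) * ε ≤ 4 * re * ((re - ri) / 2) * (2 * ri * ε) := by
      have : 0 ≤ 2 * ri * (re - ri) * ε * (2 * re - ri) :=
        mul_nonneg (by positivity) (by linarith)
      nlinarith
    nlinarith [sq_nonneg E]

lemma mul_sub_le_sqrt : (re - (ri + ε)) * (a - b) ≤ √(12 * re ^ 3) * √ε := by
  have h1 := P.eps_pos
  have h2 := P.eps_lt
  have h3 := P.ri_pos
  have hre := P.re_pos
  have hd : 0 < re - (ri + ε) := sub_pos.2 P.c_lt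
  rw [← Real.sqrt_mul (by positivity)]
  refine Real.le_sqrt_of_sq_le ?_
  rw [P.sq_mul_sub]
  have hE : (ri + ε) ^ 2 - ri ^ 2 ≤ 2 * re * ε := by nlinarith
  have hE0 : 0 ≤ (ri + ε) ^ 2 - ri ^ 2 := by nlinarith
  set E := (ri + ε) ^ 2 - ri ^ 2
  calc E ^ 2 + 4 * re * (re - (ri + ε)) * E
      ≤ (2 * re * ε) ^ 2 + 4 * re * re * (2 * re * ε) := by
        gcongr
        linarith
    _ = 4 * re ^ 2 * ε * ε + 8 * re ^ 3 * ε := by ring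
    _ ≤ 4 * re ^ 2 * ε * re + 8 * re ^ 3 * ε := by
        gcongr
        linarith
    _ = _ := by ring

lemma sqrt_le_one_sub_multiplier :
    √(2 * ri ^ 2 * (re - ri)) / re ^ 2 * √ε ≤ 1 - multiplier re (ri + ε) a b := by
  refine le_trans ?_ P.le_one_sub_multiplier
  have := P.re_pos
  rw [div_mul_eq_mul_div]
  exact div_le_div_of_nonneg_right P.sqrt_mul_sqrt_le (by positivity)

lemma one_sub_multiplier_le_sqrt :
    1 - multiplier re (ri + ε) a b ≤ √(12 * re ^ 3) / (re * ri) * √ε := by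
  refine P.one_sub_multiplier_le.trans ?_
  have := P.re_pos
  have := P.ri_pos
  rw [div_mul_eq_mul_div]
  exact div_le_div_of_nonneg_right P.mul_sub_le_sqrt (by positivity)

lemma sub_le_sqrt (hε : ε ≤ (re - ri) / 2) : a - b ≤ 2 * √(12 * re ^ 3) / (re - ri) * √ε := by
  have h := P.mul_sub_le_sqrt
  have h2 : 0 < re - ri := by linarith [P.eps_lt, P.eps_pos]
  have hL := sub_pos.2 P.lt
  rw [div_mul_eq_mul_div, le_div_iff₀ h2]
  nlinarith

lemma sub_le (hε : ε ≤ (re - ri) / 2) : a - b ≤ 8 * re ^ 2 / (re - ri) := by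
  refine (P.sub_le_sqrt hε).trans ?_
  have h2 : 0 < re - ri := by linarith [P.eps_lt, P.eps_pos]
  have hre := P.re_pos
  rw [div_mul_eq_mul_div]
  refine div_le_div_of_nonneg_right ?_ h2.le
  have h3 : √(12 * re ^ 3) * √ε ≤ 4 * re ^ 2 := by
    rw [← Real.sqrt_mul (by positivity), Real.sqrt_le_iff]
    refine ⟨by positivity, ?_⟩
    have h4 : ε ≤ re := by linarith [P.eps_lt, P.ri_pos]
    calc 12 * re ^ 3 * ε ≤ 12 * re ^ 3 * re := by gcongr
      _ ≤ _ := by nlinarith [pow_pos hre 4]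
  linarith

/-- Here $(1-\mu)/(a-b)$ is bounded above and below. The upper bound on $\epsilon$ keeps $r_e-c$,
and with it $a-b$, under control. -/
lemma remainder_le (hε : ε ≤ (re - ri) / 2) :
    (27 * (1 + (1 - multiplier re (ri + ε) a b) * (2 * re + (a - b)) / (a - b)) + 4)
      * ((a - b) / (1 - multiplier re (ri + ε) a b)) ≤ remainderConst re ri := by
  have h2 : 0 < re - ri := by linarith [P.eps_lt, P.eps_pos]
  have hre := P.re_pos
  have hri := P.ri_pos
  have hL := sub_pos.2 P.lt
  have hd : 0 < re - (ri + ε) := sub_pos.2 P.c_lt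
  have hμ := sub_pos.2 P.multiplier_lt_one
  have hLle := P.sub_le hε
  have e1 := P.one_sub_multiplier_le
  have e2 := P.le_one_sub_multiplier
  set μ := multiplier re (ri + ε) a b
  set L := a - b
  have h3 : (1 - μ) * (2 * re + L) / L ≤ (2 * re + 8 * re ^ 2 / (re - ri)) / ri := by
    rw [div_le_div_iff₀ hL hri]
    have h4 : (1 - μ) * ri ≤ L := by
      rw [le_div_iff₀ (by positivity)] at e1
      have h5 : (re - (ri + ε)) * L ≤ re * L := by
        gcongr
        linarith [P.eps_pos]
      have h6 : re * ((1 - μ) * ri) ≤ re * L := by linarith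
      exact le_of_mul_le_mul_left h6 hre
    calc (1 - μ) * (2 * re + L) * ri = (1 - μ) * ri * (2 * re + L) := by ring
      _ ≤ L * (2 * re + 8 * re ^ 2 / (re - ri)) := by gcongr
      _ = _ := by ring
  have h4 : L / (1 - μ) ≤ 2 * re ^ 2 / (re - ri) := by
    rw [div_le_div_iff₀ hμ h2]
    rw [div_le_iff₀ (by positivity)] at e2
    have h5 : L * (re - ri) ≤ 2 * ((re - (ri + ε)) * L) := by nlinarith
    linarith
  unfold remainderConst
  gcongr

variable {k Λ : ℝ} {g : ℂ → ℝ} {h f : ℂ → ℂ} {H : ℂ → ℝ}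

lemma norm_fieldSeries_sub_le_remainder (hε : ε ≤ (re - ri) / 2) (hk : 0 < k)
    (hD : DirichletData re Λ g h f H) {f₀ : ℂ} (hf₀ : ∀ z ∈ Omega re, ‖f z - f₀‖ ≤ Λ * ‖z‖)
    {z : ℂ} (hz : z ∈ Omega re) :
    ‖fieldSeries (contrast k) (multiplier re (ri + ε) a b) a b f z
        - f₀ * weightSum (contrast k) (multiplier re (ri + ε) a b) (chart a b z)‖
      ≤ remainderConst re ri * Λ := by
  refine (P.norm_fieldSeries_sub_le (abs_contrast_lt_one hk) hD hf₀ hz).trans ?_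
  have hΛ : 0 ≤ Λ := (norm_nonneg _).trans (hD.norm_le z hz)
  rw [mul_assoc, mul_comm]
  exact mul_le_mul_of_nonneg_right (P.remainder_le hε) hΛ

/-- For $0\le q,\mu\le1$, $1-q\mu$ dominates both $1-q\ge1/k$ and $1-\mu\gtrsim\sqrt\epsilon$. -/
lemma le_one_sub_contrast_mul (hk : 1 ≤ k) :
    1 / k + √ε ≤ (1 + re ^ 2 / √(2 * ri ^ 2 * (re - ri)))
      * (1 - contrast k * multiplier re (ri + ε) a b) := by
  have h0 : 0 < re - ri := by linarith [P.eps_lt, P.eps_pos]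
  have hri := P.ri_pos
  have hre := P.re_pos
  have hs : 0 < √(2 * ri ^ 2 * (re - ri)) := Real.sqrt_pos.2 (by positivity)
  have h1 := one_div_le_one_sub_contrast hk
  have h2 := P.sqrt_le_one_sub_multiplier
  have hμ0 := P.multiplier_pos
  have hμ1 := P.multiplier_lt_one
  have hq0 := contrast_nonneg hk
  have hq1 := (abs_lt.1 (abs_contrast_lt_one (by linarith : 0 < k))).2
  set μ := multiplier re (ri + ε) a b
  set s := √(2 * ri ^ 2 * (re - ri))
  have h3 : 1 - contrast k ≤ 1 - contrast k * μ := by nlinarith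
  have h4 : 1 - μ ≤ 1 - contrast k * μ := by nlinarith
  have h5 : √ε ≤ re ^ 2 / s * (1 - μ) := by
    rw [div_mul_eq_mul_div, le_div_iff₀ hs]
    rw [div_mul_eq_mul_div, div_le_iff₀ (by positivity)] at h2
    linarith
  have h6 : re ^ 2 / s * (1 - μ) ≤ re ^ 2 / s * (1 - contrast k * μ) := by gcongr
  linarith

lemma one_sub_contrast_mul_le (hk : 0 < k) : 1 - contrast k * multiplier re (ri + ε) a b
    ≤ (2 + √(12 * re ^ 3) / (re * ri)) * (1 / k + √ε) := by
  have h1 := one_sub_contrast_le hk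
  have h2 := P.one_sub_multiplier_le_sqrt
  have hμ0 := P.multiplier_pos
  have hμ1 := P.multiplier_lt_one
  have hq := abs_lt.1 (abs_contrast_lt_one hk)
  have hri := P.ri_pos
  have hre := P.re_pos
  set μ := multiplier re (ri + ε) a b
  have hC : 0 ≤ √(12 * re ^ 3) / (re * ri) := by positivity
  set C := √(12 * re ^ 3) / (re * ri)
  have h3 : 0 < 1 / k := by positivity
  have h4 : 0 ≤ √ε := Real.sqrt_nonneg _
  nlinarith [mul_nonneg hC h3.le]

end

end Pencil

end

/-! ### Upper and lower bounds for the field -/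

section

/-- The constant of the upper bound for the field. -/
def upperConst (re ri : ℝ) : ℝ := 4 * (1 + re ^ 2 / √(2 * ri ^ 2 * (re - ri)))

/-- The constant of the remainder in the upper bound for the field. -/
def upperRemainder (re ri : ℝ) : ℝ :=
  37 + remainderConst re ri
    + 4 * (re ^ 2 / (√(2 * ri ^ 2 * (re - ri)) * √((re - ri) / 2)))

/-- The constant of the lower bound for the field. -/
def lowerConst (re ri : ℝ) : ℝ := 320000 * (2 + √(12 * re ^ 3) / (re * ri))

lemma upperConst_pos (re ri : ℝ) : 0 < upperConst re ri := by
  unfold upperConst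
  positivity

lemma upperRemainder_nonneg {re ri : ℝ} (hri : 0 < ri) (hre : ri < re) :
    0 ≤ upperRemainder re ri := by
  have := remainderConst_nonneg hri hre
  unfold upperRemainder
  positivity

lemma lowerConst_pos {re ri : ℝ} (hri : 0 < ri) (hre : ri < re) : 0 < lowerConst re ri := by
  have : 0 < re := hri.trans hre
  unfold lowerConst
  positivity

lemma exists_norm_eq_one_im_eq {s : ℝ} (hs : 0 ≤ s) (hs1 : s ≤ 1) :
    ∃ e : ℂ, ‖e‖ = 1 ∧ e.im = s ∧ ‖1 - e‖ ≤ 2 * s := by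
  have h0 : 0 ≤ 1 - s ^ 2 := by nlinarith
  have hrsq : √(1 - s ^ 2) ^ 2 = 1 - s ^ 2 := Real.sq_sqrt h0
  have hr0 := Real.sqrt_nonneg (1 - s ^ 2)
  set r := √(1 - s ^ 2)
  refine ⟨⟨r, s⟩, ?_, rfl, ?_⟩
  · rw [← sq_eq_sq₀ (norm_nonneg _) zero_le_one, ← Complex.normSq_eq_norm_sq, Complex.normSq_apply]
    linear_combination hrsq
  · rw [← sq_le_sq₀ (norm_nonneg _) (by positivity), ← Complex.normSq_eq_norm_sq,
      Complex.normSq_apply]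
    simp only [Complex.sub_re, Complex.sub_im, Complex.one_re, Complex.one_im]
    have hr1 : r ≤ 1 := by nlinarith
    nlinarith

namespace Pencil

variable {re ri ε a b : ℝ}

section

variable (P : Pencil re ri (ri + ε) a b)
include P

variable {k Λ : ℝ} {g : ℂ → ℝ} {h f : ℂ → ℂ} {H : ℂ → ℝ}

/-- Three regimes: for a wide gap the crude bound goes into the remainder; for a narrow gap with
$k\le1$ the bound $37$ does; only a narrow gap with $k\ge1$ produces the singular term. -/
lemma norm_fieldSeries_le_upper (hk : 0 < k) (hD : DirichletData re Λ g h f H) {f₀ : ℂ}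
    (hf₀ : ∀ z ∈ Omega re, ‖f z - f₀‖ ≤ Λ * ‖z‖) (hf₀Λ : ‖f₀‖ ≤ Λ) {z : ℂ}
    (hz : z ∈ Omega re) :
    ‖fieldSeries (contrast k) (multiplier re (ri + ε) a b) a b f z‖
      ≤ upperConst re ri * (‖f₀‖ / (1 / k + √ε)) + upperRemainder re ri * Λ := by
  have hΛ : 0 ≤ Λ := (norm_nonneg _).trans hf₀Λ
  have hri := P.ri_pos
  have hre := P.re_pos
  have hεpos := P.eps_pos
  have hd : 0 < re - ri := by linarith [P.eps_lt]
  have hrem := remainderConst_nonneg hri (by linarith : ri < re)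
  have hs : 0 < √(2 * ri ^ 2 * (re - ri)) := Real.sqrt_pos.2 (by positivity)
  have hsε : 0 < √ε := Real.sqrt_pos.2 hεpos
  have hτ : 0 < 1 / k + √ε := by positivity
  have hU := upperConst_pos re ri
  have hmain : 0 ≤ upperConst re ri * (‖f₀‖ / (1 / k + √ε)) := by positivity
  have hμ := sub_pos.2 P.multiplier_lt_one
  rcases le_total ((re - ri) / 2) ε with hε | hε
  · have h1 := P.norm_fieldSeries_le (abs_contrast_lt_one hk) hD hz
    have h2 : 4 * Λ / (1 - multiplier re (ri + ε) a b)
        ≤ 4 * (re ^ 2 / (√(2 * ri ^ 2 * (re - ri)) * √((re - ri) / 2))) * Λ := by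
      have h3 := P.sqrt_le_one_sub_multiplier
      have h4 : √(2 * ri ^ 2 * (re - ri)) / re ^ 2 * √((re - ri) / 2)
          ≤ 1 - multiplier re (ri + ε) a b := h3.trans' (by gcongr)
      have hs2 : 0 < √((re - ri) / 2) := Real.sqrt_pos.2 (by positivity)
      calc 4 * Λ / (1 - multiplier re (ri + ε) a b)
          ≤ 4 * Λ / (√(2 * ri ^ 2 * (re - ri)) / re ^ 2 * √((re - ri) / 2)) := by gcongr
        _ = _ := by field_simp
    have h5 : 4 * (re ^ 2 / (√(2 * ri ^ 2 * (re - ri)) * √((re - ri) / 2))) * Λ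
        ≤ upperRemainder re ri * Λ := by
      refine mul_le_mul_of_nonneg_right ?_ hΛ
      unfold upperRemainder
      linarith
    linarith
  · have h1 := P.norm_fieldSeries_sub_le_remainder hε hk hD hf₀ hz
    have h2 := norm_le_norm_add_norm_sub'
      (fieldSeries (contrast k) (multiplier re (ri + ε) a b) a b f z)
      (f₀ * weightSum (contrast k) (multiplier re (ri + ε) a b) (chart a b z))
    rw [norm_mul] at h2
    have hφ := (P.norm_chart_lt_one (mem_ball_iff_norm.1 hz).le).le
    have hφ1 := P.chart_ne_one hz
    have hq := abs_contrast_lt_one hk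
    have hextra : 0 ≤ 4 * (re ^ 2 / (√(2 * ri ^ 2 * (re - ri)) * √((re - ri) / 2))) * Λ := by
      positivity
    have hR : upperRemainder re ri * Λ = 37 * Λ + remainderConst re ri * Λ
        + 4 * (re ^ 2 / (√(2 * ri ^ 2 * (re - ri)) * √((re - ri) / 2))) * Λ := by
      rw [upperRemainder]
      ring
    rcases le_total k 1 with hk1 | hk1
    · have h3 := norm_weightSum_le_of_nonpos hφ hφ1 P.multiplier_pos.le P.multiplier_lt_one hq.le
        (contrast_nonpos hk hk1)
      have h4 := mul_le_mul hf₀Λ h3 (norm_nonneg _) hΛ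
      linarith
    · have h3 := norm_weightSum_le hφ hφ1 P.multiplier_pos.le P.multiplier_lt_one hq.le
      rw [abs_of_nonneg (contrast_nonneg hk1)] at h3
      have h4 := P.le_one_sub_contrast_mul hk1
      have hσ : 0 < 1 - contrast k * multiplier re (ri + ε) a b := by
        have h5 : 0 < 1 + re ^ 2 / √(2 * ri ^ 2 * (re - ri)) := by positivity
        exact pos_of_mul_pos_right (hτ.trans_le h4) h5.le
      have h5 : 4 / (1 - contrast k * multiplier re (ri + ε) a b)
          ≤ upperConst re ri / (1 / k + √ε) := by
        rw [div_le_div_iff₀ hσ hτ, upperConst]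
        linarith
      have h6 := mul_le_mul_of_nonneg_left (h3.trans h5) (norm_nonneg f₀)
      have h7 : ‖f₀‖ * (upperConst re ri / (1 / k + √ε))
          = upperConst re ri * (‖f₀‖ / (1 / k + √ε)) := by ring
      have h8 : 0 ≤ 37 * Λ := by positivity
      linarith

/-- On $\partial D$, $r_i=(c-b)|\varphi|$ and $c-a=(c-b)|\varphi|^2$, so the normal can be expressed
by $\varphi$ alone and multiplied into the weights. -/
lemma unitNormal_chart {z : ℂ} (hz : ‖z - (ri + ε : ℝ)‖ = ri) :
    (z - (ri + ε : ℝ)) / ri = unitNormal (chart a b z) := by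
  set c := ri + ε with hc
  have hb := P.ne_b (P.norm_sub_re_lt_of_norm_sub_c_le hz.le).le
  have hφ1 := P.chart_ne_one (mem_ball_iff_norm.2 (P.norm_sub_re_lt_of_norm_sub_c_le hz.le))
  have hsq := (P.sq_norm_chart_eq_c hb).2 hz
  have hzp := param_chart P.lt hb
  set φ := chart a b z with hφ
  have hcb := P.c_sub_b_pos
  have hφpos : 0 < ‖φ‖ := by
    have h1 : 0 < ‖φ‖ ^ 2 := by rw [hsq]; exact P.sqRadius_c_pos
    exact (norm_nonneg _).lt_of_ne' fun h => by simp [h] at h1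
  have h1 : 1 - φ ≠ 0 := sub_ne_zero.2 hφ1.symm
  have h2 : (‖φ‖ : ℂ) ≠ 0 := Complex.ofReal_ne_zero.2 hφpos.ne'
  have h3 : (c : ℂ) - b ≠ 0 := by
    rw [← Complex.ofReal_sub]
    exact Complex.ofReal_ne_zero.2 hcb.ne'
  have hca : c - a = (c - b) * ‖φ‖ ^ 2 := by
    rw [hsq, sqRadius, mul_div_cancel₀ _ hcb.ne']
  have hri : ri = (c - b) * ‖φ‖ := by
    have h4 : ri ^ 2 = ((c - b) * ‖φ‖) ^ 2 := by
      rw [← P.inner, hca]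
      ring
    exact (pow_left_inj₀ P.ri_pos.le (by positivity) two_ne_zero).1 h4
  have hn : (‖φ‖ : ℂ) ^ 2 = φ * conj φ := by
    rw [Complex.mul_conj, Complex.normSq_eq_norm_sq]
    push_cast
    rfl
  have hn1 : (‖1 - φ‖ : ℂ) ^ 2 = (1 - φ) * (1 - conj φ) := by
    have : (1 : ℂ) - conj φ = conj (1 - φ) := by simp
    rw [this, Complex.mul_conj, Complex.normSq_eq_norm_sq]
    push_cast
    rfl
  have hcaC : (c : ℂ) - a = (c - b) * (φ * conj φ) := by
    rw [← hn]
    exact_mod_cast congrArg Complex.ofReal hca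
  have hriC : (ri : ℂ) = (c - b) * ‖φ‖ := by exact_mod_cast congrArg Complex.ofReal hri
  have hzc : z - c = (c - b) * φ * (1 - conj φ) / (1 - φ) := by
    rw [← hzp, param]
    field_simp
    linear_combination -hcaC
  rw [unitNormal, hn1, hriC, hzc]
  field_simp

lemma norm_leading_le (hk : 1 ≤ k) (hε : ε ≤ (re - ri) / 2) (hD : DirichletData re Λ g h f H)
    {f₀ : ℂ} (hf₀ : ∀ z ∈ Omega re, ‖f z - f₀‖ ≤ Λ * ‖z‖) {z : ℂ}
    (hz : ‖z - (ri + ε : ℝ)‖ = ri) :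
    |(f₀ * weightSum (contrast k) (multiplier re (ri + ε) a b) (chart a b z)
        * unitNormal (chart a b z)).re| - remainderConst re ri * Λ
      ≤ ‖gapField (contrast k) ri (ri + ε)
        (fieldSeries (contrast k) (multiplier re (ri + ε) a b) a b f) z‖ := by
  have hzO : z ∈ Omega re := mem_ball_iff_norm.2 (P.norm_sub_re_lt_of_norm_sub_c_le hz.le)
  have h1 := P.norm_fieldSeries_sub_le_remainder hε (by linarith : 0 < k) hD hf₀ hzO
  have h2 := P.le_norm_gapField (contrast_nonneg hk) (f := f) hz
  set w := fieldSeries (contrast k) (multiplier re (ri + ε) a b) a b f z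
  set S := f₀ * weightSum (contrast k) (multiplier re (ri + ε) a b) (chart a b z)
  have hν : ‖unitNormal (chart a b z)‖ = 1 := by
    rw [← P.unitNormal_chart hz, norm_div, hz, Complex.norm_real, Real.norm_of_nonneg P.ri_pos.le,
      div_self P.ri_pos.ne']
  rw [P.unitNormal_chart hz] at h2
  set ν := unitNormal (chart a b z)
  have h3 : |((w - S) * ν).re| ≤ remainderConst re ri * Λ := by
    refine (Complex.abs_re_le_norm _).trans ?_
    rwa [norm_mul, hν, mul_one]
  have h4 : (S * ν).re = (w * ν).re - ((w - S) * ν).re := by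
    rw [← Complex.sub_re]
    ring_nf
  have h5 := abs_sub (w * ν).re ((w - S) * ν).re
  rw [h4]
  linarith

/-- At $z=\epsilon$, the point of $\partial D$ nearest the origin, the normal is $-1$ and the chart
is a negative real number, so the image contributions add up. -/
lemma exists_real_point (hk : 1 ≤ k) {f₀ : ℂ} (him : f₀.im = 0) :
    ∃ z : ℂ, ‖z - (ri + ε : ℝ)‖ = ri ∧
      ‖f₀‖ / (1 - contrast k * multiplier re (ri + ε) a b)
        ≤ |(f₀ * weightSum (contrast k) (multiplier re (ri + ε) a b) (chart a b z)
          * unitNormal (chart a b z)).re| := by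
  have hz : ‖(ε : ℂ) - (ri + ε : ℝ)‖ = ri := by
    rw [← Complex.ofReal_sub, Complex.norm_real, Real.norm_eq_abs, sub_add_cancel_right, abs_neg,
      abs_of_pos P.ri_pos]
  refine ⟨ε, hz, ?_⟩
  rw [← P.unitNormal_chart hz]
  have hzO := (P.norm_sub_re_lt_of_norm_sub_c_le hz.le).le
  have hν : ((ε : ℂ) - (ri + ε : ℝ)) / ri = -1 := by
    have : (ri : ℂ) ≠ 0 := Complex.ofReal_ne_zero.2 P.ri_pos.ne'
    push_cast
    field_simp
    ring
  have hchart : chart a b ε = ((-((a - ε) / (ε - b)) : ℝ) : ℂ) := by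
    rw [chart]
    push_cast
    ring
  have hεb : 0 < ε - b := by linarith [P.eps_pos, P.b_neg]
  -- This says $a>\epsilon$: as $(c-a)(c-b)=r_i^2$ and $c-b>r_i$, necessarily $c-a<r_i$.
  have hcalt : ri + ε - a < ri := by
    have h1 := P.inner
    have h2 : ri < ri + ε - b := by linarith
    have h3 := P.c_sub_a_pos
    nlinarith [P.ri_pos]
  have hρ0 : 0 ≤ (a - ε) / (ε - b) := div_nonneg (by linarith) hεb.le
  have hρ1 : (a - ε) / (ε - b) ≤ 1 := by
    have h1 := (P.norm_chart_lt_one hzO).le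
    rwa [hchart, Complex.norm_real, norm_neg, Real.norm_of_nonneg hρ0] at h1
  have hq := abs_lt.1 (abs_contrast_lt_one (by linarith : 0 < k))
  have hS := le_re_weightSum_neg hρ0 hρ1 P.multiplier_pos.le P.multiplier_lt_one
    (contrast_nonneg hk) hq.2.le
  have hσ : 0 < 1 - contrast k * multiplier re (ri + ε) a b := by
    have h1 := P.multiplier_lt_one
    have h2 := P.multiplier_pos
    nlinarith [contrast_nonneg hk]
  have hf : f₀ = (f₀.re : ℂ) := Complex.ext rfl (by simpa using him)
  rw [hν, hchart, mul_neg_one, Complex.neg_re, abs_neg]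
  set S := weightSum (contrast k) (multiplier re (ri + ε) a b) ((-((a - ε) / (ε - b)) : ℝ) : ℂ)
  have hnf : ‖f₀‖ = |f₀.re| := by
    conv_lhs => rw [hf, Complex.norm_real, Real.norm_eq_abs]
  have hre : (f₀ * S).re = f₀.re * S.re := by
    conv_lhs => rw [hf]
    rw [Complex.re_ofReal_mul]
  have hS0 : 0 ≤ S.re := le_trans (by positivity) hS
  rw [hre, abs_mul, hnf, abs_of_nonneg hS0, div_eq_mul_one_div]
  gcongr

/-- The point has chart $\rho e$, with $\rho$ the radius of the image of $\partial D$, $|e|=1$ and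
$\mathrm{Im}\,e=\alpha/2$. Smallness of $\sigma$ and of $a-b$ gives $1-\rho\le\alpha$ and
$\rho\ge1/2$, hence $\mathrm{Im}\,\varphi\ge\alpha/4$ and $|1-\varphi|\le2\alpha$. -/
lemma exists_imaginary_point (hk : 1 ≤ k) {f₀ : ℂ} (hre0 : f₀.re = 0)
    (hσ1 : 8 * (1 - contrast k * multiplier re (ri + ε) a b) ≤ 1)
    (hσ2 : (1 - contrast k * multiplier re (ri + ε) a b) * (2 * re ^ 2) ≤ ri * (re - ri))
    (hε : ε ≤ (re - ri) / 2) (hL : a - b ≤ ri / 2) :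
    ∃ z : ℂ, ‖z - (ri + ε : ℝ)‖ = ri ∧
      ‖f₀‖ * (1 / 320000 / (1 - contrast k * multiplier re (ri + ε) a b))
        ≤ |(f₀ * weightSum (contrast k) (multiplier re (ri + ε) a b) (chart a b z)
          * unitNormal (chart a b z)).re| := by
  have hq := abs_lt.1 (abs_contrast_lt_one (by linarith : 0 < k))
  have hq0 := contrast_nonneg hk
  have hμ0 := P.multiplier_pos
  have hμ1 := P.multiplier_lt_one
  have hri := P.ri_pos
  have hre := P.re_pos
  have hLpos := sub_pos.2 P.lt
  have hcb := P.c_sub_b_pos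
  have hμle := P.le_one_sub_multiplier
  set μ := multiplier re (ri + ε) a b with hμdef
  set σ := 1 - contrast k * μ with hσdef
  have hσ : 0 < σ := by nlinarith
  set α := (1 - μ) / σ with hα
  have hα0 : 0 < α := div_pos (sub_pos.2 hμ1) hσ
  have hα1 : α ≤ 1 := by
    rw [hα, div_le_one hσ]
    nlinarith
  set ρ := √(sqRadius a b (ri + ε)) with hρ
  have hρsq : ρ ^ 2 = sqRadius a b (ri + ε) := Real.sq_sqrt P.sqRadius_c_pos.le
  have hρ0 : 0 < ρ := Real.sqrt_pos.2 P.sqRadius_c_pos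
  have hρ1 : ρ < 1 := by
    rw [← sq_lt_one_iff₀ hρ0.le, hρsq]
    exact P.sqRadius_lt.trans P.sqRadius_re_lt_one
  have hone : 1 - ρ ^ 2 = (a - b) / (ri + ε - b) := by
    rw [hρsq, sqRadius]
    field_simp
    ring
  have hρle : 1 - ρ ≤ (a - b) / ri := by
    have h1 : (a - b) / (ri + ε - b) ≤ (a - b) / ri := by
      gcongr
      linarith [P.eps_pos, P.b_neg]
    nlinarith
  have hρhalf : 1 / 2 ≤ ρ := by
    have : (a - b) / ri ≤ 1 / 2 := by
      rw [div_le_div_iff₀ hri two_pos]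
      linarith
    linarith
  have hρα : 1 - ρ ≤ α := by
    refine hρle.trans ?_
    rw [hα, div_le_div_iff₀ hri hσ]
    rw [div_le_iff₀ (by positivity)] at hμle
    have h1 : (re - ri) / 2 ≤ re - (ri + ε) := by linarith
    have h2 : (re - ri) / 2 * (a - b) ≤ (1 - μ) * re ^ 2 := by nlinarith
    have h3 : (a - b) * (σ * (2 * re ^ 2)) ≤ (a - b) * (ri * (re - ri)) := by gcongr
    have h4 : (a - b) * σ * (2 * re ^ 2) ≤ (1 - μ) * ri * (2 * re ^ 2) := by nlinarith
    exact le_of_mul_le_mul_right h4 (by positivity)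
  set s := α / 2 with hs
  have hsα : α = 2 * s := by rw [hs]; ring
  have hs0 : 0 ≤ s := by rw [hs]; positivity
  have hs1 : s ≤ 1 := by linarith
  clear_value s
  obtain ⟨e, hen, heim, he1⟩ := exists_norm_eq_one_im_eq hs0 hs1
  set φ : ℂ := ρ * e with hφ
  have hφn : ‖φ‖ = ρ := by
    rw [hφ, norm_mul, hen, mul_one, Complex.norm_real, Real.norm_of_nonneg hρ0.le]
  have hφ1 : φ ≠ 1 := by
    intro h
    rw [h, norm_one] at hφn
    linarith
  have hφim : φ.im = ρ * s := by rw [hφ, Complex.im_ofReal_mul, heim]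
  have hφθ : ‖1 - φ‖ ≤ 2 * α := by
    have h1 : 1 - φ = ((1 - ρ : ℝ) : ℂ) + ρ * (1 - e) := by
      rw [hφ]
      push_cast
      ring
    rw [h1]
    refine (norm_add_le _ _).trans ?_
    rw [norm_mul, Complex.norm_real, Complex.norm_real, Real.norm_of_nonneg hρ0.le,
      Real.norm_of_nonneg (by linarith)]
    have h2 : ρ * ‖1 - e‖ ≤ 1 * (2 * s) := mul_le_mul hρ1.le he1 (norm_nonneg _) zero_le_one
    linarith
  have hchart := chart_param P.lt hφ1
  have hz : ‖param a b φ - (ri + ε : ℝ)‖ = ri := by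
    rw [← P.sq_norm_chart_eq_c (param_ne P.lt hφ1), hchart, hφn, hρsq]
  refine ⟨param a b φ, hz, ?_⟩
  rw [hchart]
  have hS := le_im_unitNormal_mul_weightSum (φ := φ) (by rw [hφn]; exact hρ1.le) hφ1 hμ0 hμ1 hq0
    hq.2 hσ1 (by rw [hφim]; nlinarith) hφθ
  set S := weightSum (contrast k) μ φ
  set ν := unitNormal φ
  have hf : f₀ = (f₀.im : ℂ) * Complex.I := Complex.ext (by simp [hre0]) (by simp)
  have hnf : ‖f₀‖ = |f₀.im| := by
    conv_lhs => rw [hf, norm_mul, Complex.norm_I, mul_one, Complex.norm_real, Real.norm_eq_abs]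
  have hreS : (f₀ * S * ν).re = -(f₀.im * (ν * S).im) := by
    have : f₀ * S * ν = (f₀.im : ℂ) * (Complex.I * (ν * S)) := by
      conv_lhs => rw [hf]
      ring
    rw [this, Complex.re_ofReal_mul, Complex.I_mul_re]
    ring
  have hS0 : 0 ≤ (ν * S).im := le_trans (by positivity) hS
  rw [hreS, abs_neg, abs_mul, abs_of_nonneg hS0, hnf]
  gcongr

end

end Pencil

end

/-! ### Bounds for the gradient norm -/

section

lemma DirichletData.exists_limit {re Λ : ℝ} {g : ℂ → ℝ} {h f : ℂ → ℂ} {H : ℂ → ℝ} (hre : 0 < re)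
    (hD : DirichletData re Λ g h f H) : ∃ f₀ : ℂ, Tendsto f (𝓝[Omega re] 0) (𝓝 f₀) ∧
      ‖f₀‖ ≤ Λ ∧ ∀ z ∈ Omega re, ‖f z - f₀‖ ≤ Λ * ‖z‖ := by
  have hΛ : 0 ≤ Λ := (norm_nonneg _).trans (hD.norm_le re (Metric.mem_ball_self hre))
  have hLip : LipschitzOnWith Λ.toNNReal f (Omega re) := LipschitzOnWith.of_dist_le_mul
    fun z hz w hw => by
      rw [Real.coe_toNNReal _ hΛ, dist_eq_norm, dist_eq_norm]
      exact hD.norm_sub_le z hz w hw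
  have hne : (𝓝[Omega re] (0 : ℂ)).NeBot := by
    rw [← mem_closure_iff_nhdsWithin_neBot, Omega, closure_ball _ hre.ne',
      mem_closedBall_iff_norm, zero_sub, norm_neg, Complex.norm_real, Real.norm_of_nonneg hre.le]
  obtain ⟨F, hF, hEq⟩ := hLip.extend_finite_dimension
  have hlim : Tendsto f (𝓝[Omega re] 0) (𝓝 (F 0)) :=
    (hF.continuous.continuousAt.mono_left nhdsWithin_le_nhds).congr'
      (eventually_mem_nhdsWithin.mono fun z hz => (hEq hz).symm)
  refine ⟨F 0, hlim, le_of_tendsto hlim.norm (eventually_mem_nhdsWithin.mono hD.norm_le),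
    fun z hz => ?_⟩
  have h1 : Tendsto (fun w => ‖f z - f w‖) (𝓝[Omega re] 0) (𝓝 ‖f z - F 0‖) :=
    (tendsto_const_nhds.sub hlim).norm
  have h2 : Tendsto (fun w => Λ * ‖z - w‖) (𝓝[Omega re] 0) (𝓝 (Λ * ‖z - 0‖)) :=
    ((continuous_const.mul (continuous_const.sub continuous_id).norm).tendsto 0).mono_left
      nhdsWithin_le_nhds
  rw [sub_zero] at h2
  exact le_of_tendsto_of_tendsto h1 h2
    (eventually_mem_nhdsWithin.mono fun w hw => hD.norm_sub_le z hz w hw)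

lemma gradient_Hd {re δ A : ℝ} {g : ℂ → ℝ} (hre : 0 < re) (hg : C2HolderBound re δ A g) {z : ℂ}
    (hz : z ∈ Omega re) : gradient (Hd re g) z = conj (complexField re g z) := by
  refine HasGradientAt.gradient ?_
  refine (hasGradientAt_re (hasDerivAt_complexPotential hre hg hz)).congr_of_eventuallyEq ?_
  filter_upwards [Metric.isOpen_ball.mem_nhds hz] with y hy
  exact Hd_eq_re_complexPotential hre hg hy

lemma eventually_mul_sqrt_le (B : ℝ) {T : ℝ} (hT : 0 < T) : ∀ᶠ ε : ℝ in 𝓝 0, B * √ε ≤ T := by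
  have h : Tendsto (fun ε : ℝ => B * √ε) (𝓝 0) (𝓝 (B * √0)) :=
    (continuous_const.mul Real.continuous_sqrt).tendsto 0
  rw [Real.sqrt_zero, mul_zero] at h
  exact h.eventually (ge_mem_nhds hT)

lemma abs_add_abs_eq_norm {z : ℂ} (hz : z.re * z.im = 0) : |z.re| + |z.im| = ‖z‖ := by
  rcases mul_eq_zero.1 hz with h | h
  · rw [h, abs_zero, zero_add, ← Complex.abs_im_eq_norm.2 h]
  · rw [h, abs_zero, add_zero, ← Complex.abs_re_eq_norm.2 h]

namespace Pencil

variable {re ri ε a b k Λ : ℝ} {g v : ℂ → ℝ} {h f : ℂ → ℂ} {H : ℂ → ℝ}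

lemma gapGradNorm_le_upper (P : Pencil re ri (ri + ε) a b) (hk : 0 < k)
    (hD : DirichletData re Λ g h f H) {f₀ : ℂ} (hf₀ : ∀ z ∈ Omega re, ‖f z - f₀‖ ≤ Λ * ‖z‖)
    (hf₀Λ : ‖f₀‖ ≤ Λ) (hv : IsSolution re ri ε k g v) :
    gapGradNorm re ri ε v ≤ ENNReal.ofReal
      (2 * (upperConst re ri * (‖f₀‖ / (1 / k + √ε)) + upperRemainder re ri * Λ)) :=
  P.gapGradNorm_le (abs_contrast_lt_one hk) hD rfl hk (one_add_contrast hk) hv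
    fun _ hz => P.norm_fieldSeries_le_upper hk hD hf₀ hf₀Λ hz

/-- The smallness assumptions are those of the imaginary case; the real case has a better constant
and needs none of them, but shares the constant $320000$. -/
lemma le_gapGradNorm_lower (P : Pencil re ri (ri + ε) a b) (hk : 1 ≤ k)
    (hD : DirichletData re Λ g h f H) {f₀ : ℂ} (hf₀ : ∀ z ∈ Omega re, ‖f z - f₀‖ ≤ Λ * ‖z‖)
    (h0 : f₀.re * f₀.im = 0) (hε : ε ≤ (re - ri) / 2)
    (hε' : 2 * √(12 * re ^ 3) / (re - ri) * √ε ≤ ri / 2)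
    (hs1 : 8 * ((2 + √(12 * re ^ 3) / (re * ri)) * (1 / k + √ε)) ≤ 1)
    (hs2 : (2 + √(12 * re ^ 3) / (re * ri)) * (1 / k + √ε) * (2 * re ^ 2) ≤ ri * (re - ri))
    (hv : IsSolution re ri ε k g v) :
    ENNReal.ofReal (‖f₀‖ / (lowerConst re ri * (1 / k + √ε)) - remainderConst re ri * Λ)
      ≤ gapGradNorm re ri ε v := by
  have hk0 : 0 < k := by linarith
  have hσle := P.one_sub_contrast_mul_le hk0
  have hσ : 0 < 1 - contrast k * multiplier re (ri + ε) a b := by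
    have h1 := P.multiplier_lt_one
    have h2 := P.multiplier_pos
    have h3 := contrast_nonneg hk
    have h4 := (abs_lt.1 (abs_contrast_lt_one hk0)).2
    nlinarith
  have hre := P.re_pos
  set σ := 1 - contrast k * multiplier re (ri + ε) a b with hσdef
  have hkey : ‖f₀‖ / (lowerConst re ri * (1 / k + √ε)) ≤ ‖f₀‖ * (1 / 320000 / σ) := by
    rw [div_div, mul_one_div]
    refine div_le_div_of_nonneg_left (norm_nonneg _) (by positivity) ?_
    rw [lowerConst, mul_assoc]
    gcongr
  obtain ⟨z, hz, hle⟩ : ∃ z : ℂ, ‖z - (ri + ε : ℝ)‖ = ri ∧ ‖f₀‖ * (1 / 320000 / σ)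
      ≤ |(f₀ * weightSum (contrast k) (multiplier re (ri + ε) a b) (chart a b z)
          * unitNormal (chart a b z)).re| := by
    rcases mul_eq_zero.1 h0 with h | h
    · refine P.exists_imaginary_point hk h ?_ ?_ hε ((P.sub_le_sqrt hε).trans hε')
      · exact (mul_le_mul_of_nonneg_left hσle (by norm_num)).trans hs1
      · exact (mul_le_mul_of_nonneg_right hσle (by positivity)).trans hs2
    · obtain ⟨z, hz, hle⟩ := P.exists_real_point hk h
      refine ⟨z, hz, le_trans ?_ hle⟩
      rw [div_eq_mul_one_div ‖f₀‖]
      gcongr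
      norm_num
  have h1 := P.norm_leading_le hk hε hD hf₀ hz
  exact (ENNReal.ofReal_le_ofReal (by linarith)).trans
    (P.le_gapGradNorm (abs_contrast_lt_one hk0) hD rfl hk0 (one_add_contrast hk0) hv hz)

end Pencil

section

variable {re ri Λ : ℝ} {g : ℂ → ℝ} {h f : ℂ → ℂ} {H : ℂ → ℝ} {f₀ : ℂ}

lemma exists_gapGradNorm_le (hri : 0 < ri) (hre : ri < re) (hD : DirichletData re Λ g h f H)
    (hf₀ : ∀ z ∈ Omega re, ‖f z - f₀‖ ≤ Λ * ‖z‖) (hf₀Λ : ‖f₀‖ ≤ Λ) (hne : f₀ ≠ 0) :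
    ∃ ε₀ k₀ : ℝ, 0 < ε₀ ∧ 0 < k₀ ∧ ∀ ε k : ℝ, 0 < ε → ε < ε₀ → ε < re - ri → k₀ < k →
      ∀ v : ℂ → ℝ, IsSolution re ri ε k g v → gapGradNorm re ri ε v
        ≤ ENNReal.ofReal (4 * upperConst re ri * (‖f₀‖ / (1 / k + √ε))) := by
  have hR := upperRemainder_nonneg hri hre
  have hU := upperConst_pos re ri
  have hn : 0 < ‖f₀‖ := norm_pos_iff.2 hne
  have hΛ : 0 < Λ := hn.trans_le hf₀Λ
  -- Once $1/k+\sqrt\epsilon\le X$, the remainder is at most the leading term. The $+1$ makes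
  -- $(1/k+\sqrt\epsilon)$ times the remainder comparable without dividing by a possibly zero
  -- constant.
  set X := upperConst re ri * ‖f₀‖ / (upperRemainder re ri * Λ + 1) with hX
  have hX0 : 0 < X := by positivity
  refine ⟨(X / 2) ^ 2, 2 / X, by positivity, by positivity, fun ε k hε hε₀ hεr hk v hv => ?_⟩
  have hk0 : 0 < k := lt_trans (by positivity) hk
  obtain ⟨a, b, P⟩ := exists_pencil (re := re) (c := ri + ε) hri (by linarith) (by linarith)
  refine (P.gapGradNorm_le_upper hk0 hD hf₀ hf₀Λ hv).trans (ENNReal.ofReal_le_ofReal ?_)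
  have h1 : √ε ≤ X / 2 := (Real.sqrt_le_left (by positivity)).2 hε₀.le
  have h2 : 1 / k ≤ X / 2 := by
    rw [div_lt_iff₀ hX0] at hk
    rw [div_le_div_iff₀ hk0 two_pos]
    linarith
  have hs : 0 < 1 / k + √ε := by positivity
  have h3 : upperRemainder re ri * Λ * (1 / k + √ε) ≤ upperConst re ri * ‖f₀‖ := by
    have h4 : (upperRemainder re ri * Λ + 1) * X = upperConst re ri * ‖f₀‖ := by
      rw [hX]
      field_simp
    rw [← h4]
    gcongr <;> linarith
  have h5 : upperRemainder re ri * Λ ≤ upperConst re ri * (‖f₀‖ / (1 / k + √ε)) := by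
    rwa [← mul_div_assoc, le_div_iff₀ hs]
  linarith

/-- The condition $\epsilon^{-1}\le Mk^2$ means $1/k\le\sqrt M\sqrt\epsilon$. Small $\epsilon$ alone
thus forces $k\ge1$, makes $1/k+\sqrt\epsilon$ small, and lets half of the leading term absorb the
remainder. -/
lemma exists_le_gapGradNorm (hri : 0 < ri) (hre : ri < re) (hD : DirichletData re Λ g h f H)
    (hf₀ : ∀ z ∈ Omega re, ‖f z - f₀‖ ≤ Λ * ‖z‖) (h0 : f₀.re * f₀.im = 0) {M : ℝ} (hM : 0 < M) :
    ∃ ε₀ : ℝ, 0 < ε₀ ∧ ∀ ε k : ℝ, 0 < ε → ε < ε₀ → ε < re - ri → 0 < k → ε⁻¹ ≤ M * k ^ 2 →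
      ∀ v : ℂ → ℝ, IsSolution re ri ε k g v →
        ENNReal.ofReal (‖f₀‖ / (2 * lowerConst re ri * (1 / k + √ε)))
          ≤ gapGradNorm re ri ε v := by
  rcases eq_or_ne f₀ 0 with rfl | hne
  · exact ⟨1, one_pos, fun ε k _ _ _ _ _ v _ => by simp⟩
  have hre0 : 0 < re := hri.trans hre
  have hsub : 0 < re - ri := sub_pos.2 hre
  have hn : 0 < ‖f₀‖ := norm_pos_iff.2 hne
  have hL := lowerConst_pos hri hre
  have hR := remainderConst_nonneg hri hre
  have hΛ : 0 ≤ Λ := (norm_nonneg _).trans (hD.norm_le re (Metric.mem_ball_self hre0))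
  set c := 2 + √(12 * re ^ 3) / (re * ri) with hc
  have hc0 : 0 < c := by positivity
  obtain ⟨ε₀, hε₀, hall⟩ := Metric.eventually_nhds_iff.1 <|
    ((eventually_le_nhds (half_pos hsub)).and <| (eventually_mul_sqrt_le √M one_pos).and <|
    (eventually_mul_sqrt_le (2 * √(12 * re ^ 3) / (re - ri)) (half_pos hri)).and <|
    (eventually_mul_sqrt_le (8 * (c * (√M + 1))) one_pos).and <|
    (eventually_mul_sqrt_le (c * (√M + 1) * (2 * re ^ 2)) (mul_pos hri hsub)).and
    (eventually_mul_sqrt_le (remainderConst re ri * Λ * (2 * lowerConst re ri) * (√M + 1)) hn) :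
      ∀ᶠ ε : ℝ in 𝓝 0, _)
  refine ⟨ε₀, hε₀, fun ε k hε hεε₀ hεr hk hM' v hv => ?_⟩
  obtain ⟨h1, h2, h3, h4, h5, h6⟩ := hall (y := ε) (by
    rwa [Real.dist_eq, sub_zero, abs_of_pos hε])
  have hsε : 0 < √ε := Real.sqrt_pos.2 hε
  have hk1 : 1 / k ≤ √M * √ε := by
    rw [← Real.sqrt_mul hM.le]
    refine Real.le_sqrt_of_sq_le ?_
    rw [div_pow, one_pow, div_le_iff₀ (by positivity)]
    rw [inv_le_iff_one_le_mul₀ hε] at hM'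
    linarith
  have hk : 1 ≤ k := by
    have := hk1.trans h2
    rwa [div_le_one hk] at this
  have hs : 1 / k + √ε ≤ (√M + 1) * √ε := by linarith
  have hs0 : 0 < 1 / k + √ε := by positivity
  obtain ⟨a, b, P⟩ := exists_pencil (re := re) (c := ri + ε) hri (by linarith) (by linarith)
  refine le_trans (ENNReal.ofReal_le_ofReal ?_)
    (P.le_gapGradNorm_lower hk hD hf₀ h0 h1 h3 ?_ ?_ hv)
  · have h7 : remainderConst re ri * Λ * (2 * lowerConst re ri * (1 / k + √ε)) ≤ ‖f₀‖ := by
      refine le_trans ?_ h6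
      rw [mul_assoc _ (√M + 1), mul_assoc _ (2 * lowerConst re ri)]
      gcongr
    have h8 : remainderConst re ri * Λ ≤ ‖f₀‖ / (2 * lowerConst re ri * (1 / k + √ε)) := by
      rwa [le_div_iff₀ (by positivity)]
    have h9 : ‖f₀‖ / (lowerConst re ri * (1 / k + √ε))
        = 2 * (‖f₀‖ / (2 * lowerConst re ri * (1 / k + √ε))) := by
      field_simp
    linarith
  · refine le_trans ?_ h4
    rw [mul_assoc, mul_assoc c]
    gcongr
  · refine le_trans ?_ h5
    rw [mul_right_comm _ (2 * re ^ 2), mul_assoc c (√M + 1)]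
    gcongr

end

end

end NearlyTouchingDisks

end

/-! ### Assembly of the main theorem -/

open NearlyTouchingDisks in
theorem mainTheorem5 (re ri : ℝ) (hri : 0 < ri) (hre : ri < re) :
    ∃ C : ℝ, 0 < C ∧ ∀ δ : ℝ, 1 / 2 < δ → ∃ K : ℝ, 0 ≤ K ∧
      ∀ (g : ℂ → ℝ) (A : ℝ), NearlyTouchingDisks.C2HolderBound re δ A g →
        Real.circleAverage g (re : ℂ) re = 0 →
        ∃ C₁ C₂ : ℝ,
          -- the gradient of the unperturbed solution extends to the origin by `(C₁, C₂)`
          Tendsto (gradient (NearlyTouchingDisks.Hd re g))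
            (𝓝[NearlyTouchingDisks.Omega re] 0) (𝓝 (⟨C₁, C₂⟩ : ℂ)) ∧
          -- upper bound for all parameters, up to a remainder bounded uniformly in `ε` and `k`
          (∀ ε k : ℝ, 0 < ε → ε < re - ri → 0 < k →
            ∀ v : ℂ → ℝ, NearlyTouchingDisks.IsSolution re ri ε k g v →
              NearlyTouchingDisks.gapGradNorm re ri ε v ≤
                ENNReal.ofReal (C * ((|C₁| + |C₂|) / (1 / k + √ε)) + K * A)) ∧
          -- upper bound without remainder in the blow-up regime
          ((C₁, C₂) ≠ (0, 0) →
            ∃ ε₀ k₀ : ℝ, 0 < ε₀ ∧ 0 < k₀ ∧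
              ∀ ε k : ℝ, 0 < ε → ε < ε₀ → ε < re - ri → k₀ < k →
                ∀ v : ℂ → ℝ, NearlyTouchingDisks.IsSolution re ri ε k g v →
                  NearlyTouchingDisks.gapGradNorm re ri ε v ≤
                    ENNReal.ofReal (C * ((|C₁| + |C₂|) / (1 / k + √ε)))) ∧
          -- optimality
          (C₁ * C₂ = 0 →
            ∀ M : ℝ, 0 < M → ∃ ε₀ : ℝ, 0 < ε₀ ∧
              ∀ ε k : ℝ, 0 < ε → ε < ε₀ → ε < re - ri → 0 < k → ε⁻¹ ≤ M * k ^ 2 →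
                ∀ v : ℂ → ℝ, NearlyTouchingDisks.IsSolution re ri ε k g v →
                  ENNReal.ofReal ((|C₁| + |C₂|) / (C * (1 / k + √ε))) ≤
                    NearlyTouchingDisks.gapGradNorm re ri ε v) := by
  have hre0 : 0 < re := hri.trans hre
  have hU := upperConst_pos re ri
  have hL := lowerConst_pos hri hre
  have hR := upperRemainder_nonneg hri hre
  set C := 4 * upperConst re ri + 2 * lowerConst re ri with hC
  refine ⟨C, by positivity, fun δ hδ => ?_⟩
  obtain ⟨K, hK, hdata⟩ := exists_dirichletData hre0 (by linarith : 0 < δ)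
  refine ⟨2 * upperRemainder re ri * K, by positivity, fun g A hg hmean => ?_⟩
  obtain ⟨H, hD⟩ := hdata g A hg hmean
  obtain ⟨f₀, hlim, hf₀Λ, hf₀⟩ := hD.exists_limit hre0
  have hnorm : ‖f₀‖ ≤ |f₀.re| + |-f₀.im| := by
    rw [abs_neg]
    exact Complex.norm_le_abs_re_add_abs_im f₀
  -- The sign of the second component arises because the gradient of $\mathrm{Re}\,h$ is the
  -- conjugate of $h'$.
  refine ⟨f₀.re, -f₀.im, ?_, fun ε k hε hεr hk v hv => ?_, fun hne => ?_, fun h0 M hM => ?_⟩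
  · refine Tendsto.congr' ?_ ((Complex.continuous_conj.tendsto f₀).comp hlim)
    filter_upwards [eventually_mem_nhdsWithin] with z hz using (gradient_Hd hre0 hg hz).symm
  · obtain ⟨a, b, P⟩ := exists_pencil (re := re) (c := ri + ε) hri (by linarith) (by linarith)
    refine (P.gapGradNorm_le_upper hk hD hf₀ hf₀Λ hv).trans (ENNReal.ofReal_le_ofReal ?_)
    have h1 : 2 * upperConst re ri * (‖f₀‖ / (1 / k + √ε))
        ≤ C * ((|f₀.re| + |-f₀.im|) / (1 / k + √ε)) := by
      gcongr
      linarith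
    linarith
  · have hf : f₀ ≠ 0 := by
      rintro rfl
      simp at hne
    obtain ⟨ε₀, k₀, hε₀, hk₀, hle⟩ := exists_gapGradNorm_le hri hre hD hf₀ hf₀Λ hf
    refine ⟨ε₀, k₀, hε₀, hk₀, fun ε k hε h1 h2 h3 v hv => (hle ε k hε h1 h2 h3 v hv).trans
      (ENNReal.ofReal_le_ofReal ?_)⟩
    have hk : 0 < k := hk₀.trans h3
    gcongr
    linarith
  · have h0' : f₀.re * f₀.im = 0 := by linarith
    obtain ⟨ε₀, hε₀, hle⟩ := exists_le_gapGradNorm hri hre hD hf₀ h0' hM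
    refine ⟨ε₀, hε₀, fun ε k hε h1 h2 hk h3 v hv => le_trans
      (ENNReal.ofReal_le_ofReal ?_) (hle ε k hε h1 h2 hk h3 v hv)⟩
    rw [abs_neg, abs_add_abs_eq_norm h0']
    gcongr
    linarith
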